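/- Let $H$ denote the Hilbert transform in the variable $x$, $Hf(x)=\mathrm{p.v.}\,\frac1\pi\int\frac{f(y)}{x-y}\,dy$ (symbol $-i\,\mathrm{sgn}\,\xi$), and for $s\in\mathbb R$ let $D_x^s$ and $J_x^s$ be the Fourier multipliers on $\mathbb R^2$ with symbols $|\xi|^s$ and $(1+|\xi|^2)^{s/2}$, where $(\xi,\eta)$ are the frequencies dual to $(x,y)$. Let $X^3$ be the space of all $\varphi\in L^2(\mathbb R^2)$ with $\int_{\mathbb R^2}(1+|\xi|^{-2})\big((1+\xi^2)^3+(1+\eta^2)^3\big)|\widehat\varphi|^2\,d\xi\,d\eta<\infty$; the operator $A_\alpha=\partial_x^3-HD_x^\alpha\partial_y^2$ maps $X^3$ into $L^2$ for $-1\le\alpha\le1$ and is skew-adjoint. For every $\epsilon\in(0,1)$ there is a constant $c_\epsilon>0$, depending only on $\epsilon$, such that the following holds for all $\alpha\in[-1,1]$ and all $T>0$. Let $w\in C([0,T];L^2(\mathbb R^2))$ and $F\in L^1([0,T];L^2(\mathbb R^2))$ (complex valued), and let $w$ be a solution of $$\partial_t w=\partial_x^3w-HD_x^{\alpha}\partial_y^2w+F$$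 in the dual of $X^3$, that is, for all $\varphi\in X^3$ and $t\in[0,T]$, $$(w(t),\varphi)_{L^2}=(w(0),\varphi)_{L^2}+\int_0^t\big(-(w(s),A_\alpha\varphi)_{L^2}+(F(s),\varphi)_{L^2}\big)\,ds .$$ Then $$\int_0^T\|\partial_xw(t)\|_{L^\infty(\mathbb R^2)}\,dt\le c_\epsilon\,T^{\frac{7+2\epsilon}{12}}\left(\sup_{t\in[0,T]}\big\|J_x^{\frac{17}{12}-\frac\alpha4+\frac{2\epsilon}3}w(t)\big\|_{L^2(\mathbb R^2)}+\int_0^T\big\|D_x^{\frac5{12}-\frac\alpha4+\frac{2\epsilon}3}F(t)\big\|_{L^2(\mathbb R^2)}\,dt\right),$$ where a norm is $+\infty$ if the function or distribution in question does not belong to the space. -/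

import Mathlib

open MeasureTheory FourierTransform LineDeriv Set
open scoped ENNReal SchwartzMap ComplexInnerProductSpace

noncomputable section

namespace ZKKP

/-- The plane `ℝ²`; coordinate `0` is `x`, coordinate `1` is `y`. -/
abbrev Plane : Type := EuclideanSpace ℝ (Fin 2)

/-- `L²(ℝ²)`, complex valued. -/
abbrev L2 : Type := Lp ℂ 2 (volume : Measure Plane)

/-- The frequency `ξ` dual to `x`. Mathlib's Fourier transform has kernel `exp (-2πi ⟨x, ζ⟩)`, so that
`ξ = 2π ζ₀` is the variable for which `∂_x` has the symbol `i ξ`. -/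
def freqX (ζ : Plane) : ℝ := 2 * Real.pi * ζ 0

/-- The frequency `η = 2π ζ₁` dual to `y`. -/
def freqY (ζ : Plane) : ℝ := 2 * Real.pi * ζ 1

/-- `‖m(D) f‖_{L²}`, where `m(D)` is the Fourier multiplier with symbol `m`
(it is `∞` if `m · f̂` is not in `L²`). -/
def multiplierNorm (m : Plane → ℝ) (f : L2) : ℝ≥0∞ :=
  eLpNorm (fun ζ => (m ζ : ℂ) * (𝓕 f : L2) ζ) 2 volume

/-- `‖D_x^s f‖_{L²}`, where `D_x^s` has the symbol `|ξ|^s`. -/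
def normDx (s : ℝ) (f : L2) : ℝ≥0∞ :=
  multiplierNorm (fun ζ => |freqX ζ| ^ s) f

/-- `‖J_x^s f‖_{L²}`, where `J_x^s` has the symbol `(1 + |ξ|²)^(s/2)`. -/
def normJx (s : ℝ) (f : L2) : ℝ≥0∞ :=
  multiplierNorm (fun ζ => (1 + |freqX ζ| ^ 2) ^ (s / 2)) f

/-- `‖∂_x f‖_{L^∞}`, where `∂_x f` is the distributional derivative: the norm of the element of
`L^∞` that represents `∂_x f`, and `∞` if there is none. -/
def supNormDerivX (f : L2) : ℝ≥0∞ :=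
  ⨅ (g : Lp ℂ ∞ (volume : Measure Plane))
    (_ : (g : 𝓢'(Plane, ℂ)) = ∂_{EuclideanSpace.single (0 : Fin 2) (1 : ℝ)} (f : 𝓢'(Plane, ℂ))),
    ‖g‖ₑ

/-- The symbol `-i sgn ξ` of the Hilbert transform `H` in `x`, `H f = p.v. (1/π) ∫ f(y)/(x-y) dy`. -/
def hilbertSymbol (ζ : Plane) : ℂ := -Complex.I * (Real.sign (freqX ζ) : ℂ)

/-- The symbol of `∂_x³ - H D_x^α ∂_y²`. -/
def linSymbol (α : ℝ) (ζ : Plane) : ℂ :=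
  (Complex.I * (freqX ζ : ℂ)) ^ 3
    - hilbertSymbol ζ * ((|freqX ζ| ^ α : ℝ) : ℂ) * (Complex.I * (freqY ζ : ℂ)) ^ 2

/-- The test space `X³ = {φ ∈ H³ : ∂_x⁻¹ φ ∈ H³}`, as a condition on `φ ∈ L²`. -/
def MemX3 (φ : L2) : Prop :=
  ∫⁻ ζ, ENNReal.ofReal
    ((1 + (freqX ζ ^ 2)⁻¹) * ((1 + freqX ζ ^ 2) ^ 3 + (1 + freqY ζ ^ 2) ^ 3)
      * ‖(𝓕 φ : L2) ζ‖ ^ 2) < ∞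

/-- `w ∈ C([0,T]; L²)` solves `∂_t w = ∂_x³ w - H D_x^α ∂_y² w + F` with `F ∈ L¹([0,T]; L²)`, where
the equation holds in the dual of `X³`. It is written in the form integrated in time, and `ψ` below
is `(∂_x³ - H D_x^α ∂_y²) φ`; this operator is skew-adjoint, which gives the minus sign.
The inner product `⟪·, ·⟫` is conjugate linear in its first entry. -/
structure IsSolution (α T : ℝ) (w F : ℝ → L2) : Prop where
  continuousOn : ContinuousOn w (Icc 0 T)
  integrableOn : IntegrableOn F (Icc 0 T)
  equation : ∀ φ ψ : L2, MemX3 φ →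
    ((𝓕 ψ : L2) : Plane → ℂ) =ᵐ[volume] (fun ζ => linSymbol α ζ * (𝓕 φ : L2) ζ) →
    ∀ t ∈ Icc 0 T, ⟪φ, w t⟫ = ⟪φ, w 0⟫ + ∫ s in (0 : ℝ)..t, (-⟪ψ, w s⟫ + ⟪φ, F s⟫)

end ZKKP

end

noncomputable section

namespace ZKKP

/-! ### Oscillatory integrals -/

/-! The estimate is a Strichartz bound for each dyadic band `|ξ| ∼ R`, applied on time intervals of
length about `T / R` when `R ≥ 1` and then summed over the bands.

On one band, consider the kernel of `∂_x² e^{tA}`. The `η` integral is a complex Gaussian, which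
yields `|t|^(-1/2) r^(-α/2)` and turns the phase in `r = |ξ|` into `X r + s (r³ - q r^(-α))` with
`|s| = |t|` and `q ≥ 0`. For `α ≥ 0` the third derivative of this phase has no cancellation, and for
`α ≤ 0` neither has the second. Van der Corput's lemma, interpolated with the trivial bound `R`,
gives `R^ε |t|^(-(1-ε)/3)` in both cases, uniformly in `X` and `q`
(`norm_integral_exp_kerPhase_le`). Hence the kernel is at most a constant times `R^(2-α/2+ε)
|t|^(-(5/6-ε/3))` (`norm_fourier_bandMult_le`, `norm_inner_grp_bandTest_le`).

The singularity in time is integrable, so the `TT*` argument bounds `∂_x` of a band of `w` in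
`L¹L^∞`, on an interval of length `L`, by `R^(1-α/4+ε/2) L^(7/12+ε/6)` times the `L²` norm at the
left endpoint plus the `L¹L²` norm of the forcing (`IsDispersive.lintegral_iSup_le`,
`lintegral_dualNorm_bandPart_le`). The `L^∞` norm is a supremum over a countable dense family of
test functions, and a measurable choice of near-optimal test functions makes the bound linear. The
Duhamel formula that this requires follows from the weak equation (`duhamel_of_weak`, `duhamel`).

For `R ≥ 1`, splitting `[0, T]` into `R` equal pieces costs a factor `R` in front of the endpoint
terms but none in front of the forcing, and each piece gains `R^(-(7/12+ε/6))`. This produces the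
orders `17/12 - α/4` and `5/12 - α/4`; the surplus `2ε/3` leaves a factor `R^(-ε/3)`. For `R ≤ 1`
one piece suffices and leaves at most `R^(ε/3)`. The resulting geometric series gives the constant
(`exists_partition_size`, `lintegral_dualNorm_bandPart_le_geometric`). -/

theorem norm_intervalIntegral_mul_le_of_deriv_nonneg {F : ℝ → ℂ} {ψ ψ' : ℝ → ℝ} {a b M B : ℝ}
    (hab : a ≤ b) (hF : Continuous F)
    (hψ : ∀ x ∈ Icc a b, HasDerivAt ψ (ψ' x) x) (hψ' : ContinuousOn ψ' (Icc a b))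
    (hpos : ∀ x ∈ Icc a b, 0 ≤ ψ' x) (hB : ∀ x ∈ Icc a b, |ψ x| ≤ B)
    (hM : ∀ x ∈ Icc a b, ‖∫ t in a..x, F t‖ ≤ M) :
    ‖∫ t in a..b, F t * (ψ t : ℂ)‖ ≤ 3 * B * M := by
  have ha : a ∈ Icc a b := left_mem_Icc.2 hab
  have hb : b ∈ Icc a b := right_mem_Icc.2 hab
  have hB0 : 0 ≤ B := (abs_nonneg _).trans (hB a ha)
  have hM0 : 0 ≤ M := (norm_nonneg _).trans (hM a ha)
  have hψi : IntervalIntegrable ψ' volume a b :=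
    ContinuousOn.intervalIntegrable (by rwa [uIcc_of_le hab])
  -- Integration by parts against the primitive of `F`: the boundary term costs `B * M`, and the
  -- total variation `ψ b - ψ a ≤ 2 * B` of the monotone weight costs the rest.
  have key := intervalIntegral.integral_deriv_mul_eq_sub (a := a) (b := b)
    (u := fun x => ∫ t in a..x, F t) (u' := F) (v := fun x => (ψ x : ℂ))
    (v' := fun x => (ψ' x : ℂ))
    (fun x _ => intervalIntegral.integral_hasDerivAt_right (hF.intervalIntegrable _ _)
      (hF.stronglyMeasurableAtFilter _ _) hF.continuousAt)
    (fun x hx => (hψ x (by rwa [uIcc_of_le hab] at hx)).ofReal_comp)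
    (hF.intervalIntegrable _ _)
    (ContinuousOn.intervalIntegrable (by
      rw [uIcc_of_le hab]; exact Complex.continuous_ofReal.comp_continuousOn hψ'))
  have hΨc : Continuous (fun x => ∫ t in a..x, F t) :=
    intervalIntegral.continuous_primitive (fun _ _ => hF.intervalIntegrable _ _) _
  have hψc : ContinuousOn ψ (uIcc a b) := by
    rw [uIcc_of_le hab]; exact fun x hx => (hψ x hx).continuousAt.continuousWithinAt
  have hi1 : IntervalIntegrable (fun t => F t * (ψ t : ℂ)) volume a b :=
    ContinuousOn.intervalIntegrable
      (hF.continuousOn.mul (Complex.continuous_ofReal.comp_continuousOn hψc))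
  have hi2 : IntervalIntegrable (fun t => (∫ u in a..t, F u) * (ψ' t : ℂ)) volume a b := by
    apply ContinuousOn.intervalIntegrable
    rw [uIcc_of_le hab]
    exact hΨc.continuousOn.mul (Complex.continuous_ofReal.comp_continuousOn hψ')
  rw [intervalIntegral.integral_add hi1 hi2] at key
  have hftc : ∫ t in a..b, ψ' t = ψ b - ψ a :=
    intervalIntegral.integral_eq_sub_of_hasDerivAt
      (fun x hx => hψ x (by rwa [uIcc_of_le hab] at hx)) hψi
  have h2 : ‖∫ t in a..b, (∫ u in a..t, F u) * (ψ' t : ℂ)‖ ≤ M * (ψ b - ψ a) := by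
    rw [← hftc, ← intervalIntegral.integral_const_mul]
    apply intervalIntegral.norm_integral_le_of_norm_le hab _ (hψi.const_mul M)
    filter_upwards with t ht
    have ht' : t ∈ Icc a b := Ioc_subset_Icc_self ht
    rw [norm_mul, Complex.norm_real, Real.norm_of_nonneg (hpos t ht')]
    exact mul_le_mul_of_nonneg_right (hM t ht') (hpos t ht')
  have h1 : ‖(∫ t in a..b, F t) * (ψ b : ℂ)‖ ≤ M * B := by
    rw [norm_mul, Complex.norm_real]
    exact mul_le_mul (hM b hb) (hB b hb) (norm_nonneg _) hM0
  have h3 : ∫ t in a..b, F t * (ψ t : ℂ) = (∫ t in a..b, F t) * (ψ b : ℂ)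
      - ∫ t in a..b, (∫ u in a..t, F u) * (ψ' t : ℂ) := by
    rw [eq_sub_iff_add_eq, key]; simp
  rw [h3]
  refine (norm_sub_le _ _).trans ?_
  have := abs_le.1 (hB a ha)
  have := abs_le.1 (hB b hb)
  nlinarith

theorem norm_intervalIntegral_mul_le_of_deriv_nonpos {F : ℝ → ℂ} {ψ ψ' : ℝ → ℝ} {a b M B : ℝ}
    (hab : a ≤ b) (hF : Continuous F)
    (hψ : ∀ x ∈ Icc a b, HasDerivAt ψ (ψ' x) x) (hψ' : ContinuousOn ψ' (Icc a b))
    (hneg : ∀ x ∈ Icc a b, ψ' x ≤ 0) (hB : ∀ x ∈ Icc a b, |ψ x| ≤ B)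
    (hM : ∀ x ∈ Icc a b, ‖∫ t in a..x, F t‖ ≤ M) :
    ‖∫ t in a..b, F t * (ψ t : ℂ)‖ ≤ 3 * B * M := by
  have := norm_intervalIntegral_mul_le_of_deriv_nonneg (ψ := fun x => -ψ x)
    (ψ' := fun x => -ψ' x) hab hF (fun x hx => (hψ x hx).neg) hψ'.neg
    (fun x hx => by have := hneg x hx; linarith) (fun x hx => by simpa using hB x hx) hM
  simpa using this

/-- The point `c` is a zero of `g` if there is one, and otherwise the endpoint at which `g` comes
closest to changing sign. It is the centre of the window removed in van der Corput's lemma. -/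
theorem exists_signed_lower_bound {g : ℝ → ℝ} {a b l : ℝ} (hab : a ≤ b)
    (hg : ContinuousOn g (Icc a b))
    (hl : ∀ x ∈ Icc a b, ∀ y ∈ Icc a b, x ≤ y → l * (y - x) ≤ g y - g x) :
    ∃ c ∈ Icc a b, (∀ x ∈ Icc a b, c < x → l * (x - c) ≤ g x) ∧
      (∀ x ∈ Icc a b, x < c → g x ≤ -(l * (c - x))) := by
  have ha : a ∈ Icc a b := left_mem_Icc.2 hab
  have hb : b ∈ Icc a b := right_mem_Icc.2 hab
  by_cases h1 : 0 ≤ g a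
  · refine ⟨a, ha, fun x hx hx' => ?_, fun x hx hx' => absurd hx.1 (not_le.2 hx')⟩
    have := hl a ha x hx hx.1; linarith
  by_cases h2 : g b ≤ 0
  · refine ⟨b, hb, fun x hx hx' => absurd hx.2 (not_le.2 hx'), fun x hx hx' => ?_⟩
    have := hl x hx b hb hx.2; linarith
  obtain ⟨c, hc, hc0⟩ := intermediate_value_Icc hab hg ⟨(not_le.1 h1).le, (not_le.1 h2).le⟩
  refine ⟨c, hc, fun x hx hx' => ?_, fun x hx hx' => ?_⟩
  · have := hl c hc x hx hx'.le; linarith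
  · have := hl x hx c hc hx'.le; linarith

/-- The window of radius `δ` about `c` contributes at most its length, and each of the two sides at
most `M`. -/
theorem norm_intervalIntegral_le_of_away {f : ℝ → ℂ} (hf : Continuous f) (hf1 : ∀ x, ‖f x‖ ≤ 1)
    {a b c δ M : ℝ} (hab : a ≤ b) (hδ : 0 < δ) (hM0 : 0 ≤ M)
    (hleft : ∀ v, a ≤ v → v ≤ b → v ≤ c - δ → ‖∫ t in a..v, f t‖ ≤ M)
    (hright : ∀ u, a ≤ u → u ≤ b → c + δ ≤ u → ‖∫ t in u..b, f t‖ ≤ M) :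
    ‖∫ t in a..b, f t‖ ≤ 2 * M + 2 * δ := by
  have hi : ∀ u v, IntervalIntegrable f volume u v := fun u v => hf.intervalIntegrable u v
  have hmid : ∀ u v, ‖∫ t in u..v, f t‖ ≤ |v - u| := fun u v => by
    simpa using intervalIntegral.norm_integral_le_of_norm_le_const (a := u) (b := v) (C := 1)
      (f := f) (fun x _ => hf1 x)
  -- Clamping to `[a, b]` covers windows that stick out of the interval or miss it: the pieces
  -- concerned become degenerate.
  set u := max a (min b (c - δ)) with hu
  set v := max u (min b (c + δ)) with hv
  have hau : a ≤ u := le_max_left _ _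
  have hub : u ≤ b := max_le hab (min_le_left _ _)
  have huv : u ≤ v := le_max_left _ _
  have hvb : v ≤ b := max_le hub (min_le_left _ _)
  have e1 := intervalIntegral.integral_add_adjacent_intervals (hi a u) (hi u v)
  have e2 := intervalIntegral.integral_add_adjacent_intervals (hi a v) (hi v b)
  have n1 : ‖∫ t in a..u, f t‖ ≤ M := by
    rcases le_total a (min b (c - δ)) with h | h
    · refine hleft u hau hub ?_
      rw [hu, max_eq_right h]; exact min_le_right _ _
    · rw [hu, max_eq_left h]; simpa using hM0
  have n3 : ‖∫ t in v..b, f t‖ ≤ M := by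
    rcases le_total b (c + δ) with h | h
    · have : v = b := le_antisymm hvb (by rw [hv, min_eq_left h]; exact le_max_right _ _)
      rw [this]; simpa using hM0
    · exact hright v (hau.trans huv) hvb (by rw [hv, min_eq_right h]; exact le_max_right _ _)
  have n2 : ‖∫ t in u..v, f t‖ ≤ 2 * δ := by
    refine (hmid u v).trans ?_
    rw [abs_of_nonneg (by linarith)]
    rcases le_total u (min b (c + δ)) with h | h
    · rw [hv, max_eq_right h]
      have h1 : min b (c + δ) ≤ c + δ := min_le_right _ _
      have h2 : min b (c + δ) ≤ b := min_le_left _ _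
      have h3 : min b (c - δ) ≤ u := le_max_right _ _
      rcases le_total b (c - δ) with h' | h'
      · rw [min_eq_left h'] at h3; linarith
      · rw [min_eq_right h'] at h3; linarith
    · rw [hv, max_eq_left h]; linarith
  rw [← e2, ← e1]
  refine (norm_add_le _ _).trans ?_
  have := norm_add_le (∫ t in a..u, f t) (∫ t in u..v, f t)
  linarith

theorem continuous_exp_I_mul {φ : ℝ → ℝ} (hφ : Continuous φ) :
    Continuous (fun t => Complex.exp (Complex.I * φ t)) := by fun_prop

/-- A phase together with its first three derivatives on `[a, b]`. -/
structure IsPhase (φ φ₁ φ₂ φ₃ : ℝ → ℝ) (a b : ℝ) : Prop where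
  cont : Continuous φ
  cont₃ : ContinuousOn φ₃ (Icc a b)
  deriv : ∀ x ∈ Icc a b, HasDerivAt φ (φ₁ x) x
  deriv₁ : ∀ x ∈ Icc a b, HasDerivAt φ₁ (φ₂ x) x
  deriv₂ : ∀ x ∈ Icc a b, HasDerivAt φ₂ (φ₃ x) x

namespace IsPhase

variable {φ φ₁ φ₂ φ₃ : ℝ → ℝ} {a b δ : ℝ}

theorem mono (h : IsPhase φ φ₁ φ₂ φ₃ a b) {a' b' : ℝ} (ha : a ≤ a') (hb : b' ≤ b) :
    IsPhase φ φ₁ φ₂ φ₃ a' b' := by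
  have hs : Icc a' b' ⊆ Icc a b := Icc_subset_Icc ha hb
  exact ⟨h.cont, h.cont₃.mono hs, fun x hx => h.deriv x (hs hx), fun x hx => h.deriv₁ x (hs hx),
    fun x hx => h.deriv₂ x (hs hx)⟩

theorem neg (h : IsPhase φ φ₁ φ₂ φ₃ a b) :
    IsPhase (fun x => -φ x) (fun x => -φ₁ x) (fun x => -φ₂ x) (fun x => -φ₃ x) a b :=
  ⟨h.cont.neg, h.cont₃.neg, fun x hx => (h.deriv x hx).neg, fun x hx => (h.deriv₁ x hx).neg,
    fun x hx => (h.deriv₂ x hx).neg⟩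

theorem cont₁ (h : IsPhase φ φ₁ φ₂ φ₃ a b) : ContinuousOn φ₁ (Icc a b) :=
  fun x hx => (h.deriv₁ x hx).continuousAt.continuousWithinAt

theorem cont₂ (h : IsPhase φ φ₁ φ₂ φ₃ a b) : ContinuousOn φ₂ (Icc a b) :=
  fun x hx => (h.deriv₂ x hx).continuousAt.continuousWithinAt

/-- Reversing the phase conjugates the integrand; this reduces negative derivatives to positive
ones. -/
theorem norm_integral_neg (φ : ℝ → ℝ) (a b : ℝ) :
    ‖∫ t in a..b, Complex.exp (Complex.I * ((-φ t : ℝ) : ℂ))‖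
      = ‖∫ t in a..b, Complex.exp (Complex.I * φ t)‖ := by
  have : ∀ t, Complex.exp (Complex.I * ((-φ t : ℝ) : ℂ))
      = (starRingEnd ℂ) (Complex.exp (Complex.I * φ t)) := fun t => by
    rw [← Complex.exp_conj]; simp
  simp_rw [this]
  rw [intervalIntegral, intervalIntegral, integral_conj, integral_conj, ← map_sub, RCLike.norm_conj]

theorem sub_le_of_deriv_ge {g g' : ℝ → ℝ} {l : ℝ} (hd : ∀ x ∈ Icc a b, HasDerivAt g (g' x) x)
    (hl : ∀ x ∈ Icc a b, l ≤ g' x) :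
    ∀ x ∈ Icc a b, ∀ y ∈ Icc a b, x ≤ y → l * (y - x) ≤ g y - g x :=
  (convex_Icc a b).mul_sub_le_image_sub_of_le_deriv
    (fun x hx => (hd x hx).continuousAt.continuousWithinAt)
    (fun x hx => (hd x (interior_subset hx)).differentiableAt.differentiableWithinAt)
    (fun x hx => by rw [(hd x (interior_subset hx)).deriv]; exact hl x (interior_subset hx))

/-- The integrand is `(e^{iφ})'` times `(iφ₁)⁻¹`. The primitive of the first factor is bounded by
`2`, and `1 / φ₁` is monotone with modulus at most `δ`, whence `3 * δ * 2`. Here and below `δ` is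
the length scale of the phase, so that the `k`-th derivative is compared with `δ^(-k)`. -/
theorem norm_integral_le_one (h : IsPhase φ φ₁ φ₂ φ₃ a b) (hab : a ≤ b) (hδ : 0 < δ)
    (h2 : ∀ x ∈ Icc a b, 0 ≤ φ₂ x) (h1 : ∀ x ∈ Icc a b, δ⁻¹ ≤ |φ₁ x|) :
    ‖∫ t in a..b, Complex.exp (Complex.I * φ t)‖ ≤ 6 * δ := by
  have hne : ∀ x ∈ Icc a b, φ₁ x ≠ 0 := fun x hx h0 => by
    have := h1 x hx; rw [h0, abs_zero] at this
    have := inv_pos.2 hδ; linarith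
  -- Extension of `φ₁` by constants outside `[a, b]`, since integration by parts asks for a factor
  -- that is continuous on the whole line.
  let P : ℝ → ℝ := fun x => φ₁ (projIcc a b hab x)
  have hP : Continuous P := by
    have := h.cont₁.comp_continuous (f := fun x => (projIcc a b hab x : ℝ))
      (continuous_subtype_val.comp continuous_projIcc) (fun x => (projIcc a b hab x).2)
    exact this
  have hPeq : ∀ x ∈ Icc a b, P x = φ₁ x := fun x hx => by
    simp only [P]; rw [projIcc_of_mem hab hx]
  have hF : Continuous (fun t => Complex.exp (Complex.I * φ t) * (Complex.I * P t)) :=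
    (continuous_exp_I_mul h.cont).mul
      (continuous_const.mul (Complex.continuous_ofReal.comp hP))
  have key := norm_intervalIntegral_mul_le_of_deriv_nonpos (ψ := fun x => (φ₁ x)⁻¹)
    (ψ' := fun x => -φ₂ x / φ₁ x ^ 2) (B := δ) (M := 2) hab hF
    (fun x hx => (h.deriv₁ x hx).inv (hne x hx))
    (h.cont₂.neg.div (h.cont₁.pow 2) (fun x hx => pow_ne_zero 2 (hne x hx)))
    (fun x hx => div_nonpos_of_nonpos_of_nonneg (by have := h2 x hx; linarith) (sq_nonneg _))
    (fun x hx => by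
      rw [abs_inv]; exact inv_le_of_inv_le₀ hδ (h1 x hx))
    (fun x hx => by
      have e : ∫ t in a..x, Complex.exp (Complex.I * φ t) * (Complex.I * P t)
          = Complex.exp (Complex.I * φ x) - Complex.exp (Complex.I * φ a) := by
        apply intervalIntegral.integral_eq_sub_of_hasDerivAt _ (hF.intervalIntegrable _ _)
        intro y hy
        rw [uIcc_of_le hx.1] at hy
        have hy' : y ∈ Icc a b := ⟨hy.1, hy.2.trans hx.2⟩
        rw [hPeq y hy']
        exact ((h.deriv y hy').ofReal_comp.const_mul Complex.I).cexp
      rw [e]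
      refine (norm_sub_le _ _).trans ?_
      rw [mul_comm, Complex.norm_exp_ofReal_mul_I, mul_comm, Complex.norm_exp_ofReal_mul_I]
      norm_num)
  have e : ∫ t in a..b, Complex.exp (Complex.I * φ t)
      = Complex.I⁻¹ * ∫ t in a..b, Complex.exp (Complex.I * φ t) * (Complex.I * P t)
          * (((φ₁ t)⁻¹ : ℝ) : ℂ) := by
    rw [← intervalIntegral.integral_const_mul]
    apply intervalIntegral.integral_congr
    intro t ht
    rw [uIcc_of_le hab] at ht
    have h0 : (φ₁ t : ℂ) ≠ 0 := by exact_mod_cast hne t ht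
    simp only
    rw [hPeq t ht]
    push_cast
    field_simp
  rw [e, norm_mul]
  simp only [norm_inv, Complex.norm_I, inv_one, one_mul]
  linarith

/-- At distance `δ` from `c` the first derivative has size at least `δ⁻¹`, so the first-derivative
bound applies outside the window: `2 * 6δ + 2δ = 14δ`. -/
theorem norm_integral_le_two (h : IsPhase φ φ₁ φ₂ φ₃ a b) (hab : a ≤ b) (hδ : 0 < δ)
    (h2 : ∀ x ∈ Icc a b, (δ ^ 2)⁻¹ ≤ φ₂ x) :
    ‖∫ t in a..b, Complex.exp (Complex.I * φ t)‖ ≤ 14 * δ := by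
  obtain ⟨c, hc, hr, hl⟩ := exists_signed_lower_bound hab h.cont₁ (sub_le_of_deriv_ge h.deriv₁ h2)
  have hp : 0 < (δ ^ 2)⁻¹ := by positivity
  have hd : (δ ^ 2)⁻¹ * δ = δ⁻¹ := by field_simp
  have := norm_intervalIntegral_le_of_away (continuous_exp_I_mul h.cont)
    (fun x => by rw [mul_comm, Complex.norm_exp_ofReal_mul_I]) hab hδ (c := c) (M := 6 * δ)
    (by positivity)
    (fun v hav hvb hvc => (h.mono le_rfl hvb).norm_integral_le_one hav hδ
      (fun x hx => hp.le.trans (h2 x ⟨hx.1, hx.2.trans hvb⟩))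
      (fun x hx => by
        have h1 := hl x ⟨hx.1, hx.2.trans hvb⟩ (by linarith [hx.2])
        have h3 : (δ ^ 2)⁻¹ * δ ≤ (δ ^ 2)⁻¹ * (c - x) :=
          mul_le_mul_of_nonneg_left (by linarith [hx.2]) hp.le
        rw [le_abs]; right; linarith))
    (fun u hau hub huc => (h.mono hau le_rfl).norm_integral_le_one hub hδ
      (fun x hx => hp.le.trans (h2 x ⟨hau.trans hx.1, hx.2⟩))
      (fun x hx => by
        have h1 := hr x ⟨hau.trans hx.1, hx.2⟩ (by linarith [hx.1])
        have h3 : (δ ^ 2)⁻¹ * δ ≤ (δ ^ 2)⁻¹ * (x - c) :=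
          mul_le_mul_of_nonneg_left (by linarith [hx.1]) hp.le
        rw [le_abs]; left; linarith))
  linarith

theorem norm_integral_le_two' (h : IsPhase φ φ₁ φ₂ φ₃ a b) (hab : a ≤ b) (hδ : 0 < δ)
    (h2 : ∀ x ∈ Icc a b, φ₂ x ≤ -(δ ^ 2)⁻¹) :
    ‖∫ t in a..b, Complex.exp (Complex.I * φ t)‖ ≤ 14 * δ := by
  rw [← norm_integral_neg]
  exact h.neg.norm_integral_le_two hab hδ (fun x hx => by have := h2 x hx; linarith)

/-- The same induction step one derivative higher: `2 * 14δ + 2δ = 30δ`. To the left of the window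
the second derivative is negative, which is why the reversed second-derivative bound is needed. -/
theorem norm_integral_le_three (h : IsPhase φ φ₁ φ₂ φ₃ a b) (hab : a ≤ b) (hδ : 0 < δ)
    (h3 : ∀ x ∈ Icc a b, (δ ^ 3)⁻¹ ≤ φ₃ x) :
    ‖∫ t in a..b, Complex.exp (Complex.I * φ t)‖ ≤ 30 * δ := by
  obtain ⟨c, hc, hr, hl⟩ := exists_signed_lower_bound hab h.cont₂ (sub_le_of_deriv_ge h.deriv₂ h3)
  have hp : 0 < (δ ^ 3)⁻¹ := by positivity
  have hd : (δ ^ 3)⁻¹ * δ = (δ ^ 2)⁻¹ := by field_simp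
  have := norm_intervalIntegral_le_of_away (continuous_exp_I_mul h.cont)
    (fun x => by rw [mul_comm, Complex.norm_exp_ofReal_mul_I]) hab hδ (c := c) (M := 14 * δ)
    (by positivity)
    (fun v hav hvb hvc => (h.mono le_rfl hvb).norm_integral_le_two' hav hδ
      (fun x hx => by
        have h1 := hl x ⟨hx.1, hx.2.trans hvb⟩ (by linarith [hx.2])
        have h3 : (δ ^ 3)⁻¹ * δ ≤ (δ ^ 3)⁻¹ * (c - x) :=
          mul_le_mul_of_nonneg_left (by linarith [hx.2]) hp.le
        linarith))
    (fun u hau hub huc => (h.mono hau le_rfl).norm_integral_le_two hub hδ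
      (fun x hx => by
        have h1 := hr x ⟨hau.trans hx.1, hx.2⟩ (by linarith [hx.1])
        have h3 : (δ ^ 3)⁻¹ * δ ≤ (δ ^ 3)⁻¹ * (x - c) :=
          mul_le_mul_of_nonneg_left (by linarith [hx.1]) hp.le
        linarith))
  linarith

theorem norm_integral_le_three' (h : IsPhase φ φ₁ φ₂ φ₃ a b) (hab : a ≤ b) (hδ : 0 < δ)
    (h3 : ∀ x ∈ Icc a b, φ₃ x ≤ -(δ ^ 3)⁻¹) :
    ‖∫ t in a..b, Complex.exp (Complex.I * φ t)‖ ≤ 30 * δ := by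
  rw [← norm_integral_neg]
  exact h.neg.norm_integral_le_three hab hδ (fun x hx => by have := h3 x hx; linarith)

end IsPhase

/-! ### The one-dimensional dispersive integral -/

/-- `r ↦ r ^ β`, frozen below `R / 2` so that it is continuous on the whole line. -/
def cutRpow (R β r : ℝ) : ℝ := max r (R / 2) ^ β

theorem continuous_cutRpow {R : ℝ} (hR : 0 < R) (β : ℝ) : Continuous (cutRpow R β) :=
  (continuous_id.max continuous_const).rpow_const
    (fun r => Or.inl (ne_of_gt (lt_max_of_lt_right (by positivity))))

theorem cutRpow_eq {R r : ℝ} (hR : 0 < R) (hr : R ≤ r) (β : ℝ) : cutRpow R β r = r ^ β := by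
  rw [cutRpow, max_eq_left (by linarith)]

/-- Freezing below `R / 2` rather than below `R` leaves room for a two-sided derivative at the
endpoint `r = R`. -/
theorem hasDerivAt_cutRpow {R r : ℝ} (hR : 0 < R) (hr : R ≤ r) (β : ℝ) :
    HasDerivAt (cutRpow R β) (β * r ^ (β - 1)) r := by
  refine (Real.hasDerivAt_rpow_const (Or.inl (by linarith))).congr_of_eventuallyEq ?_
  filter_upwards [lt_mem_nhds (show R / 2 < r by linarith)] with x hx
  rw [cutRpow, max_eq_left hx.le]

/-- The phase of the kernel as a function of the modulus `r` of the frequency. -/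
def kerPhase (α R X s q r : ℝ) : ℝ := X * r + s * (r ^ 3 - q * cutRpow R (-α) r)

theorem continuous_kerPhase {R : ℝ} (hR : 0 < R) (α X s q : ℝ) :
    Continuous (kerPhase α R X s q) := by
  have := continuous_cutRpow hR (-α)
  unfold kerPhase; fun_prop

theorem isPhase_kerPhase {R b : ℝ} (hR : 0 < R) (α X s q : ℝ) :
    IsPhase (kerPhase α R X s q)
      (fun r => X + s * (3 * r ^ 2 + q * α * r ^ (-α - 1)))
      (fun r => s * (6 * r - q * α * (α + 1) * r ^ (-α - 2)))
      (fun r => s * (6 + q * α * (α + 1) * (α + 2) * r ^ (-α - 3))) R b := by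
  have hne : ∀ r ∈ Icc R b, r ≠ 0 := fun r hr => (hR.trans_le hr.1).ne'
  refine ⟨continuous_kerPhase hR α X s q, ?_, ?_, ?_, ?_⟩
  · refine continuousOn_const.mul (continuousOn_const.add (continuousOn_const.mul ?_))
    exact continuousOn_id.rpow_const (fun r hr => Or.inl (hne r hr))
  · intro r hr
    have h := ((hasDerivAt_id r).const_mul X).add
      (((hasDerivAt_pow 3 r).sub ((hasDerivAt_cutRpow hR hr.1 (-α)).const_mul q)).const_mul s)
    refine h.congr_deriv ?_
    simp; left; ring
  · intro r hr
    have h := ((((hasDerivAt_pow 2 r).const_mul 3).add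
      ((Real.hasDerivAt_rpow_const (p := -α - 1) (Or.inl (hne r hr))).const_mul (q * α))).const_mul
        s).const_add X
    refine h.congr_deriv ?_
    rw [show -α - 1 - 1 = -α - 2 by ring]; simp; left; ring
  · intro r hr
    have h := (((hasDerivAt_id r).const_mul 6).sub
      ((Real.hasDerivAt_rpow_const (p := -α - 2) (Or.inl (hne r hr))).const_mul
        (q * α * (α + 1)))).const_mul s
    refine h.congr_deriv ?_
    rw [show -α - 2 - 1 = -α - 3 by ring]; simp; left; ring

theorem le_rpow_mul_rpow_of_le {M x y θ : ℝ} (hM : 0 ≤ M) (hx : M ≤ x) (hy : M ≤ y)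
    (h0 : 0 ≤ θ) (h1 : θ ≤ 1) : M ≤ x ^ (1 - θ) * y ^ θ := by
  calc M = M ^ (1 - θ) * M ^ θ := by
        rw [← Real.rpow_add_of_nonneg hM (by linarith) h0]; simp
    _ ≤ _ := mul_le_mul (Real.rpow_le_rpow hM hx (by linarith)) (Real.rpow_le_rpow hM hy h0)
        (Real.rpow_nonneg hM _) (Real.rpow_nonneg (hM.trans hx) _)

theorem rpow_le_self_of_one_le_of_le_one {x θ : ℝ} (hx : 1 ≤ x) (h1 : θ ≤ 1) :
    x ^ θ ≤ x := by
  simpa using Real.rpow_le_rpow_of_exponent_le hx h1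

/-- The term in `q` may be arbitrarily large, so a derivative is chosen in which it has the same
sign as the cubic term. For `α ≥ 0` this is the third, as `α(α+1)(α+2) ≥ 0`; for `-1 ≤ α ≤ 0` it is
the second, as `α(α+1) ≤ 0`. -/
theorem norm_integral_exp_kerPhase_le {α R X s q ε b : ℝ} (hα : -1 ≤ α) (hR : 0 < R)
    (hs : s ≠ 0) (hq : 0 ≤ q) (hε : 0 ≤ ε) (hε1 : ε ≤ 1) (hb : R ≤ b) (hb2 : b ≤ 2 * R) :
    ‖∫ r in R..b, Complex.exp (Complex.I * kerPhase α R X s q r)‖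
      ≤ 30 * (R ^ ε * |s| ^ (-((1 - ε) / 3))) := by
  have hP := isPhase_kerPhase (b := b) hR α X s q
  have hs0 : 0 < |s| := abs_pos.2 hs
  set M := ‖∫ r in R..b, Complex.exp (Complex.I * kerPhase α R X s q r)‖ with hM
  have hM0 : 0 ≤ M := norm_nonneg _
  have hMR : M ≤ R := by
    have := intervalIntegral.norm_integral_le_of_norm_le_const (a := R) (b := b) (C := 1)
      (f := fun r => Complex.exp (Complex.I * kerPhase α R X s q r))
      (fun x _ => by rw [mul_comm, Complex.norm_exp_ofReal_mul_I])
    rw [abs_of_nonneg (by linarith)] at this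
    linarith
  rcases le_total 0 α with h | h
  · have hd : (0 : ℝ) < |s| ^ (-(1 / 3) : ℝ) := Real.rpow_pos_of_pos hs0 _
    have hd3 : ((|s| ^ (-(1 / 3) : ℝ)) ^ 3)⁻¹ = |s| := by
      rw [← Real.rpow_natCast, ← Real.rpow_mul hs0.le, ← Real.rpow_neg hs0.le]; norm_num
    have hlow : ∀ r ∈ Icc R b, 1 ≤ 6 + q * α * (α + 1) * (α + 2) * r ^ (-α - 3) := fun r hr => by
      have : 0 ≤ r ^ (-α - 3) := Real.rpow_nonneg (hR.le.trans hr.1) _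
      have : 0 ≤ q * α * (α + 1) * (α + 2) * r ^ (-α - 3) := by positivity
      linarith
    have hM3 : M ≤ 30 * |s| ^ (-(1 / 3) : ℝ) := by
      rcases lt_or_gt_of_ne hs with hneg | hpos
      · refine hP.norm_integral_le_three' hb hd (fun r hr => ?_)
        rw [hd3, abs_of_neg hneg]; have := hlow r hr; nlinarith
      · refine hP.norm_integral_le_three hb hd (fun r hr => ?_)
        rw [hd3, abs_of_pos hpos]; have := hlow r hr; nlinarith
    -- Interpolation between the trivial bound `R` and `|s|^(-1/3)`.
    refine (le_rpow_mul_rpow_of_le hM0 hMR hM3 (θ := 1 - ε) (by linarith) (by linarith)).trans ?_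
    rw [Real.mul_rpow (by norm_num) hd.le, ← Real.rpow_mul hs0.le]
    have e1 : (1 - (1 - ε)) = ε := by ring
    have e2 : -(1 / 3) * (1 - ε) = -((1 - ε) / 3) := by ring
    rw [e1, e2]
    have h30 := rpow_le_self_of_one_le_of_le_one (x := 30) (θ := 1 - ε) (by norm_num) (by linarith)
    have : 0 ≤ R ^ ε * |s| ^ (-((1 - ε) / 3)) := by positivity
    nlinarith
  · have hsR : 0 < |s| * R := by positivity
    have hd : (0 : ℝ) < (|s| * R) ^ (-(1 / 2) : ℝ) := Real.rpow_pos_of_pos hsR _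
    have hd2 : (((|s| * R) ^ (-(1 / 2) : ℝ)) ^ 2)⁻¹ = |s| * R := by
      rw [← Real.rpow_natCast, ← Real.rpow_mul hsR.le, ← Real.rpow_neg hsR.le]; norm_num
    have hlow : ∀ r ∈ Icc R b, R ≤ 6 * r - q * α * (α + 1) * r ^ (-α - 2) := fun r hr => by
      have : 0 ≤ r ^ (-α - 2) := Real.rpow_nonneg (hR.le.trans hr.1) _
      have : 0 ≤ q * (-α) * (α + 1) * r ^ (-α - 2) :=
        mul_nonneg (mul_nonneg (mul_nonneg hq (by linarith)) (by linarith)) this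
      have := hr.1
      linarith
    have hM2 : M ≤ 14 * (|s| * R) ^ (-(1 / 2) : ℝ) := by
      rcases lt_or_gt_of_ne hs with hneg | hpos
      · refine hP.norm_integral_le_two' hb hd (fun r hr => ?_)
        rw [hd2, abs_of_neg hneg]; have := hlow r hr; nlinarith
      · refine hP.norm_integral_le_two hb hd (fun r hr => ?_)
        rw [hd2, abs_of_pos hpos]; have := hlow r hr; nlinarith
    -- The weight `θ` is chosen so that `(|s| R)^(-θ/2)` carries the same power of `|s|` as in the
    -- other case; the power of `R` is then `1 - 3θ/2 = ε`, again the same.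
    refine (le_rpow_mul_rpow_of_le hM0 hMR hM2 (θ := 2 / 3 * (1 - ε)) (by linarith)
      (by linarith)).trans ?_
    rw [Real.mul_rpow (by norm_num) hd.le, ← Real.rpow_mul hsR.le, Real.mul_rpow hs0.le hR.le]
    have e2 : -(1 / 2) * (2 / 3 * (1 - ε)) = -((1 - ε) / 3) := by ring
    have e3 : R ^ (1 - 2 / 3 * (1 - ε)) = R ^ ε * R ^ ((1 - ε) / 3) := by
      rw [← Real.rpow_add hR]; congr 1; ring
    have e4 : R ^ ((1 - ε) / 3) * R ^ (-((1 - ε) / 3)) = 1 := by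
      rw [← Real.rpow_add hR]; simp
    rw [e2, e3]
    have h30 := rpow_le_self_of_one_le_of_le_one (x := 14) (θ := 2 / 3 * (1 - ε)) (by norm_num)
      (by linarith)
    have hp : 0 ≤ R ^ ε * |s| ^ (-((1 - ε) / 3)) := by positivity
    calc R ^ ε * R ^ ((1 - ε) / 3) * (14 ^ (2 / 3 * (1 - ε)) *
          (|s| ^ (-((1 - ε) / 3)) * R ^ (-((1 - ε) / 3))))
        = 14 ^ (2 / 3 * (1 - ε)) * (R ^ ε * |s| ^ (-((1 - ε) / 3)))
            * (R ^ ((1 - ε) / 3) * R ^ (-((1 - ε) / 3))) := by ring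
      _ ≤ _ := by rw [e4]; nlinarith

/-- Both amplitudes are monotone on `[R, 2R]`, so each is removed by one integration by parts. The
damping factor stays in `[0, 1]`, which makes the bound uniform in `A`. -/
theorem norm_integral_kernel_le {α R X s q A ε : ℝ} (hα : -1 ≤ α) (hα1 : α ≤ 1) (hR : 0 < R)
    (hs : s ≠ 0) (hq : 0 ≤ q) (hA : 0 ≤ A) (hε : 0 ≤ ε) (hε1 : ε ≤ 1) :
    ‖∫ r in R..2 * R, Complex.exp (Complex.I * kerPhase α R X s q r)
        * ((Real.exp (-(A * r ^ (-α))) : ℝ) : ℂ) * ((r ^ (2 - α / 2) : ℝ) : ℂ)‖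
      ≤ 2000 * (R ^ (2 - α / 2 + ε) * |s| ^ (-((1 - ε) / 3))) := by
  have hRR : R ≤ 2 * R := by linarith
  have hF : Continuous (fun r => Complex.exp (Complex.I * kerPhase α R X s q r)) :=
    continuous_exp_I_mul (continuous_kerPhase hR α X s q)
  have hcut := continuous_cutRpow hR (-α)
  have hF2 : Continuous (fun r => Complex.exp (Complex.I * kerPhase α R X s q r)
      * ((Real.exp (-(A * cutRpow R (-α) r)) : ℝ) : ℂ)) :=
    hF.mul (Complex.continuous_ofReal.comp (by fun_prop))
  set K := R ^ ε * |s| ^ (-((1 - ε) / 3)) with hK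
  have hK0 : 0 ≤ K := by positivity
  have hne : ∀ b, ∀ r ∈ Icc R b, r ≠ 0 := fun b r hr => (hR.trans_le hr.1).ne'
  have hstep : ∀ b ∈ Icc R (2 * R), ‖∫ r in R..b, Complex.exp (Complex.I * kerPhase α R X s q r)
      * ((Real.exp (-(A * cutRpow R (-α) r)) : ℝ) : ℂ)‖ ≤ 3 * 1 * (30 * K) := by
    intro b hb
    have hd : ∀ r ∈ Icc R b, HasDerivAt (fun r => Real.exp (-(A * cutRpow R (-α) r)))
        (Real.exp (-(A * r ^ (-α))) * (A * α * r ^ (-α - 1))) r := fun r hr => by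
      refine (((hasDerivAt_cutRpow hR hr.1 (-α)).const_mul A).neg.exp).congr_deriv ?_
      simp only [Pi.neg_apply]
      rw [cutRpow_eq hR hr.1]; ring
    have hc : ContinuousOn (fun r => Real.exp (-(A * r ^ (-α))) * (A * α * r ^ (-α - 1)))
        (Icc R b) := by
      have h1 : ContinuousOn (fun r : ℝ => r ^ (-α)) (Icc R b) :=
        continuousOn_id.rpow_const (fun r hr => Or.inl (hne b r hr))
      have h2 : ContinuousOn (fun r : ℝ => r ^ (-α - 1)) (Icc R b) :=
        continuousOn_id.rpow_const (fun r hr => Or.inl (hne b r hr))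
      fun_prop
    have hB : ∀ r ∈ Icc R b, |Real.exp (-(A * cutRpow R (-α) r))| ≤ 1 := fun r hr => by
      rw [abs_of_pos (Real.exp_pos _), Real.exp_le_one_iff, cutRpow_eq hR hr.1]
      have : 0 ≤ r ^ (-α) := Real.rpow_nonneg (hR.le.trans hr.1) _
      have := mul_nonneg hA this
      linarith
    have hM : ∀ x ∈ Icc R b, ‖∫ t in R..x, Complex.exp (Complex.I * kerPhase α R X s q t)‖
        ≤ 30 * K := fun x hx =>
      norm_integral_exp_kerPhase_le hα hR hs hq hε hε1 hx.1 (hx.2.trans hb.2)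
    rcases le_total 0 α with h | h
    · refine norm_intervalIntegral_mul_le_of_deriv_nonneg hb.1 hF hd hc (fun r hr => ?_) hB hM
      have : 0 ≤ r ^ (-α - 1) := Real.rpow_nonneg (hR.le.trans hr.1) _
      positivity
    · refine norm_intervalIntegral_mul_le_of_deriv_nonpos hb.1 hF hd hc (fun r hr => ?_) hB hM
      have : 0 ≤ r ^ (-α - 1) := Real.rpow_nonneg (hR.le.trans hr.1) _
      exact mul_nonpos_of_nonneg_of_nonpos (Real.exp_pos _).le
        (mul_nonpos_of_nonpos_of_nonneg (mul_nonpos_of_nonneg_of_nonpos hA h) this)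
  have hd2 : ∀ r ∈ Icc R (2 * R), HasDerivAt (fun r : ℝ => r ^ (2 - α / 2))
      ((2 - α / 2) * r ^ (2 - α / 2 - 1)) r := fun r hr =>
    Real.hasDerivAt_rpow_const (Or.inl (hne _ r hr))
  have key := norm_intervalIntegral_mul_le_of_deriv_nonneg (B := (2 * R) ^ (2 - α / 2)) hRR hF2 hd2
    (continuousOn_const.mul (continuousOn_id.rpow_const (fun r hr => Or.inl (hne _ r hr))))
    (fun r hr => mul_nonneg (by linarith) (Real.rpow_nonneg (hR.le.trans hr.1) _))
    (fun r hr => by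
      rw [abs_of_nonneg (Real.rpow_nonneg (hR.le.trans hr.1) _)]
      exact Real.rpow_le_rpow (hR.le.trans hr.1) hr.2 (by linarith))
    hstep
  have e : ∫ r in R..2 * R, Complex.exp (Complex.I * kerPhase α R X s q r)
        * ((Real.exp (-(A * r ^ (-α))) : ℝ) : ℂ) * ((r ^ (2 - α / 2) : ℝ) : ℂ)
      = ∫ r in R..2 * R, Complex.exp (Complex.I * kerPhase α R X s q r)
        * ((Real.exp (-(A * cutRpow R (-α) r)) : ℝ) : ℂ) * ((r ^ (2 - α / 2) : ℝ) : ℂ) := by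
    apply intervalIntegral.integral_congr
    intro r hr
    rw [uIcc_of_le hRR] at hr
    simp only
    rw [cutRpow_eq hR hr.1]
  rw [e]
  refine key.trans ?_
  -- With this bound the constant is `3 * 7 * 3 * 30 = 1890`.
  have h2 : (2 : ℝ) ^ (2 - α / 2) ≤ 7 := by
    calc (2 : ℝ) ^ (2 - α / 2) ≤ 2 ^ (5 / 2 : ℝ) :=
          Real.rpow_le_rpow_of_exponent_le (by norm_num) (by linarith)
      _ = 2 ^ (2 : ℕ) * √2 := by
          rw [Real.sqrt_eq_rpow, ← Real.rpow_natCast, ← Real.rpow_add (by norm_num)]; norm_num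
      _ ≤ 7 := by
          have := Real.sqrt_le_sqrt (show (2 : ℝ) ≤ (1.5 : ℝ) ^ 2 by norm_num)
          rw [Real.sqrt_sq (by norm_num)] at this
          linarith
  rw [Real.mul_rpow (by norm_num) hR.le, Real.rpow_add hR]
  have hp : 0 ≤ R ^ (2 - α / 2) * K := by positivity
  calc 3 * (2 ^ (2 - α / 2) * R ^ (2 - α / 2)) * (3 * 1 * (30 * K))
      = 270 * 2 ^ (2 - α / 2) * (R ^ (2 - α / 2) * K) := by ring
    _ ≤ 2000 * (R ^ (2 - α / 2) * K) := by nlinarith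
    _ = _ := by rw [hK]; ring

/-! ### The dispersive estimate for the kernel of a frequency band -/

/-- The plane as a product, `ζ ↦ (ζ 0, ζ 1)`. -/
def planeEquiv : Plane ≃ᵐ ℝ × ℝ :=
  (MeasurableEquiv.toLp 2 (Fin 2 → ℝ)).symm.trans MeasurableEquiv.finTwoArrow

theorem measurePreserving_planeEquiv :
    MeasurePreserving planeEquiv (volume : Measure Plane) volume :=
  (volume_preserving_finTwoArrow ℝ).comp (EuclideanSpace.volume_preserving_symm_measurableEquiv_toLp _)

theorem integral_plane (G : ℝ × ℝ → ℂ) : ∫ ζ : Plane, G (ζ 0, ζ 1) = ∫ z, G z :=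
  measurePreserving_planeEquiv.integral_comp' (g := G)

theorem integrable_plane {G : ℝ × ℝ → ℂ} (hG : Integrable G) :
    Integrable (fun ζ : Plane => G (ζ 0, ζ 1)) :=
  (measurePreserving_planeEquiv.integrable_comp_emb planeEquiv.measurableEmbedding).2 hG

/-- The damped multiplier of a band as a function of `r = |ξ|` and `η`. -/
def radMult (α R s δ r η : ℝ) : ℂ :=
  (Ico R (2 * R)).indicator (fun r => ((r ^ 2 : ℝ) : ℂ) *
    Complex.exp (Complex.I * ((s * (r ^ 3 + r ^ α * η ^ 2) : ℝ) : ℂ)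
      - ((δ * (r ^ α * η ^ 2) : ℝ) : ℂ))) r

theorem measurable_radMult (α R s δ : ℝ) :
    Measurable (fun z : ℝ × ℝ => radMult α R s δ z.1 z.2) := by
  have : (fun z : ℝ × ℝ => radMult α R s δ z.1 z.2) =
      {z : ℝ × ℝ | z.1 ∈ Ico R (2 * R)}.indicator (fun z => ((z.1 ^ 2 : ℝ) : ℂ) *
    Complex.exp (Complex.I * ((s * (z.1 ^ 3 + z.1 ^ α * z.2 ^ 2) : ℝ) : ℂ)
      - ((δ * (z.1 ^ α * z.2 ^ 2) : ℝ) : ℂ))) := by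
    ext z; simp only [radMult, indicator, mem_ofPred_eq]
  rw [this]
  refine Measurable.indicator ?_ (measurable_fst measurableSet_Ico)
  fun_prop

theorem norm_radMult_le {α R s δ r η : ℝ} (hα : -1 ≤ α) (hR : 0 < R) (hδ : 0 ≤ δ) :
    ‖radMult α R s δ r η‖ ≤
      (Ico R (2 * R)).indicator (fun _ => 4 * R ^ 2) r * Real.exp (-(δ * (R ^ α / 2)) * η ^ 2) := by
  rw [radMult]
  by_cases hr : r ∈ Ico R (2 * R)
  · rw [indicator_of_mem hr, indicator_of_mem hr]
    have hr0 : 0 < r := hR.trans_le hr.1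
    rw [norm_mul, Complex.norm_real, Complex.norm_exp]
    simp only [Complex.sub_re, Complex.mul_re, Complex.I_re, Complex.ofReal_re, Complex.I_im,
      Complex.ofReal_im, zero_mul, one_mul, sub_zero, zero_sub]
    -- The ratio `r / R` lies in `[1, 2)` and `α ≥ -1`, so its power `α` is at least `1 / 2`.
    have hlow : R ^ α / 2 ≤ r ^ α := by
      have hq1 : 1 ≤ r / R := by rw [le_div_iff₀ hR]; linarith [hr.1]
      have hq2 : r / R ≤ 2 := by rw [div_le_iff₀ hR]; linarith [hr.2]
      have h1 : (r / R) ^ (-1 : ℝ) ≤ (r / R) ^ α := Real.rpow_le_rpow_of_exponent_le hq1 hα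
      have h2 : 1 / 2 ≤ (r / R) ^ (-1 : ℝ) := by
        rw [Real.rpow_neg_one, one_div]
        exact inv_anti₀ (by linarith) hq2
      have h3 : r ^ α = R ^ α * (r / R) ^ α := by
        rw [← Real.mul_rpow hR.le (by linarith)]; congr 1; field_simp
      rw [h3]
      have : 0 < R ^ α := Real.rpow_pos_of_pos hR _
      nlinarith
    apply mul_le_mul
    · rw [Real.norm_of_nonneg (by positivity)]
      nlinarith [hr.2]
    · apply Real.exp_le_exp.2
      have : δ * (R ^ α / 2) * η ^ 2 ≤ δ * r ^ α * η ^ 2 := by gcongr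
      nlinarith
    · positivity
    · positivity
  · rw [indicator_of_notMem hr, indicator_of_notMem hr]; simp

theorem integrable_radMult {α R δ : ℝ} (s : ℝ) {κ : ℝ} (hκ : κ ≠ 0) (hα : -1 ≤ α) (hR : 0 < R)
    (hδ : 0 < δ) :
    Integrable (fun z : ℝ × ℝ => radMult α R s δ (κ * z.1) (2 * Real.pi * z.2)) := by
  have h1 : Integrable (fun u : ℝ => (Ico R (2 * R)).indicator (fun _ => 4 * R ^ 2) (κ * u)) := by
    have : Integrable (fun u : ℝ => (Ico R (2 * R)).indicator (fun _ => 4 * R ^ 2) u) :=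
      (integrable_indicator_iff measurableSet_Ico).2 (by
        exact integrableOn_const (by simp) )
    exact this.comp_mul_left' hκ
  have hb : 0 < δ * (R ^ α / 2) := by
    have : 0 < R ^ α := Real.rpow_pos_of_pos hR _
    positivity
  have h2 : Integrable (fun v : ℝ => Real.exp (-(δ * (R ^ α / 2)) * (2 * Real.pi * v) ^ 2)) :=
    (integrable_exp_neg_mul_sq hb).comp_mul_left' (by positivity)
  refine (h1.mul_prod h2).mono' ?_ ?_
  · have := (measurable_radMult α R s δ).comp
      (show Measurable (fun z : ℝ × ℝ => (κ * z.1, 2 * Real.pi * z.2)) by fun_prop)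
    exact this.aestronglyMeasurable
  · filter_upwards with z
    exact norm_radMult_le hα hR hδ.le

/-- A positive factor does not change the argument, hence passes through the principal square root.
-/
theorem ofReal_mul_cpow_half {r : ℝ} (hr : 0 < r) (α : ℝ) {z : ℂ} (hz : z ≠ 0) :
    (((r ^ (-α) : ℝ) : ℂ) * z) ^ (1 / 2 : ℂ) = ((r ^ (-(α / 2)) : ℝ) : ℂ) * z ^ (1 / 2 : ℂ) := by
  have h0 : 0 < r ^ (-α) := Real.rpow_pos_of_pos hr _
  have h1 : ((r ^ (-α) : ℝ) : ℂ) ≠ 0 := by exact_mod_cast h0.ne'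
  rw [Complex.cpow_def_of_ne_zero (mul_ne_zero h1 hz), Complex.cpow_def_of_ne_zero hz,
    Complex.log_ofReal_mul h0 hz, add_mul, Complex.exp_add, Real.log_rpow hr,
    Real.rpow_def_of_pos hr, Complex.ofReal_exp]
  congr 2
  push_cast; ring

/-- The damping `δ > 0` makes this an absolutely convergent Gaussian integral. Splitting `1 / (δ -
is)` into real and imaginary parts separates the oscillation, with `q = y² / (4(δ² + s²))`, from a
damping factor with coefficient `q δ`. -/
theorem gaussian_transverse {α r s δ y : ℝ} (hr : 0 < r) (hδ : 0 < δ) :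
    ∫ v : ℝ, Complex.exp (((-2 * Real.pi * (v * y) : ℝ) : ℂ) * Complex.I) *
      Complex.exp (Complex.I * ((s * (r ^ α * (2 * Real.pi * v) ^ 2) : ℝ) : ℂ)
        - ((δ * (r ^ α * (2 * Real.pi * v) ^ 2) : ℝ) : ℂ))
    = ((r ^ (-(α / 2)) : ℝ) : ℂ) *
        (Real.pi / ((2 * Real.pi) ^ 2 * (δ - Complex.I * s)) : ℂ) ^ (1 / 2 : ℂ) *
      (Complex.exp (Complex.I * ((s * (-(y ^ 2 / (4 * (δ ^ 2 + s ^ 2))) * r ^ (-α)) : ℝ) : ℂ)) *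
        ((Real.exp (-(y ^ 2 / (4 * (δ ^ 2 + s ^ 2)) * δ * r ^ (-α))) : ℝ) : ℂ)) := by
  have hra : 0 < r ^ α := Real.rpow_pos_of_pos hr _
  have hpi := Real.pi_pos
  set β : ℂ := (2 * Real.pi) ^ 2 * (δ - Complex.I * s) with hβ
  set b : ℂ := ((r ^ α : ℝ) : ℂ) * β with hb
  have hβre : β.re = (2 * Real.pi) ^ 2 * δ := by
    have : β = (((2 * Real.pi) ^ 2 * δ : ℝ) : ℂ) - Complex.I * (((2 * Real.pi) ^ 2 * s : ℝ) : ℂ) := by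
      rw [hβ]; push_cast; ring
    rw [this, Complex.sub_re, Complex.ofReal_re, Complex.I_mul_re, Complex.ofReal_im]; ring
  have hbre : 0 < b.re := by
    rw [hb, Complex.re_ofReal_mul, hβre]; positivity
  have hβ0 : β ≠ 0 := fun h => by
    rw [h] at hβre
    have : 0 < (2 * Real.pi) ^ 2 * δ := by positivity
    simp only [Complex.zero_re] at hβre; linarith
  have hra' : ((r ^ α : ℝ) : ℂ) ≠ 0 := by exact_mod_cast hra.ne'
  have hpi' : (Real.pi : ℂ) ≠ 0 := by exact_mod_cast hpi.ne'
  have hd0 : (δ : ℂ) - Complex.I * s ≠ 0 := fun h => hβ0 (by rw [hβ, h, mul_zero])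
  have hd1 : (δ : ℂ) ^ 2 + (s : ℂ) ^ 2 ≠ 0 := by
    have : (0 : ℝ) < δ ^ 2 + s ^ 2 := by positivity
    exact_mod_cast this.ne'
  have hneg : ((r ^ (-α) : ℝ) : ℂ) = ((r ^ α : ℝ) : ℂ)⁻¹ := by
    rw [Real.rpow_neg hr.le]; push_cast; rfl
  have key := fourierIntegral_gaussian hbre (((-2 * Real.pi * y : ℝ)) : ℂ)
  have e1 : ∀ v : ℝ, Complex.exp (((-2 * Real.pi * (v * y) : ℝ) : ℂ) * Complex.I) *
      Complex.exp (Complex.I * ((s * (r ^ α * (2 * Real.pi * v) ^ 2) : ℝ) : ℂ)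
        - ((δ * (r ^ α * (2 * Real.pi * v) ^ 2) : ℝ) : ℂ))
      = Complex.exp (Complex.I * ((-2 * Real.pi * y : ℝ) : ℂ) * v) *
        Complex.exp (-b * (v : ℂ) ^ 2) := fun v => by
    rw [hb, hβ]; congr 1
    · congr 1; push_cast; ring
    · congr 1; push_cast; ring
  simp_rw [e1]
  rw [key]
  have e2 : (Real.pi : ℂ) / b = ((r ^ (-α) : ℝ) : ℂ) * (Real.pi / β) := by
    rw [hneg, hb]; field_simp
  rw [e2, ofReal_mul_cpow_half hr α (div_ne_zero hpi' hβ0)]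
  congr 1
  rw [Complex.ofReal_exp, ← Complex.exp_add]
  congr 1
  rw [hb, hβ]
  push_cast
  rw [hneg]
  have hI : ((δ : ℂ) - Complex.I * s) * (δ + Complex.I * s) = δ ^ 2 + s ^ 2 := by
    linear_combination (-(s : ℂ) ^ 2) * Complex.I_sq
  have hI2 : (1 : ℂ) / (δ - Complex.I * s) = (δ + Complex.I * s) / (δ ^ 2 + s ^ 2) := by
    rw [div_eq_div_iff hd0 hd1, ← hI]; ring
  calc -(-2 * (Real.pi : ℂ) * y) ^ 2 / (4 * (((r ^ α : ℝ) : ℂ) * ((2 * Real.pi) ^ 2 * (δ - Complex.I * s))))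
      = -((y : ℂ) ^ 2 / 4 * ((r ^ α : ℝ) : ℂ)⁻¹ * (1 / (δ - Complex.I * s))) := by
        field_simp
    _ = _ := by rw [hI2]; field_simp; ring

/-- Since `|δ - is| ≥ |s|` and `4π² ≥ π`, the bound is uniform in `δ`. -/
theorem norm_gaussian_const_le {δ s : ℝ} (hs : s ≠ 0) :
    ‖(Real.pi / ((2 * Real.pi) ^ 2 * (δ - Complex.I * s)) : ℂ) ^ (1 / 2 : ℂ)‖
      ≤ |s| ^ (-(1 / 2) : ℝ) := by
  have hpi := Real.pi_gt_three
  have hs0 : 0 < |s| := abs_pos.2 hs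
  have e : (1 / 2 : ℂ) = ((1 / 2 : ℝ) : ℂ) := by push_cast; rfl
  rw [e, Complex.norm_cpow_real, Real.rpow_neg hs0.le, ← Real.inv_rpow hs0.le]
  apply Real.rpow_le_rpow (norm_nonneg _) _ (by norm_num)
  have h1 : |s| ≤ ‖(δ : ℂ) - Complex.I * s‖ := by
    have := Complex.abs_im_le_norm ((δ : ℂ) - Complex.I * s)
    simpa using this
  have h2 := hs0.trans_le h1
  rw [norm_div, norm_mul, norm_pow, norm_mul]
  simp only [Complex.norm_real, Complex.norm_ofNat]
  rw [Real.norm_of_nonneg (by linarith), div_le_iff₀ (by positivity), inv_mul_eq_div,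
    le_div_iff₀ hs0]
  have h3 : 0 ≤ 4 * Real.pi ^ 2 - Real.pi := by nlinarith
  nlinarith [mul_nonneg h3 h2.le]

/-- The damped multiplier of the band `σ ξ ∈ [R, 2R)`. -/
def bandMult (α σ R τ δ : ℝ) (ζ : Plane) : ℂ := radMult α R (σ * τ) δ (σ * freqX ζ) (freqY ζ)

theorem integrable_bandMult {α σ R δ : ℝ} (τ : ℝ) (hσ : σ ≠ 0) (hα : -1 ≤ α) (hR : 0 < R)
    (hδ : 0 < δ) : Integrable (bandMult α σ R τ δ) := by
  have := integrable_plane (integrable_radMult (σ * τ) (κ := σ * (2 * Real.pi))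
    (mul_ne_zero hσ (by positivity)) hα hR hδ)
  refine this.congr (Filter.Eventually.of_forall fun ζ => ?_)
  simp only [bandMult, freqX, freqY, mul_assoc]

/-- By Fubini the Gaussian `η` integral comes first and contributes `|τ|^(-1/2)`; the remaining
integral over `r` contributes `|τ|^(-(1-ε)/3)`. The bound does not depend on `δ`, so the damping can
later be removed. -/
theorem norm_fourier_bandMult_le {α σ R τ δ ε : ℝ} (hσ : |σ| = 1) (hα : -1 ≤ α) (hα1 : α ≤ 1)
    (hR : 0 < R) (hτ : τ ≠ 0) (hδ : 0 < δ) (hε : 0 ≤ ε) (hε1 : ε ≤ 1) (x : Plane) :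
    ‖𝓕 (bandMult α σ R τ δ) x‖ ≤ 2000 * (R ^ (2 - α / 2 + ε) * |τ| ^ (-(5 / 6 - ε / 3))) := by
  have hpi := Real.pi_gt_three
  have hσ0 : σ ≠ 0 := fun h => by simp [h] at hσ
  have hσ2 : σ * σ = 1 := by rw [← abs_mul_abs_self, hσ]; norm_num
  set s := σ * τ with hs
  have hs0 : s ≠ 0 := mul_ne_zero hσ0 hτ
  have hsτ : |s| = |τ| := by rw [hs, abs_mul, hσ, one_mul]
  set κ := σ * (2 * Real.pi) with hκ
  have hκ0 : κ ≠ 0 := mul_ne_zero hσ0 (by positivity)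
  set c : ℂ := (Real.pi / ((2 * Real.pi) ^ 2 * (δ - Complex.I * s)) : ℂ) ^ (1 / 2 : ℂ) with hc
  set q := x 1 ^ 2 / (4 * (δ ^ 2 + s ^ 2)) with hq
  have hq0 : 0 ≤ q := by positivity
  let E : ℝ × ℝ → ℂ := fun z =>
    Complex.exp (((-2 * Real.pi * (z.1 * x 0 + z.2 * x 1) : ℝ) : ℂ) * Complex.I)
  have hEc : Continuous E := by fun_prop
  let G : ℝ × ℝ → ℂ := fun z => E z * radMult α R s δ (κ * z.1) (2 * Real.pi * z.2)
  have hG : Integrable G := by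
    refine (integrable_radMult s hκ0 hα hR hδ).bdd_mul hEc.aestronglyMeasurable (c := 1)
      (Filter.Eventually.of_forall fun z => ?_)
    simp only [E]
    rw [Complex.norm_exp_ofReal_mul_I]
  let g : ℝ → ℂ := (Ico R (2 * R)).indicator fun r =>
    c * (Complex.exp (Complex.I * kerPhase α R (-(σ * x 0)) s q r)
        * ((Real.exp (-(q * δ * r ^ (-α))) : ℝ) : ℂ) * ((r ^ (2 - α / 2) : ℝ) : ℂ))
  have hinner : ∀ u : ℝ, ∫ v : ℝ, G (u, v) = g (κ * u) := by
    intro u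
    by_cases hu : κ * u ∈ Ico R (2 * R)
    · have hr : 0 < κ * u := hR.trans_le hu.1
      simp only [g, indicator_of_mem hu]
      have hGuv : ∀ v, G (u, v) =
          (((κ * u) ^ 2 : ℝ) : ℂ) * Complex.exp (((-2 * Real.pi * (u * x 0) : ℝ) : ℂ) * Complex.I)
            * Complex.exp (Complex.I * ((s * (κ * u) ^ 3 : ℝ) : ℂ)) *
          (Complex.exp (((-2 * Real.pi * (v * x 1) : ℝ) : ℂ) * Complex.I) *
      Complex.exp (Complex.I * ((s * ((κ * u) ^ α * (2 * Real.pi * v) ^ 2) : ℝ) : ℂ)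
        - ((δ * ((κ * u) ^ α * (2 * Real.pi * v) ^ 2) : ℝ) : ℂ))) := by
        intro v
        simp only [G, E, radMult, indicator_of_mem hu]
        have a1 : Complex.exp (((-2 * Real.pi * (u * x 0 + v * x 1) : ℝ) : ℂ) * Complex.I)
            = Complex.exp (((-2 * Real.pi * (u * x 0) : ℝ) : ℂ) * Complex.I) *
              Complex.exp (((-2 * Real.pi * (v * x 1) : ℝ) : ℂ) * Complex.I) := by
          rw [← Complex.exp_add]; congr 1; push_cast; ring
        have a2 : Complex.exp (Complex.I *
              ((s * ((κ * u) ^ 3 + (κ * u) ^ α * (2 * Real.pi * v) ^ 2) : ℝ) : ℂ)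
              - ((δ * ((κ * u) ^ α * (2 * Real.pi * v) ^ 2) : ℝ) : ℂ))
            = Complex.exp (Complex.I * ((s * (κ * u) ^ 3 : ℝ) : ℂ)) *
              Complex.exp (Complex.I * ((s * ((κ * u) ^ α * (2 * Real.pi * v) ^ 2) : ℝ) : ℂ)
        - ((δ * ((κ * u) ^ α * (2 * Real.pi * v) ^ 2) : ℝ) : ℂ)) := by
          rw [← Complex.exp_add]; congr 1; push_cast; ring
        rw [a1, a2]; ring
      simp_rw [hGuv]
      rw [integral_const_mul, gaussian_transverse hr hδ]
      have b1 : Complex.exp (Complex.I * kerPhase α R (-(σ * x 0)) s q (κ * u))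
          = Complex.exp (((-2 * Real.pi * (u * x 0) : ℝ) : ℂ) * Complex.I) *
            Complex.exp (Complex.I * ((s * (κ * u) ^ 3 : ℝ) : ℂ)) *
            Complex.exp (Complex.I * ((s * (-q * (κ * u) ^ (-α)) : ℝ) : ℂ)) := by
        rw [← Complex.exp_add, ← Complex.exp_add]; congr 1
        rw [kerPhase, cutRpow_eq hR hu.1]
        have : -(σ * x 0) * (κ * u) = -2 * Real.pi * (u * x 0) := by
          rw [hκ]; linear_combination (-(2 * Real.pi * u * x 0)) * hσ2
        rw [this]; push_cast; ring
      have b2 : (κ * u) ^ (2 - α / 2) = (κ * u) ^ 2 * (κ * u) ^ (-(α / 2)) := by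
        rw [← Real.rpow_natCast, ← Real.rpow_add hr]; congr 1
      rw [b1, b2, ← hc, ← hq]
      push_cast
      ring
    · simp only [g, G, radMult, indicator_of_notMem hu]; simp
  have hF : 𝓕 (bandMult α σ R τ δ) x = ∫ z, G z := by
    rw [Real.fourier_eq', ← integral_plane]
    congr 1; ext ζ
    simp only [G, E, bandMult, freqX, freqY, smul_eq_mul, PiLp.inner_apply, Fin.sum_univ_two,
      RCLike.inner_apply, conj_trivial, hκ, hs, mul_assoc]
    ring_nf
  rw [hF, Measure.volume_eq_prod, integral_prod _ (by rwa [← Measure.volume_eq_prod])]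
  simp_rw [hinner]
  -- The substitution `r = κ u` has the Jacobian `|κ|⁻¹ = 1 / (2π)`, estimated below by `1`.
  rw [Measure.integral_comp_mul_left, norm_smul, integral_indicator measurableSet_Ico,
    integral_Ico_eq_integral_Ioc, ← intervalIntegral.integral_of_le (by linarith),
    intervalIntegral.integral_const_mul, norm_mul]
  have n1 : ‖|κ⁻¹|‖ ≤ 1 := by
    rw [norm_abs_eq_norm, norm_inv, hκ, norm_mul, Real.norm_eq_abs, hσ, one_mul,
      Real.norm_of_nonneg (by positivity)]
    exact inv_le_one_of_one_le₀ (by linarith)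
  have n2 := norm_gaussian_const_le (δ := δ) hs0
  have n3 := norm_integral_kernel_le (X := -(σ * x 0)) hα hα1 hR hs0 hq0
    (mul_nonneg hq0 hδ.le) hε hε1
  have hs1 : 0 < |s| := abs_pos.2 hs0
  have e : |s| ^ (-(1 / 2) : ℝ) * |s| ^ (-((1 - ε) / 3)) = |τ| ^ (-(5 / 6 - ε / 3)) := by
    rw [← Real.rpow_add hs1, hsτ]; congr 1; ring
  refine (mul_le_of_le_one_left (by positivity) n1).trans ?_
  refine (mul_le_mul n2 n3 (norm_nonneg _) (by positivity)).trans_eq ?_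
  rw [← e]; ring

/-! ### Multiplication operators on `L²` -/

/-- Multiplication of an `L²` function by `k`; it is `0` if the product is not in `L²`. -/
def mulL2 (k : Plane → ℂ) (a : L2) : L2 :=
  open Classical in
  if h : MemLp (fun ζ => k ζ * a ζ) 2 volume then h.toLp _ else 0

/-- `k` is measurable and bounded by `C`. -/
structure IsMult (k : Plane → ℂ) (C : ℝ) : Prop where
  meas : Measurable k
  bound : ∀ ζ, ‖k ζ‖ ≤ C

section mulL2

variable {k l : Plane → ℂ} {C D : ℝ}

theorem IsMult.nonneg (hk : IsMult k C) : 0 ≤ C := (norm_nonneg _).trans (hk.bound 0)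

theorem IsMult.mul (hk : IsMult k C) (hl : IsMult l D) : IsMult (fun ζ => k ζ * l ζ) (C * D) :=
  ⟨hk.meas.mul hl.meas, fun ζ => by
    rw [norm_mul]; exact mul_le_mul (hk.bound ζ) (hl.bound ζ) (norm_nonneg _) hk.nonneg⟩

theorem IsMult.conj (hk : IsMult k C) : IsMult (fun ζ => starRingEnd ℂ (k ζ)) C :=
  ⟨RCLike.continuous_conj.measurable.comp hk.meas, fun ζ => by
    rw [RCLike.norm_conj]; exact hk.bound ζ⟩

theorem IsMult.memLp (hk : IsMult k C) (a : L2) : MemLp (fun ζ => k ζ * a ζ) 2 volume :=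
  (Lp.memLp a).of_le_mul (c := C) (hk.meas.aestronglyMeasurable.mul (Lp.memLp a).1)
    (Filter.Eventually.of_forall fun ζ => by
      rw [norm_mul]; exact mul_le_mul_of_nonneg_right (hk.bound ζ) (norm_nonneg _))

theorem coeFn_mulL2 (hk : IsMult k C) (a : L2) :
    (mulL2 k a : Plane → ℂ) =ᵐ[volume] fun ζ => k ζ * a ζ := by
  rw [mulL2, dif_pos (hk.memLp a)]; exact MemLp.coeFn_toLp _

theorem norm_mulL2_le (hk : IsMult k C) (a : L2) : ‖mulL2 k a‖ ≤ C * ‖a‖ := by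
  apply Lp.norm_le_mul_norm_of_ae_le_mul
  filter_upwards [coeFn_mulL2 hk a] with ζ h
  rw [h, norm_mul]; exact mul_le_mul_of_nonneg_right (hk.bound ζ) (norm_nonneg _)

theorem mulL2_sub (hk : IsMult k C) (a b : L2) : mulL2 k (a - b) = mulL2 k a - mulL2 k b := by
  apply Lp.ext
  filter_upwards [coeFn_mulL2 hk a, coeFn_mulL2 hk b, coeFn_mulL2 hk (a - b), Lp.coeFn_sub a b,
    Lp.coeFn_sub (mulL2 k a) (mulL2 k b)] with ζ h1 h2 h3 h4 h5
  rw [h3, h4, h5, Pi.sub_apply, Pi.sub_apply, h1, h2, mul_sub]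

theorem continuous_mulL2 (hk : IsMult k C) : Continuous (mulL2 k) := by
  refine LipschitzWith.continuous (K := ⟨C, hk.nonneg⟩) (LipschitzWith.of_dist_le_mul fun a b => ?_)
  rw [dist_eq_norm, dist_eq_norm, ← mulL2_sub hk]
  exact norm_mulL2_le hk _

theorem mulL2_mulL2 (hk : IsMult k C) (hl : IsMult l D) (a : L2) :
    mulL2 k (mulL2 l a) = mulL2 (fun ζ => k ζ * l ζ) a := by
  apply Lp.ext
  filter_upwards [coeFn_mulL2 hl a, coeFn_mulL2 hk (mulL2 l a), coeFn_mulL2 (hk.mul hl) a]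
    with ζ h1 h2 h3
  rw [h2, h3, h1, mul_assoc]

theorem inner_L2 (a b : L2) : ⟪a, b⟫ = ∫ ζ, starRingEnd ℂ (a ζ) * b ζ := by
  rw [L2.inner_def]; congr 1; ext ζ; rw [RCLike.inner_apply, mul_comm]

theorem inner_mulL2_left (hk : IsMult k C) (a b : L2) :
    ⟪mulL2 k a, b⟫ = ⟪a, mulL2 (fun ζ => starRingEnd ℂ (k ζ)) b⟫ := by
  rw [inner_L2, inner_L2]
  apply integral_congr_ae
  filter_upwards [coeFn_mulL2 hk a, coeFn_mulL2 hk.conj b] with ζ h1 h2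
  rw [h1, h2, map_mul]; ring

theorem inner_mulL2_mulL2 (hk : IsMult k C) (hl : IsMult l D) (a b : L2) :
    ⟪mulL2 k a, mulL2 l b⟫ = ∫ ζ, starRingEnd ℂ (a ζ) * b ζ * (starRingEnd ℂ (k ζ) * l ζ) := by
  rw [inner_L2]
  apply integral_congr_ae
  filter_upwards [coeFn_mulL2 hk a, coeFn_mulL2 hl b] with ζ h1 h2
  rw [h1, h2, map_mul]; ring

end mulL2

/-! ### The Fourier transform on `L¹ ∩ L²` -/

theorem integral_fourier_mul {f g : Plane → ℂ} (hf : Integrable f) (hg : Integrable g) :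
    ∫ ξ, 𝓕 f ξ * g ξ = ∫ x, f x * 𝓕 g x := by
  have := VectorFourier.integral_fourierIntegral_smul_eq_flip (μ := (volume : Measure Plane))
    (ν := (volume : Measure Plane)) (L := innerₗ Plane)
    Real.continuous_fourierChar continuous_inner hf hg
  simp only [flip_innerₗ, smul_eq_mul] at this
  exact this

theorem norm_fourier_le (f : Plane → ℂ) (x : Plane) : ‖𝓕 f x‖ ≤ ∫ y, ‖f y‖ :=
  VectorFourier.norm_fourierIntegral_le_integral_norm _ _ _ _ _

theorem continuous_fourier {f : Plane → ℂ} (hf : Integrable f) : Continuous (𝓕 f) :=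
  VectorFourier.fourierIntegral_continuous Real.continuous_fourierChar continuous_inner hf

/-- The transform extended to `L²` and the Fourier integral agree because both have the same pairing
with smooth compactly supported functions. -/
theorem coeFn_fourier_L2 {g : L2} (hg : Integrable g) :
    ((𝓕 g : L2) : Plane → ℂ) =ᵐ[volume] 𝓕 (g : Plane → ℂ) := by
  apply ae_eq_of_integral_contDiff_smul_eq
  · exact (Lp.memLp (𝓕 g : L2)).locallyIntegrable (by norm_num)
  · exact (continuous_fourier hg).locallyIntegrable
  · intro φ φs φc
    have h₁ : HasCompactSupport (Complex.ofRealCLM ∘ φ) := φc.comp_left rfl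
    have h₂ : ContDiff ℝ ((⊤ : ℕ∞) : WithTop ℕ∞) (Complex.ofRealCLM ∘ φ) :=
      Complex.ofRealCLM.contDiff.comp φs
    let Φ : 𝓢(Plane, ℂ) := h₁.toSchwartzMap h₂
    have hΦ : ∀ x, Φ x = (φ x : ℂ) := fun x => rfl
    have e1 : ∫ x, φ x • (𝓕 g : L2) x = ((𝓕 g : L2) : 𝓢'(Plane, ℂ)) Φ := by
      rw [Lp.toTemperedDistribution_apply]; simp [hΦ]
    have e2 : ∫ x, φ x • 𝓕 (g : Plane → ℂ) x = ∫ x, 𝓕 (g : Plane → ℂ) x * Φ x := by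
      congr 1; ext x; rw [hΦ, Complex.real_smul, mul_comm]
    rw [e1, e2, integral_fourier_mul hg Φ.integrable, ← Lp.fourier_toTemperedDistribution_eq,
      TemperedDistribution.fourier_apply, Lp.toTemperedDistribution_apply]
    congr 1; ext x
    rw [smul_eq_mul, mul_comm, SchwartzMap.fourier_coe]

theorem conj_fourier (f : Plane → ℂ) (ζ : Plane) :
    starRingEnd ℂ (𝓕 f ζ) = 𝓕 (fun x => starRingEnd ℂ (f (-x))) ζ := by
  rw [Real.fourier_eq', Real.fourier_eq', ← integral_conj, ← integral_neg_eq_self]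
  congr 1; ext x
  simp only [smul_eq_mul, map_mul, ← Complex.exp_conj, Complex.conj_ofReal, Complex.conj_I,
    inner_neg_left]
  congr 2; push_cast; ring

/-- In physical space the multiplier `k` is convolution with a kernel bounded by `B`, hence maps
`L¹` to `L^∞`. The proof uses the multiplication formula twice instead of convolutions. -/
theorem norm_integral_fourier_mul_le {k f g : Plane → ℂ} {B : ℝ} (hk : Integrable k)
    (hB : ∀ x, ‖𝓕 k x‖ ≤ B) (hf : Integrable f) (hg : Integrable g) :
    ‖∫ ζ, starRingEnd ℂ (𝓕 f ζ) * 𝓕 g ζ * k ζ‖ ≤ B * (∫ x, ‖f x‖) * ∫ x, ‖g x‖ := by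
  let f' : Plane → ℂ := fun x => starRingEnd ℂ (f (-x))
  have hf' : Integrable f' := by
    have := hf.comp_neg
    exact (LinearIsometryEquiv.integrable_comp_iff (Complex.conjLIE)).2 this
  have hf'n : ∫ x, ‖f' x‖ = ∫ x, ‖f x‖ := by
    rw [← integral_neg_eq_self]; congr 1; ext x; simp [f']
  have hfk : Integrable (fun ζ => 𝓕 f' ζ * k ζ) :=
    hk.bdd_mul (continuous_fourier hf').aestronglyMeasurable
      (Filter.Eventually.of_forall (norm_fourier_le f'))
  have e1 : ∫ ζ, starRingEnd ℂ (𝓕 f ζ) * 𝓕 g ζ * k ζ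
      = ∫ x, g x * 𝓕 (fun ζ => 𝓕 f' ζ * k ζ) x := by
    rw [← integral_fourier_mul hg hfk]
    congr 1; ext ζ
    rw [conj_fourier]; ring
  have hbound : ∀ y, ‖𝓕 (fun ζ => 𝓕 f' ζ * k ζ) y‖ ≤ B * ∫ x, ‖f x‖ := by
    intro y
    -- Modulating `k` translates its transform, so the bound `B` is preserved.
    let ky : Plane → ℂ := fun ζ => Complex.exp (((-2 * Real.pi * inner ℝ ζ y : ℝ) : ℂ) * Complex.I) * k ζ
    have hky : Integrable ky := by
      refine hk.bdd_mul (c := 1) (Continuous.aestronglyMeasurable (by fun_prop))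
        (Filter.Eventually.of_forall fun ζ => ?_)
      rw [Complex.norm_exp_ofReal_mul_I]
    have hky2 : ∀ x, 𝓕 ky x = 𝓕 k (x + y) := by
      intro x
      rw [Real.fourier_eq', Real.fourier_eq']
      congr 1; ext ζ
      simp only [ky, smul_eq_mul]
      rw [← mul_assoc, ← Complex.exp_add, inner_add_right]
      congr 2; push_cast; ring
    have e2 : 𝓕 (fun ζ => 𝓕 f' ζ * k ζ) y = ∫ x, f' x * 𝓕 ky x := by
      rw [← integral_fourier_mul hf' hky, Real.fourier_eq']
      congr 1; ext ζ
      simp only [ky, smul_eq_mul]; ring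
    rw [e2, ← hf'n, mul_comm, ← integral_mul_const]
    refine norm_integral_le_of_norm_le (hf'.norm.mul_const B) (Filter.Eventually.of_forall fun x => ?_)
    rw [norm_mul, hky2]
    exact mul_le_mul_of_nonneg_left (hB _) (norm_nonneg _)
  rw [e1, mul_comm (B * _), ← integral_mul_const]
  refine norm_integral_le_of_norm_le (hg.norm.mul_const _) (Filter.Eventually.of_forall fun x => ?_)
  rw [norm_mul]
  exact mul_le_mul_of_nonneg_left (hbound _) (norm_nonneg _)

/-! ### The linear group and the dispersive estimate -/

theorem measurable_freqX : Measurable freqX := by unfold freqX; fun_prop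

theorem measurable_freqY : Measurable freqY := by unfold freqY; fun_prop

/-- The dispersion relation: the symbol of `∂_x³ - H D_x^α ∂_y²` is `-i` times it. -/
def phase (α : ℝ) (ζ : Plane) : ℝ :=
  freqX ζ ^ 3 + Real.sign (freqX ζ) * |freqX ζ| ^ α * freqY ζ ^ 2

theorem measurable_sign : Measurable Real.sign := by
  unfold Real.sign
  exact Measurable.ite measurableSet_Iio measurable_const
    (Measurable.ite measurableSet_Ioi measurable_const measurable_const)

theorem measurable_phase (α : ℝ) : Measurable (phase α) := by
  have := measurable_freqX
  have := measurable_freqY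
  have := measurable_sign.comp measurable_freqX
  have h2 : Measurable (fun ζ => Real.sign (freqX ζ)) := this
  unfold phase
  fun_prop

theorem linSymbol_eq (α : ℝ) (ζ : Plane) : linSymbol α ζ = -(Complex.I * phase α ζ) := by
  rw [linSymbol, hilbertSymbol, phase]
  push_cast
  linear_combination ((freqX ζ : ℂ) ^ 3 * Complex.I + Complex.I *
    (Real.sign (freqX ζ) : ℂ) * ((|freqX ζ| ^ α : ℝ) : ℂ) * (freqY ζ : ℂ) ^ 2) * Complex.I_sq

/-- The symbol of the group generated by `∂_x³ - H D_x^α ∂_y²`. -/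
def grpSymbol (α t : ℝ) (ζ : Plane) : ℂ := Complex.exp (((-(t * phase α ζ) : ℝ) : ℂ) * Complex.I)

theorem isMult_grpSymbol (α t : ℝ) : IsMult (grpSymbol α t) 1 := by
  refine ⟨?_, fun ζ => by rw [grpSymbol, Complex.norm_exp_ofReal_mul_I]⟩
  have := measurable_phase α
  unfold grpSymbol
  fun_prop

/-- The group generated by `∂_x³ - H D_x^α ∂_y²`, on the Fourier side. -/
def grp (α t : ℝ) (a : L2) : L2 := mulL2 (grpSymbol α t) a

/-- The frequency band `σ ξ ∈ [R, 2R)`. -/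
def band (σ R : ℝ) : Set Plane := {ζ | σ * freqX ζ ∈ Ico R (2 * R)}

theorem measurableSet_band (σ R : ℝ) : MeasurableSet (band σ R) :=
  (measurable_freqX.const_mul σ) measurableSet_Ico

/-- The symbol of `∂_x` restricted to a frequency band. -/
def bandDeriv (σ R : ℝ) (ζ : Plane) : ℂ :=
  (band σ R).indicator (fun ζ => Complex.I * (freqX ζ : ℂ)) ζ

theorem abs_freqX_of_mem_band {σ R : ℝ} (hσ : |σ| = 1) (hR : 0 < R) {ζ : Plane}
    (h : ζ ∈ band σ R) : |freqX ζ| = σ * freqX ζ := by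
  have h1 : R ≤ σ * freqX ζ := h.1
  rw [← abs_of_nonneg (hR.le.trans h1), abs_mul, hσ, one_mul]

theorem isMult_bandDeriv {σ R : ℝ} (hσ : |σ| = 1) (hR : 0 < R) :
    IsMult (bandDeriv σ R) (2 * R) := by
  refine ⟨?_, fun ζ => ?_⟩
  · have := measurable_freqX
    exact Measurable.indicator (by fun_prop) (measurableSet_band σ R)
  · by_cases h : ζ ∈ band σ R
    · rw [bandDeriv, indicator_of_mem h, norm_mul, Complex.norm_I, one_mul, Complex.norm_real,
        Real.norm_eq_abs, abs_freqX_of_mem_band hσ hR h]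
      exact h.2.le
    · rw [bandDeriv, indicator_of_notMem h, norm_zero]; positivity

/-- The Fourier transform of the functional `f ↦ (g, ∂_x P f)`, `P` the projection to a band. -/
def bandTest (σ R : ℝ) (g : L2) : L2 := mulL2 (fun ζ => starRingEnd ℂ (bandDeriv σ R ζ)) (𝓕 g)

/-- The dispersion relation is odd in `ξ`, so on the band it equals `σ (r³ + r^α η²)` with `r =
|ξ|`. This is why the sign enters the band multiplier as a factor of the time. -/
theorem bandMult_zero {α σ R : ℝ} (hσ : |σ| = 1) (hR : 0 < R) (t t' : ℝ) (ζ : Plane) :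
    bandMult α σ R (t' - t) 0 ζ =
      bandDeriv σ R ζ * starRingEnd ℂ (bandDeriv σ R ζ) *
        (starRingEnd ℂ (grpSymbol α (-t) ζ) * grpSymbol α (-t') ζ) := by
  by_cases h : ζ ∈ band σ R
  · have h0 := abs_freqX_of_mem_band hσ hR h
    have hpos : 0 < σ * freqX ζ := hR.trans_le h.1
    rw [bandMult, radMult, indicator_of_mem (show σ * freqX ζ ∈ Ico R (2 * R) from h), bandDeriv,
      indicator_of_mem h]
    have hs : σ * ((σ * freqX ζ) ^ 3 + (σ * freqX ζ) ^ α * freqY ζ ^ 2) = phase α ζ := by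
      rw [phase, h0]
      rcases eq_or_eq_neg_of_abs_eq hσ with rfl | rfl
      · rw [Real.sign_of_pos (by linarith)]; ring
      · rw [Real.sign_of_neg (by linarith)]; ring
    have hσ2 : σ ^ 2 = 1 := by rw [← sq_abs, hσ]; norm_num
    rw [show σ * (t' - t) * ((σ * freqX ζ) ^ 3 + (σ * freqX ζ) ^ α * freqY ζ ^ 2)
      = (t' - t) * phase α ζ by rw [← hs]; ring, mul_pow, hσ2]
    rw [grpSymbol, grpSymbol, ← Complex.exp_conj, ← Complex.exp_add]
    simp only [map_mul, Complex.conj_I, Complex.conj_ofReal]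
    have : Complex.I * (freqX ζ : ℂ) * (-Complex.I * (freqX ζ : ℂ)) = (freqX ζ : ℂ) ^ 2 := by
      linear_combination (-(freqX ζ : ℂ) ^ 2) * Complex.I_sq
    rw [this]
    congr 1
    · push_cast; ring
    · congr 1; push_cast; ring
  · rw [bandMult, radMult, bandDeriv, indicator_of_notMem h,
      indicator_of_notMem (show σ * freqX ζ ∉ Ico R (2 * R) from h)]
    simp

theorem integrable_of_eLpNorm_one_le {h : L2} (hh : eLpNorm h 1 volume ≤ 1) :
    Integrable h ∧ ∫ x, ‖h x‖ ≤ 1 := by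
  have hm : MemLp h 1 volume := ⟨(Lp.memLp h).1, hh.trans_lt ENNReal.one_lt_top⟩
  have hi := memLp_one_iff_integrable.1 hm
  refine ⟨hi, ?_⟩
  rw [integral_norm_eq_lintegral_enorm hi.1, ← eLpNorm_one_eq_lintegral_enorm]
  exact ENNReal.toReal_le_of_le_ofReal zero_le_one (by simpa using hh)

theorem inner_grp_bandTest {α σ R : ℝ} (hσ : |σ| = 1) (hR : 0 < R) (g g' : L2) (t t' : ℝ) :
    ⟪grp α (-t) (bandTest σ R g), grp α (-t') (bandTest σ R g')⟫
      = ∫ ζ, starRingEnd ℂ ((𝓕 g : L2) ζ) * (𝓕 g' : L2) ζ * bandMult α σ R (t' - t) 0 ζ := by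
  have hdm := (isMult_bandDeriv (R := R) hσ hR)
  have hU := isMult_grpSymbol α
  rw [grp, grp, bandTest, bandTest, mulL2_mulL2 (hU _) hdm.conj, mulL2_mulL2 (hU _) hdm.conj,
    inner_mulL2_mulL2 ((hU _).mul hdm.conj) ((hU _).mul hdm.conj)]
  refine integral_congr_ae (Filter.Eventually.of_forall fun ζ => ?_)
  simp only
  rw [bandMult_zero hσ hR t t' ζ, map_mul, Complex.conj_conj]; ring

theorem measurable_bandMult (α σ R τ δ : ℝ) : Measurable (bandMult α σ R τ δ) := by
  have h : Measurable (fun ζ : Plane => ((σ * freqX ζ, freqY ζ) : ℝ × ℝ)) :=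
    (measurable_freqX.const_mul σ).prodMk measurable_freqY
  have e : bandMult α σ R τ δ = (fun z : ℝ × ℝ => radMult α R (σ * τ) δ z.1 z.2) ∘
      (fun ζ : Plane => ((σ * freqX ζ, freqY ζ) : ℝ × ℝ)) := rfl
  rw [e]
  exact (measurable_radMult α R (σ * τ) δ).comp h

theorem norm_bandMult_le {α σ R τ δ : ℝ} (hα : -1 ≤ α) (hR : 0 < R) (hδ : 0 ≤ δ) (ζ : Plane) :
    ‖bandMult α σ R τ δ ζ‖ ≤ 4 * R ^ 2 := by
  refine (norm_radMult_le hα hR hδ).trans ?_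
  have h1 : Real.exp (-(δ * (R ^ α / 2)) * freqY ζ ^ 2) ≤ 1 := by
    rw [Real.exp_le_one_iff, neg_mul]
    have : 0 ≤ δ * (R ^ α / 2) * freqY ζ ^ 2 := by positivity
    linarith
  refine (mul_le_of_le_one_right (indicator_nonneg (fun _ _ => by positivity) _) h1).trans ?_
  exact indicator_apply_le' (fun _ => le_rfl) (fun _ => by positivity)

theorem continuous_bandMult_damping (α σ R τ : ℝ) (ζ : Plane) :
    Continuous (fun δ : ℝ => bandMult α σ R τ δ ζ) := by
  unfold bandMult radMult
  by_cases h : σ * freqX ζ ∈ Ico R (2 * R)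
  · simp only [indicator_of_mem h]; fun_prop
  · simp only [indicator_of_notMem h]; fun_prop

theorem tendsto_integral_bandMult {α σ R τ : ℝ} (hα : -1 ≤ α) (hR : 0 < R) (a b : L2) :
    Filter.Tendsto (fun n : ℕ => ∫ ζ, starRingEnd ℂ (a ζ) * b ζ *
      bandMult α σ R τ (1 / ((n : ℝ) + 1)) ζ) Filter.atTop
      (nhds (∫ ζ, starRingEnd ℂ (a ζ) * b ζ * bandMult α σ R τ 0 ζ)) := by
  have hprod : Integrable (fun ζ => ‖a ζ‖ * ‖b ζ‖) :=
    (Lp.memLp a).norm.integrable_mul (Lp.memLp b).norm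
  refine tendsto_integral_of_dominated_convergence
    (fun ζ => ‖a ζ‖ * ‖b ζ‖ * (4 * R ^ 2)) (fun n => ?_)
    (hprod.mul_const _) (fun n => ?_) ?_
  · exact ((RCLike.continuous_conj.comp_aestronglyMeasurable (Lp.memLp a).1).mul
      (Lp.memLp b).1).mul (measurable_bandMult α σ R τ _).aestronglyMeasurable
  · filter_upwards with ζ
    rw [norm_mul, norm_mul, RCLike.norm_conj]
    exact mul_le_mul_of_nonneg_left (norm_bandMult_le hα hR (by positivity) ζ) (by positivity)
  · filter_upwards with ζ
    exact (((continuous_bandMult_damping α σ R τ ζ).tendsto 0).comp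
      tendsto_one_div_add_atTop_nhds_zero_nat).const_mul _

/-- The dispersive estimate in dual form. The undamped multiplier need not be integrable in `η`, so
the kernel bound is applied with damping `1 / (n + 1)` and passed to the limit. -/
theorem norm_inner_grp_bandTest_le {α σ R ε : ℝ} (hσ : |σ| = 1) (hα : -1 ≤ α) (hα1 : α ≤ 1)
    (hR : 0 < R) (hε : 0 ≤ ε) (hε1 : ε ≤ 1) {g g' : L2} (hg : eLpNorm g 1 volume ≤ 1)
    (hg' : eLpNorm g' 1 volume ≤ 1) {t t' : ℝ} (ht : t ≠ t') :
    ‖⟪grp α (-t) (bandTest σ R g), grp α (-t') (bandTest σ R g')⟫‖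
      ≤ 2000 * (R ^ (2 - α / 2 + ε) * |t - t'| ^ (-(5 / 6 - ε / 3))) := by
  have hσ0 : σ ≠ 0 := fun h => by simp [h] at hσ
  obtain ⟨gi, gn⟩ := integrable_of_eLpNorm_one_le hg
  obtain ⟨gi', gn'⟩ := integrable_of_eLpNorm_one_le hg'
  rw [inner_grp_bandTest hσ hR]
  refine le_of_tendsto (tendsto_integral_bandMult hα hR (𝓕 g : L2) (𝓕 g' : L2)).norm
    (Filter.Eventually.of_forall fun n => ?_)
  have hδ : (0 : ℝ) < 1 / ((n : ℝ) + 1) := by positivity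
  have e2 : ∫ ζ, starRingEnd ℂ ((𝓕 g : L2) ζ) * (𝓕 g' : L2) ζ *
      bandMult α σ R (t' - t) (1 / ((n : ℝ) + 1)) ζ
      = ∫ ζ, starRingEnd ℂ (𝓕 (g : Plane → ℂ) ζ) * 𝓕 (g' : Plane → ℂ) ζ *
      bandMult α σ R (t' - t) (1 / ((n : ℝ) + 1)) ζ := by
    apply integral_congr_ae
    filter_upwards [coeFn_fourier_L2 gi, coeFn_fourier_L2 gi'] with ζ h1 h2
    rw [h1, h2]
  rw [e2]
  have ht' : t' - t ≠ 0 := sub_ne_zero.2 ht.symm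
  have := norm_integral_fourier_mul_le (integrable_bandMult (t' - t) hσ0 hα hR hδ)
    (norm_fourier_bandMult_le hσ hα hα1 hR ht' hδ hε hε1) gi gi'
  rw [abs_sub_comm t' t] at this
  refine this.trans ?_
  have h1 : 0 ≤ ∫ x, ‖g x‖ := integral_nonneg fun _ => norm_nonneg _
  have h2 : 0 ≤ ∫ x, ‖g' x‖ := integral_nonneg fun _ => norm_nonneg _
  have hB0 : 0 ≤ 2000 * (R ^ (2 - α / 2 + ε) * |t - t'| ^ (-(5 / 6 - ε / 3))) := by positivity
  exact (mul_le_of_le_one_right (mul_nonneg hB0 h1) gn').trans (mul_le_of_le_one_right hB0 gn)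

/-! ### The `TT*` argument in a Hilbert space -/

theorem integrableOn_abs_sub_rpow {γ p q t : ℝ} (hγ1 : γ < 1) (hpt : p ≤ t)
    (htq : t ≤ q) :
    IntegrableOn (fun u => |t - u| ^ (-γ)) (Ioc p q) ∧
      ∫ u in Ioc p q, |t - u| ^ (-γ) ≤ 2 / (1 - γ) * (q - p) ^ (1 - γ) := by
  have hr : -1 < -γ := by linarith
  have hI : ∀ a b, IntervalIntegrable (fun x : ℝ => x ^ (-γ)) volume a b := fun a b =>
    intervalIntegral.intervalIntegrable_rpow' hr
  have i1 : IntervalIntegrable (fun u => (t - u) ^ (-γ)) volume p t := by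
    simpa using (hI (t - p) 0).comp_sub_left t
  have i2 : IntervalIntegrable (fun u => (u - t) ^ (-γ)) volume t q := by
    simpa using (hI 0 (q - t)).comp_sub_right t
  have e1 : EqOn (fun u => (t - u) ^ (-γ)) (fun u => |t - u| ^ (-γ)) (Ioc p t) := fun u hu => by
    simp only; rw [abs_of_nonneg (by linarith [hu.2])]
  have e2 : EqOn (fun u => (u - t) ^ (-γ)) (fun u => |t - u| ^ (-γ)) (Ioc t q) := fun u hu => by
    simp only; rw [abs_sub_comm, abs_of_nonneg (by linarith [hu.1])]
  have j1 : IntegrableOn (fun u => |t - u| ^ (-γ)) (Ioc p t) :=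
    i1.1.congr_fun e1 measurableSet_Ioc
  have j2 : IntegrableOn (fun u => |t - u| ^ (-γ)) (Ioc t q) :=
    i2.1.congr_fun e2 measurableSet_Ioc
  have hu : Ioc p q = Ioc p t ∪ Ioc t q := (Ioc_union_Ioc_eq_Ioc hpt htq).symm
  refine ⟨hu ▸ j1.union j2, ?_⟩
  rw [hu, setIntegral_union (Ioc_disjoint_Ioc_of_le le_rfl) measurableSet_Ioc j1 j2,
    ← setIntegral_congr_fun measurableSet_Ioc e1, ← setIntegral_congr_fun measurableSet_Ioc e2,
    ← intervalIntegral.integral_of_le hpt, ← intervalIntegral.integral_of_le htq,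
    intervalIntegral.integral_comp_sub_left (fun x => x ^ (-γ)) t,
    intervalIntegral.integral_comp_sub_right (fun x => x ^ (-γ)) t, sub_self,
    integral_rpow (Or.inl hr), integral_rpow (Or.inl hr),
    Real.zero_rpow (by linarith : -γ + 1 ≠ 0)]
  have h1 : (t - p) ^ (-γ + 1) ≤ (q - p) ^ (1 - γ) := by
    rw [show -γ + 1 = 1 - γ by ring]
    exact Real.rpow_le_rpow (by linarith) (by linarith) (by linarith)
  have h2 : (q - t) ^ (-γ + 1) ≤ (q - p) ^ (1 - γ) := by
    rw [show -γ + 1 = 1 - γ by ring]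
    exact Real.rpow_le_rpow (by linarith) (by linarith) (by linarith)
  have h0 : 0 < 1 - γ := by linarith
  rw [show -γ + 1 = 1 - γ by ring] at *
  rw [sub_zero, sub_zero, ← add_div, div_mul_eq_mul_div]
  gcongr
  linarith

/-- Expanding the square of the norm gives a double integral of `|t - t'|^(-γ)`, of order `(q -
p)^(2 - γ)`; the diagonal is a null set. -/
theorem norm_integral_le_of_inner_le {H : Type*} [NormedAddCommGroup H] [InnerProductSpace ℂ H]
    [CompleteSpace H] {b : ℝ → H} {κ γ p q : ℝ} (hγ1 : γ < 1) (hκ : 0 ≤ κ)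
    (hpq : p ≤ q) (hb : IntegrableOn b (Ioc p q))
    (h : ∀ t ∈ Ioc p q, ∀ t' ∈ Ioc p q, t ≠ t' → ‖⟪b t, b t'⟫‖ ≤ κ * |t - t'| ^ (-γ)) :
    ‖∫ t in Ioc p q, b t‖ ≤ √(κ * (2 / (1 - γ))) * (q - p) ^ (1 - γ / 2) := by
  set x := ∫ t in Ioc p q, b t with hx
  set c := κ * (2 / (1 - γ) * (q - p) ^ (1 - γ)) with hc
  have hg : 0 < 1 - γ := by linarith
  have hqp : 0 ≤ q - p := by linarith
  have h1 : ∀ t ∈ Ioc p q, ‖⟪x, b t⟫‖ ≤ c := by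
    intro t ht
    obtain ⟨hi, hle⟩ := integrableOn_abs_sub_rpow hγ1 ht.1.le ht.2
    rw [← inner_conj_symm, RCLike.norm_conj, hx, ← integral_inner hb]
    refine (norm_integral_le_of_norm_le (hi.const_mul κ) ?_).trans ?_
    · have hne : ∀ᵐ u ∂(volume.restrict (Ioc p q)), u ≠ t :=
        ae_restrict_of_ae (Measure.ae_ne volume t)
      filter_upwards [hne, ae_restrict_mem measurableSet_Ioc] with u hu hu'
      exact h t ht u hu' hu.symm
    · rw [integral_const_mul]
      exact mul_le_mul_of_nonneg_left hle hκ
  have h2 : ‖x‖ ^ 2 ≤ c * (q - p) := by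
    have e : ‖x‖ ^ 2 = ‖⟪x, x⟫‖ := by
      rw [inner_self_eq_norm_sq_to_K]; simp
    rw [e]
    nth_rewrite 2 [hx]
    rw [← integral_inner hb]
    have := norm_setIntegral_le_of_norm_le_const (μ := volume) (s := Ioc p q) (C := c)
      (f := fun t => ⟪x, b t⟫) (by simp) h1
    simpa [Measure.real, hqp] using this
  have h3 : c * (q - p) = (√(κ * (2 / (1 - γ))) * (q - p) ^ (1 - γ / 2)) ^ 2 := by
    rw [mul_pow, Real.sq_sqrt (by positivity), ← Real.rpow_natCast, ← Real.rpow_mul hqp, hc]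
    rw [show (1 - γ / 2) * ((2 : ℕ) : ℝ) = (1 - γ) + 1 by push_cast; ring,
      Real.rpow_add_of_nonneg hqp hg.le zero_le_one, Real.rpow_one]
    ring
  rw [h3] at h2
  exact le_of_sq_le_sq h2 (by positivity)

/-- A measurable choice of an index at which a finite family of continuous functions is maximal. -/
theorem exists_measurable_argmax {u : ℕ → ℝ → ℝ} (hu : ∀ n, Measurable (u n)) (N : ℕ) :
    ∃ ν : ℝ → ℕ, Measurable ν ∧ ∀ t, ν t ≤ N ∧ ∀ m ≤ N, u m t ≤ u (ν t) t := by
  classical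
  have hex : ∀ t, ∃ n, n ≤ N ∧ ∀ m ≤ N, u m t ≤ u n t := fun t => by
    obtain ⟨n, hn, hmax⟩ := Finset.exists_max_image (Finset.range (N + 1)) (fun n => u n t)
      ⟨0, by simp⟩
    exact ⟨n, by simpa [Nat.lt_succ_iff] using hn,
      fun m hm => hmax m (by simpa [Nat.lt_succ_iff] using hm)⟩
  refine ⟨fun t => Nat.find (hex t), measurable_find hex fun n => ?_,
    fun t => Nat.find_spec (hex t)⟩
  by_cases hn : n ≤ N
  · have : {t | n ≤ N ∧ ∀ m ≤ N, u m t ≤ u n t} = ⋂ m, ⋂ (_ : m ≤ N), {t | u m t ≤ u n t} := by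
      ext t; simp [hn]
    rw [this]
    exact MeasurableSet.iInter fun m => MeasurableSet.iInter fun _ =>
      measurableSet_le (hu m) (hu n)
  · have : {t | n ≤ N ∧ ∀ m ≤ N, u m t ≤ u n t} = ∅ := by ext t; simp [hn]
    rw [this]; exact MeasurableSet.empty

/-- The hypotheses of the `TT*` argument: `v` solves a Duhamel equation with forcing `f` tested
against the vectors `a n`, and the propagator `U` satisfies a dispersive estimate on them. -/
structure IsDispersive {H : Type*} [NormedAddCommGroup H] [InnerProductSpace ℂ H]
    (U : ℝ → H → H) (a : ℕ → H) (v f : ℝ → H) (κ γ p q : ℝ) : Prop where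
  cont : ∀ x, Continuous fun t => U t x
  norm_le : ∀ t x, ‖U t x‖ ≤ ‖x‖
  cont_v : Continuous v
  int_f : IntegrableOn f (Ioc p q)
  duhamel : ∀ n, ∀ t ∈ Ioc p q,
    ⟪a n, v t⟫ = ⟪U (p - t) (a n), v p⟫ + ∫ s in Ioc p t, ⟪U (s - t) (a n), f s⟫
  decay : ∀ n m s t t', t ≠ t' → ‖⟪U (s - t) (a n), U (s - t') (a m)⟫‖ ≤ κ * |t - t'| ^ (-γ)

/-- The phase that turns `z` into its absolute value. -/
def unitPhase (z : ℂ) : ℂ := z / (‖z‖ : ℂ)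

theorem measurable_unitPhase : Measurable unitPhase := by unfold unitPhase; fun_prop

theorem norm_unitPhase_le (z : ℂ) : ‖unitPhase z‖ ≤ 1 := by
  rw [unitPhase, norm_div, Complex.norm_real, norm_norm]; exact div_self_le_one _

theorem conj_unitPhase_mul (z : ℂ) : starRingEnd ℂ (unitPhase z) * z = (‖z‖ : ℂ) := by
  rw [unitPhase, map_div₀, Complex.conj_ofReal, div_mul_eq_mul_div, Complex.conj_mul']
  by_cases h : z = 0
  · simp [h]
  · have : (‖z‖ : ℂ) ≠ 0 := by exact_mod_cast norm_ne_zero_iff.2 h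
    field_simp

section IsDispersive

variable {H : Type*} [NormedAddCommGroup H] [InnerProductSpace ℂ H]
  {U : ℝ → H → H} {a : ℕ → H} {v f : ℝ → H} {κ γ p q : ℝ}

/-- The dual object `1_{s ≤ t} θ(t) U(s - t) a_{ν(t)}` of the `TT*` argument. -/
def dualTest (U : ℝ → H → H) (a : ℕ → H) (v : ℝ → H) (ν : ℝ → ℕ) (s t : ℝ) : H :=
  open Classical in
  if s ≤ t then unitPhase ⟪a (ν t), v t⟫ • U (s - t) (a (ν t)) else 0

theorem IsDispersive.norm_dualTest_le (h : IsDispersive U a v f κ γ p q) {ν : ℝ → ℕ} {N : ℕ}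
    (hν : ∀ t, ν t ≤ N) (s t : ℝ) :
    ‖dualTest U a v ν s t‖ ≤ ∑ n ∈ Finset.range (N + 1), ‖a n‖ := by
  have h0 : 0 ≤ ∑ n ∈ Finset.range (N + 1), ‖a n‖ := Finset.sum_nonneg fun _ _ => norm_nonneg _
  rw [dualTest]
  split_ifs
  · rw [norm_smul]
    refine (mul_le_of_le_one_left (norm_nonneg _) (norm_unitPhase_le _)).trans ?_
    refine (h.norm_le _ _).trans ?_
    exact Finset.single_le_sum (f := fun n => ‖a n‖) (fun _ _ => norm_nonneg _)
      (Finset.mem_range.2 (Nat.lt_succ_of_le (hν t)))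
  · simpa using h0

theorem IsDispersive.norm_inner_dualTest_le (h : IsDispersive U a v f κ γ p q) (ν : ℝ → ℕ)
    (s : ℝ) {t t' : ℝ} (htt : t ≠ t') (hκ : 0 ≤ κ) :
    ‖⟪dualTest U a v ν s t, dualTest U a v ν s t'⟫‖ ≤ κ * |t - t'| ^ (-γ) := by
  have h0 : 0 ≤ κ * |t - t'| ^ (-γ) := by positivity
  rw [dualTest, dualTest]
  split_ifs
  · rw [inner_smul_left, inner_smul_right, norm_mul, norm_mul, RCLike.norm_conj]
    exact (mul_le_of_le_one_left (by positivity) (norm_unitPhase_le _)).trans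
      ((mul_le_of_le_one_left (by positivity) (norm_unitPhase_le _)).trans
        (h.decay _ _ _ _ _ htt))
  all_goals simpa using h0

/-- This is Duhamel's formula multiplied by a unimodular factor (or by `0`). The cutoff `s ≤ t` sits
in the dual object, so the time integral runs over a fixed interval and Fubini applies. -/
theorem IsDispersive.norm_inner_eq (h : IsDispersive U a v f κ γ p q) (ν : ℝ → ℕ) {t : ℝ}
    (ht : t ∈ Ioc p q) :
    ((‖⟪a (ν t), v t⟫‖ : ℝ) : ℂ) = ⟪dualTest U a v ν p t, v p⟫
      + ∫ s in Ioc p q, ⟪dualTest U a v ν s t, f s⟫ := by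
  have e1 : ∫ s in Ioc p q, ⟪dualTest U a v ν s t, f s⟫
      = ∫ s in Ioc p t, ⟪unitPhase ⟪a (ν t), v t⟫ • U (s - t) (a (ν t)), f s⟫ := by
    have hs : Ioc p t ⊆ Ioc p q := Ioc_subset_Ioc_right ht.2
    have h1 : ∫ s in Ioc p q, ⟪dualTest U a v ν s t, f s⟫
        = ∫ s in Ioc p t, ⟪dualTest U a v ν s t, f s⟫ := by
      refine setIntegral_eq_of_subset_of_forall_sdiff_eq_zero measurableSet_Ioc hs fun s hs' => ?_
      have : ¬ s ≤ t := fun hst => hs'.2 ⟨hs'.1.1, hst⟩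
      rw [dualTest, if_neg this, inner_zero_left]
    rw [h1]
    refine setIntegral_congr_fun measurableSet_Ioc fun s hs' => ?_
    rw [dualTest, if_pos hs'.2]
  rw [e1, dualTest, if_pos ht.1.le]
  simp_rw [inner_smul_left]
  rw [integral_const_mul, ← mul_add, ← h.duhamel _ t ht, conj_unitPhase_mul]

variable [SecondCountableTopology H]

theorem IsDispersive.stronglyMeasurable_dualTest (h : IsDispersive U a v f κ γ p q) {ν : ℝ → ℕ}
    (hν : Measurable ν) : StronglyMeasurable fun z : ℝ × ℝ => dualTest U a v ν z.1 z.2 := by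
  -- A measurable index with countably many values preserves measurability.
  have hcount : ∀ g : ℕ → ℝ × ℝ → H, (∀ n, StronglyMeasurable (g n)) →
      StronglyMeasurable fun z : ℝ × ℝ => g (ν z.2) z := by
    intro g hg
    borelize H
    refine Measurable.stronglyMeasurable ?_
    have h1 : Measurable (Function.uncurry fun (z : ℝ × ℝ) (n : ℕ) => g n z) :=
      measurable_from_prod_countable_left fun n => (hg n).measurable
    exact h1.comp (measurable_id.prodMk (hν.comp measurable_snd))
  have hmain : StronglyMeasurable fun z : ℝ × ℝ =>
      unitPhase ⟪a (ν z.2), v z.2⟫ • U (z.1 - z.2) (a (ν z.2)) :=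
    hcount (fun n z => unitPhase ⟪a n, v z.2⟫ • U (z.1 - z.2) (a n)) fun n => by
      have h1 : Continuous fun z : ℝ × ℝ => ⟪a n, v z.2⟫ :=
        continuous_const.inner (h.cont_v.comp continuous_snd)
      have h2 : Continuous fun z : ℝ × ℝ => U (z.1 - z.2) (a n) :=
        (h.cont (a n)).comp (continuous_fst.sub continuous_snd)
      exact (measurable_unitPhase.comp h1.measurable).stronglyMeasurable.smul h2.stronglyMeasurable
  exact StronglyMeasurable.ite (measurableSet_le measurable_fst measurable_snd) hmain
    stronglyMeasurable_const

theorem IsDispersive.integrableOn_dualTest (h : IsDispersive U a v f κ γ p q) {ν : ℝ → ℕ} {N : ℕ}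
    (hνm : Measurable ν) (hν : ∀ t, ν t ≤ N) (s : ℝ) :
    IntegrableOn (dualTest U a v ν s) (Ioc p q) := by
  have hm : StronglyMeasurable (dualTest U a v ν s) :=
    (h.stronglyMeasurable_dualTest hνm).comp_measurable measurable_prodMk_left
  exact IntegrableOn.of_bound (by simp) hm.aestronglyMeasurable _
    (Filter.Eventually.of_forall fun t => h.norm_dualTest_le hν s t)

theorem IsDispersive.integrable_inner_dualTest (h : IsDispersive U a v f κ γ p q) {ν : ℝ → ℕ}
    {N : ℕ} (hνm : Measurable ν) (hν : ∀ t, ν t ≤ N) :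
    Integrable (Function.uncurry fun t s => ⟪dualTest U a v ν s t, f s⟫)
      ((volume.restrict (Ioc p q)).prod (volume.restrict (Ioc p q))) := by
  set D := ∑ n ∈ Finset.range (N + 1), ‖a n‖
  have hf : Integrable (fun z : ℝ × ℝ => D * ‖f z.2‖)
      ((volume.restrict (Ioc p q)).prod (volume.restrict (Ioc p q))) := by
    have h1 : Integrable (fun _ : ℝ => D) (volume.restrict (Ioc p q)) :=
      integrable_const D
    exact h1.mul_prod h.int_f.norm
  refine hf.mono' ?_ (Filter.Eventually.of_forall fun z => ?_)
  · have h1 : AEStronglyMeasurable (fun z : ℝ × ℝ => dualTest U a v ν z.2 z.1)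
        ((volume.restrict (Ioc p q)).prod (volume.restrict (Ioc p q))) :=
      ((h.stronglyMeasurable_dualTest hνm).comp_measurable measurable_swap).aestronglyMeasurable
    have h2 : AEStronglyMeasurable (fun z : ℝ × ℝ => f z.2)
        ((volume.restrict (Ioc p q)).prod (volume.restrict (Ioc p q))) :=
      h.int_f.aestronglyMeasurable.comp_snd
    exact h1.inner h2
  · exact (norm_inner_le_norm _ _).trans
      (mul_le_mul_of_nonneg_right (h.norm_dualTest_le hν _ _) (norm_nonneg _))

variable [CompleteSpace H]

theorem IsDispersive.norm_integral_dualTest_le (h : IsDispersive U a v f κ γ p q) {ν : ℝ → ℕ}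
    {N : ℕ} (hνm : Measurable ν) (hν : ∀ t, ν t ≤ N) (hκ : 0 ≤ κ) (hγ : γ < 1) (hpq : p ≤ q)
    (s : ℝ) :
    ‖∫ t in Ioc p q, dualTest U a v ν s t‖ ≤ √(κ * (2 / (1 - γ))) * (q - p) ^ (1 - γ / 2) :=
  norm_integral_le_of_inner_le hγ hκ hpq (h.integrableOn_dualTest hνm hν s)
    fun _ _ _ _ htt => h.norm_inner_dualTest_le ν s htt hκ

/-- After exchanging the integrals, the forcing at each fixed time `s` meets the single vector `∫
dualTest U a v ν s t dt`, whose norm is bounded uniformly in `s`. As the forcing is measured in `L¹`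
of time, the retarded integral needs no further argument. -/
theorem IsDispersive.integral_norm_le (h : IsDispersive U a v f κ γ p q) {ν : ℝ → ℕ}
    {N : ℕ} (hνm : Measurable ν) (hν : ∀ t, ν t ≤ N) (hκ : 0 ≤ κ) (hγ : γ < 1) (hpq : p ≤ q) :
    ∫ t in Ioc p q, ‖⟪a (ν t), v t⟫‖ ≤ √(κ * (2 / (1 - γ))) * (q - p) ^ (1 - γ / 2) *
      (‖v p‖ + ∫ s in Ioc p q, ‖f s‖) := by
  set K := √(κ * (2 / (1 - γ))) * (q - p) ^ (1 - γ / 2) with hK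
  have hi := h.integrable_inner_dualTest hνm hν
  have hK' := h.norm_integral_dualTest_le hνm hν hκ hγ hpq
  have e1 : ((∫ t in Ioc p q, ‖⟪a (ν t), v t⟫‖ : ℝ) : ℂ)
      = (∫ t in Ioc p q, ⟪dualTest U a v ν p t, v p⟫)
        + ∫ s in Ioc p q, ∫ t in Ioc p q, ⟪dualTest U a v ν s t, f s⟫ := by
    have hi' : Integrable (fun t => ∫ s in Ioc p q, ⟪dualTest U a v ν s t, f s⟫)
        (volume.restrict (Ioc p q)) := hi.integral_prod_left
    rw [← integral_integral_swap hi, ← integral_add ?_ hi', ← integral_complex_ofReal]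
    · exact setIntegral_congr_fun measurableSet_Ioc fun t ht => h.norm_inner_eq ν ht
    · exact (h.integrableOn_dualTest hνm hν p).inner_const (v p)
  have hswap : ∀ s, ∀ y : H, ‖∫ t in Ioc p q, ⟪dualTest U a v ν s t, y⟫‖ ≤ K * ‖y‖ := by
    intro s y
    have : ∫ t in Ioc p q, ⟪dualTest U a v ν s t, y⟫
        = starRingEnd ℂ ⟪y, ∫ t in Ioc p q, dualTest U a v ν s t⟫ := by
      rw [← integral_inner (h.integrableOn_dualTest hνm hν s), ← integral_conj]
      congr 1; ext t; rw [inner_conj_symm]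
    rw [this, RCLike.norm_conj, mul_comm]
    exact (norm_inner_le_norm _ _).trans (mul_le_mul_of_nonneg_left (hK' s) (norm_nonneg _))
  have h0 : 0 ≤ ∫ t in Ioc p q, ‖⟪a (ν t), v t⟫‖ := integral_nonneg fun _ => norm_nonneg _
  calc ∫ t in Ioc p q, ‖⟪a (ν t), v t⟫‖
      = ‖((∫ t in Ioc p q, ‖⟪a (ν t), v t⟫‖ : ℝ) : ℂ)‖ := by
        rw [Complex.norm_real, Real.norm_of_nonneg h0]
    _ ≤ K * ‖v p‖ + ∫ s in Ioc p q, K * ‖f s‖ := by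
        rw [e1]
        refine (norm_add_le _ _).trans (add_le_add (hswap _ _) ?_)
        exact norm_integral_le_of_norm_le (h.int_f.norm.const_mul K)
          (Filter.Eventually.of_forall fun s => hswap s (f s))
    _ = _ := by rw [integral_const_mul, mul_add]

/-- The supremum over the first `N + 1` indices is attained at a measurable index; the bound is
independent of `N`, and monotone convergence concludes. -/
theorem IsDispersive.lintegral_iSup_le (h : IsDispersive U a v f κ γ p q)
    (hκ : 0 ≤ κ) (hγ : γ < 1) (hpq : p ≤ q) :
    ∫⁻ t in Ioc p q, ⨆ n, ‖⟪a n, v t⟫‖ₑ ≤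
      ENNReal.ofReal (√(κ * (2 / (1 - γ))) * (q - p) ^ (1 - γ / 2)) *
      (‖v p‖ₑ + ∫⁻ s in Ioc p q, ‖f s‖ₑ) := by
  have hc : ∀ n, Continuous fun t => ⟪a n, v t⟫ := fun n => continuous_const.inner h.cont_v
  have hm : ∀ n, Measurable fun t => ‖⟪a n, v t⟫‖ₑ := fun n => (hc n).measurable.enorm
  have e : ∀ t, ⨆ n, ‖⟪a n, v t⟫‖ₑ
      = ⨆ N, (partialSups fun n => ‖⟪a n, v t⟫‖ₑ) N := fun t => (iSup_partialSups_eq _).symm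
  simp_rw [e]
  have hpm : ∀ N, Measurable fun t => (partialSups fun n => ‖⟪a n, v t⟫‖ₑ) N := by
    intro N
    induction N with
    | zero => simpa using hm 0
    | succ N ih => simp_rw [partialSups_add_one]; exact ih.sup (hm _)
  rw [lintegral_iSup hpm fun N M hNM t => (partialSups _).mono hNM]
  refine iSup_le fun N => ?_
  obtain ⟨ν, hνm, hν⟩ := exists_measurable_argmax (u := fun n t => ‖⟪a n, v t⟫‖)
    (fun n => (hc n).norm.measurable) N
  have h1 : ∀ t, (partialSups fun n => ‖⟪a n, v t⟫‖ₑ) N ≤ ‖⟪a (ν t), v t⟫‖ₑ := fun t =>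
    partialSups_le _ _ _ fun m hm => by
      rw [enorm_le_iff_norm_le]; exact (hν t).2 m hm
  refine (lintegral_mono h1).trans ?_
  have hνN := fun t => (hν t).1
  have hint : IntegrableOn (fun t => ⟪a (ν t), v t⟫) (Ioc p q) := by
    have hz : Measurable fun t => ⟪a (ν t), v t⟫ := by
      have h1 : Measurable (Function.uncurry fun (t : ℝ) (n : ℕ) => ⟪a n, v t⟫) :=
        measurable_from_prod_countable_left fun n => (hc n).measurable
      exact h1.comp (measurable_id.prodMk hνm)
    obtain ⟨C, hC⟩ := (isCompact_Icc (a := p) (b := q)).exists_bound_of_continuousOn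
      h.cont_v.continuousOn
    refine IntegrableOn.of_bound (by simp) hz.aestronglyMeasurable
      ((∑ n ∈ Finset.range (N + 1), ‖a n‖) * C) ?_
    filter_upwards [ae_restrict_mem measurableSet_Ioc] with t ht
    have h2 : ‖a (ν t)‖ ≤ ∑ n ∈ Finset.range (N + 1), ‖a n‖ :=
      Finset.single_le_sum (f := fun n => ‖a n‖) (fun _ _ => norm_nonneg _)
        (Finset.mem_range.2 (Nat.lt_succ_of_le (hνN t)))
    exact (norm_inner_le_norm _ _).trans (mul_le_mul h2 (hC t (Ioc_subset_Icc_self ht))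
      (norm_nonneg _) ((norm_nonneg _).trans h2))
  rw [← ofReal_integral_norm_eq_lintegral_enorm hint,
    ← ofReal_integral_norm_eq_lintegral_enorm h.int_f, ← ofReal_norm (v p),
    ← ENNReal.ofReal_add (norm_nonneg _) (integral_nonneg fun _ => norm_nonneg _),
    ← ENNReal.ofReal_mul (mul_nonneg (Real.sqrt_nonneg _)
      (Real.rpow_nonneg (by linarith) _))]
  exact ENNReal.ofReal_le_ofReal (h.integral_norm_le hνm hνN hκ hγ hpq)

end IsDispersive

/-! ### The Duhamel formula -/

section Duhamel

variable {H : Type*} [NormedAddCommGroup H] [InnerProductSpace ℂ H]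

theorem integrable_inner_prod [SecondCountableTopology H] {ω g : ℝ → H} {t : ℝ}
    (hω : Continuous ω) (hg : IntegrableOn g (Ioc 0 t)) :
    Integrable (fun z : ℝ × ℝ => ⟪ω z.1, g z.2⟫)
      ((volume.restrict (Ioc 0 t)).prod (volume.restrict (Ioc 0 t))) := by
  obtain ⟨C, hC⟩ := (isCompact_Icc (a := 0) (b := t)).exists_bound_of_continuousOn hω.continuousOn
  have h1 : Integrable (fun s => ‖ω s‖) (volume.restrict (Ioc 0 t)) :=
    IntegrableOn.of_bound (by simp) hω.norm.aestronglyMeasurable C (by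
      filter_upwards [ae_restrict_mem measurableSet_Ioc] with s hs
      rw [norm_norm]; exact hC s (Ioc_subset_Icc_self hs))
  refine (h1.mul_prod hg.norm).mono' ?_ (Filter.Eventually.of_forall fun z => norm_inner_le_norm _ _)
  have h2 : AEStronglyMeasurable (fun z : ℝ × ℝ => ω z.1)
      ((volume.restrict (Ioc 0 t)).prod (volume.restrict (Ioc 0 t))) :=
    (hω.comp continuous_fst).aestronglyMeasurable
  have h3 : AEStronglyMeasurable (fun z : ℝ × ℝ => g z.2)
      ((volume.restrict (Ioc 0 t)).prod (volume.restrict (Ioc 0 t))) :=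
    hg.aestronglyMeasurable.comp_snd
  exact h2.inner h3

theorem integrableOn_inner [SecondCountableTopology H] {ω g : ℝ → H} {t : ℝ}
    (hω : Continuous ω) (hg : IntegrableOn g (Ioc 0 t)) :
    IntegrableOn (fun r => ⟪ω r, g r⟫) (Ioc 0 t) := by
  obtain ⟨C, hC⟩ := (isCompact_Icc (a := 0) (b := t)).exists_bound_of_continuousOn hω.continuousOn
  refine (hg.norm.const_mul C).mono' (hω.aestronglyMeasurable.inner hg.aestronglyMeasurable) ?_
  filter_upwards [ae_restrict_mem measurableSet_Ioc] with s hs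
  exact (norm_inner_le_norm _ _).trans
    (mul_le_mul_of_nonneg_right (hC s (Ioc_subset_Icc_self hs)) (norm_nonneg _))

theorem integral_indicator_triangle (G : ℝ × ℝ → ℂ) {s t : ℝ} (hst : s ≤ t) :
    ∫ r in Ioc 0 t, {z : ℝ × ℝ | z.2 ≤ z.1}.indicator G (s, r) = ∫ r in Ioc 0 s, G (s, r) := by
  have h1 : ∫ r in Ioc 0 t, {z : ℝ × ℝ | z.2 ≤ z.1}.indicator G (s, r)
      = ∫ r in Ioc 0 s, {z : ℝ × ℝ | z.2 ≤ z.1}.indicator G (s, r) :=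
    setIntegral_eq_of_subset_of_forall_sdiff_eq_zero measurableSet_Ioc
      (Ioc_subset_Ioc_right hst) fun r hr =>
        indicator_of_notMem (s := {z : ℝ × ℝ | z.2 ≤ z.1})
          (fun h : r ≤ s => hr.2 ⟨hr.1.1, h⟩) G
  rw [h1]
  exact setIntegral_congr_fun measurableSet_Ioc fun r hr =>
    indicator_of_mem (show (s, r) ∈ {z : ℝ × ℝ | z.2 ≤ z.1} from hr.2) G

/-- Fubini on the triangle `r ≤ s ≤ t`, then the fundamental theorem of calculus in `s`. -/
theorem integral_triangle [SecondCountableTopology H] {θ ω g : ℝ → H} {t : ℝ}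
    (hω : Continuous ω) (hd : ∀ y s, HasDerivAt (fun s => ⟪θ s, y⟫) ⟪ω s, y⟫ s)
    (hg : IntegrableOn g (Ioc 0 t)) :
    ∫ s in Ioc 0 t, ∫ r in Ioc 0 s, ⟪ω s, g r⟫ = ∫ r in Ioc 0 t, (⟪θ t, g r⟫ - ⟪θ r, g r⟫) := by
  let S : Set (ℝ × ℝ) := {z | z.2 ≤ z.1}
  have hS : MeasurableSet S := measurableSet_le measurable_snd measurable_fst
  have hi := (integrable_inner_prod hω hg).indicator hS
  have hswap := integral_integral_swap (f := fun s r => S.indicator (fun z => ⟪ω z.1, g z.2⟫) (s, r)) hi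
  have e1 : ∫ s in Ioc 0 t, ∫ r in Ioc 0 s, ⟪ω s, g r⟫
      = ∫ s in Ioc 0 t, ∫ r in Ioc 0 t, S.indicator (fun z => ⟪ω z.1, g z.2⟫) (s, r) := by
    refine setIntegral_congr_fun measurableSet_Ioc fun s hs => ?_
    exact (integral_indicator_triangle (fun z => ⟪ω z.1, g z.2⟫) hs.2).symm
  rw [e1, hswap]
  refine setIntegral_congr_fun measurableSet_Ioc fun r hr => ?_
  have h1 : ∫ s in Ioc 0 t, S.indicator (fun z => ⟪ω z.1, g z.2⟫) (s, r)
      = ∫ s in Icc r t, S.indicator (fun z => ⟪ω z.1, g z.2⟫) (s, r) :=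
    setIntegral_eq_of_subset_of_forall_sdiff_eq_zero measurableSet_Ioc
      (fun s hs => ⟨hr.1.trans_le hs.1, hs.2⟩) fun s hs =>
        indicator_of_notMem (s := S) (fun h : r ≤ s => hs.2 ⟨h, hs.1.2⟩) _
  have h2 : ∫ s in Icc r t, S.indicator (fun z => ⟪ω z.1, g z.2⟫) (s, r)
      = ∫ s in Icc r t, ⟪ω s, g r⟫ :=
    setIntegral_congr_fun measurableSet_Icc fun s hs =>
      indicator_of_mem (show (s, r) ∈ S from hs.1) _
  rw [h1, h2, integral_Icc_eq_integral_Ioc, ← intervalIntegral.integral_of_le hr.2]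
  have hc : Continuous fun s => ⟪ω s, g r⟫ := hω.inner continuous_const
  exact intervalIntegral.integral_eq_sub_of_hasDerivAt (fun s _ => hd (g r) s)
    (hc.intervalIntegrable _ _)

/-- The weak equation holds for test vectors frozen in time, whereas Duhamel's formula tests with a
moving one. The product rule is replaced by integrating in `s` the equation tested with `χ s`, the
derivative of `ψ`: after Fubini on the triangle the terms `⟪χ s, u s⟫` cancel, and no
differentiability of `u` is used. -/
theorem duhamel_of_weak [SecondCountableTopology H] {ψ χ ω u f : ℝ → H} {t : ℝ} (ht : 0 ≤ t)
    (hψ : Continuous ψ) (hχ : Continuous χ) (hω : Continuous ω)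
    (hdψ : ∀ y s, HasDerivAt (fun s => ⟪ψ s, y⟫) ⟪χ s, y⟫ s)
    (hdχ : ∀ y s, HasDerivAt (fun s => ⟪χ s, y⟫) ⟪ω s, y⟫ s)
    (hu : IntegrableOn u (Ioc 0 t)) (hf : IntegrableOn f (Ioc 0 t))
    (wψ : ⟪ψ t, u t⟫ = ⟪ψ t, u 0⟫ + ∫ r in Ioc 0 t, (-⟪χ t, u r⟫ + ⟪ψ t, f r⟫))
    (wχ : ∀ s ∈ Ioc 0 t, ⟪χ s, u s⟫ = ⟪χ s, u 0⟫ + ∫ r in Ioc 0 s, (-⟪ω s, u r⟫ + ⟪χ s, f r⟫)) :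
    ⟪ψ t, u t⟫ = ⟪ψ 0, u 0⟫ + ∫ s in Ioc 0 t, ⟪ψ s, f s⟫ := by
  have hconst : ∀ (y : H) (g : ℝ → H) (s : ℝ), IntegrableOn g (Ioc 0 s) →
      IntegrableOn (fun r => ⟪y, g r⟫) (Ioc 0 s) := fun y g s hg => hg.const_inner y
  have hadd : ∀ (y z : H) (s : ℝ), s ≤ t → ∫ r in Ioc 0 s, (-⟪y, u r⟫ + ⟪z, f r⟫)
      = -(∫ r in Ioc 0 s, ⟪y, u r⟫) + ∫ r in Ioc 0 s, ⟪z, f r⟫ := by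
    intro y z s hs
    have hsub : Ioc 0 s ⊆ Ioc 0 t := Ioc_subset_Ioc_right hs
    have hn : IntegrableOn (fun r => -⟪y, u r⟫) (Ioc 0 s) := (hconst y u s (hu.mono_set hsub)).neg
    rw [integral_add hn (hconst z f s (hf.mono_set hsub)), integral_neg]
  have h1 : ∫ s in Ioc 0 t, ⟪χ s, u 0⟫ = ⟪ψ t, u 0⟫ - ⟪ψ 0, u 0⟫ := by
    rw [← intervalIntegral.integral_of_le ht]
    have hc : Continuous fun s => ⟪χ s, u 0⟫ := hχ.inner continuous_const
    exact intervalIntegral.integral_eq_sub_of_hasDerivAt (fun s _ => hdψ (u 0) s)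
      (hc.intervalIntegrable _ _)
  have t1 := integral_triangle hω hdχ hu
  have t2 := integral_triangle hχ hdψ hf
  have hi1 : IntegrableOn (fun s => ∫ r in Ioc 0 s, ⟪ω s, u r⟫) (Ioc 0 t) := by
    let S : Set (ℝ × ℝ) := {z | z.2 ≤ z.1}
    have hS : MeasurableSet S := measurableSet_le measurable_snd measurable_fst
    have := ((integrable_inner_prod hω hu).indicator hS).integral_prod_left
    refine IntegrableOn.congr_fun this (fun s hs => ?_) measurableSet_Ioc
    exact integral_indicator_triangle (fun z => ⟪ω z.1, u z.2⟫) hs.2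
  have hc1 : IntegrableOn (fun s => ⟪χ s, u 0⟫) (Ioc 0 t) :=
    ((hχ.inner continuous_const).intervalIntegrable 0 t).1
  have hχu := integrableOn_inner hχ hu
  have hψf := integrableOn_inner hψ hf
  have e : ∀ s ∈ Ioc 0 t, ∫ r in Ioc 0 s, ⟪χ s, f r⟫
      = ⟪χ s, u s⟫ - ⟪χ s, u 0⟫ + ∫ r in Ioc 0 s, ⟪ω s, u r⟫ := by
    intro s hs
    rw [wχ s hs, hadd _ _ s hs.2]
    ring
  have hsub : IntegrableOn (fun s => ⟪χ s, u s⟫ - ⟪χ s, u 0⟫) (Ioc 0 t) := hχu.sub hc1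
  rw [setIntegral_congr_fun measurableSet_Ioc e, integral_add hsub hi1, integral_sub hχu hc1, h1, t1, integral_sub (hconst _ _ _ hu) hχu,
    integral_sub (hconst _ _ _ hf) hψf] at t2
  rw [hadd _ _ t le_rfl] at wψ
  linear_combination wψ - t2

end Duhamel

/-! ### The group on `L²` -/

theorem grpSymbol_mul (α s t : ℝ) (ζ : Plane) :
    grpSymbol α s ζ * grpSymbol α t ζ = grpSymbol α (s + t) ζ := by
  rw [grpSymbol, grpSymbol, grpSymbol, ← Complex.exp_add]; congr 1; push_cast; ring

theorem norm_grp_le (α t : ℝ) (a : L2) : ‖grp α t a‖ ≤ ‖a‖ := by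
  simpa [grp] using norm_mulL2_le (isMult_grpSymbol α t) a

theorem grp_grp (α s t : ℝ) (a : L2) : grp α s (grp α t a) = grp α (s + t) a := by
  rw [grp, grp, grp, mulL2_mulL2 (isMult_grpSymbol α s) (isMult_grpSymbol α t)]
  simp_rw [grpSymbol_mul]

theorem grp_zero (α : ℝ) (a : L2) : grp α 0 a = a := by
  apply Lp.ext
  filter_upwards [coeFn_mulL2 (isMult_grpSymbol α 0) a] with ζ h
  rw [grp, h, grpSymbol]; simp

theorem inner_mulL2_eq {k : Plane → ℂ} {C : ℝ} (hk : IsMult k C) (a b : L2) :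
    ⟪mulL2 k a, b⟫ = ∫ ζ, starRingEnd ℂ (k ζ) * (starRingEnd ℂ (a ζ) * b ζ) := by
  rw [inner_L2]
  apply integral_congr_ae
  filter_upwards [coeFn_mulL2 hk a] with ζ h1
  rw [h1, map_mul]; ring

theorem integrable_conj_mul (a b : L2) : Integrable (fun ζ => starRingEnd ℂ (a ζ) * b ζ) := by
  have := L2.integrable_inner (𝕜 := ℂ) a b
  refine this.congr (Filter.Eventually.of_forall fun ζ => ?_)
  simp only; rw [RCLike.inner_apply, mul_comm]

theorem tendsto_inner_mulL2 {ι : Type*} {l : Filter ι} [l.IsCountablyGenerated]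
    {k : ι → Plane → ℂ} {k₀ : Plane → ℂ} {C : ℝ} (hk : ∀ i, IsMult (k i) C) (hk₀ : IsMult k₀ C)
    (h : ∀ᵐ ζ, Filter.Tendsto (fun i => k i ζ) l (nhds (k₀ ζ))) (a b : L2) :
    Filter.Tendsto (fun i => ⟪mulL2 (k i) a, b⟫) l (nhds ⟪mulL2 k₀ a, b⟫) := by
  simp_rw [inner_mulL2_eq hk₀, fun i => inner_mulL2_eq (hk i) a b]
  refine tendsto_integral_filter_of_dominated_convergence
    (fun ζ => C * ‖starRingEnd ℂ (a ζ) * b ζ‖) (Filter.Eventually.of_forall fun i => ?_)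
    (Filter.Eventually.of_forall fun i => Filter.Eventually.of_forall fun ζ => ?_)
    ((integrable_conj_mul a b).norm.const_mul C) ?_
  · exact (hk i).conj.meas.aestronglyMeasurable.mul (integrable_conj_mul a b).1
  · rw [norm_mul, RCLike.norm_conj]
    exact mul_le_mul_of_nonneg_right ((hk i).bound ζ) (norm_nonneg _)
  · filter_upwards [h] with ζ hζ
    exact ((RCLike.continuous_conj.tendsto _).comp hζ).mul_const _

theorem continuous_inner_grp (α : ℝ) (a b : L2) : Continuous fun t => ⟪grp α t a, b⟫ := by
  rw [continuous_iff_continuousAt]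
  intro t
  refine tendsto_inner_mulL2 (isMult_grpSymbol α) (isMult_grpSymbol α t)
    (Filter.Eventually.of_forall fun ζ => ?_) a b
  have : Continuous fun t => grpSymbol α t ζ := by unfold grpSymbol; fun_prop
  exact this.tendsto t

theorem norm_grp (α t : ℝ) (a : L2) : ‖grp α t a‖ = ‖a‖ := by
  refine le_antisymm (norm_grp_le α t a) ?_
  have := norm_grp_le α (-t) (grp α t a)
  rwa [grp_grp, neg_add_cancel, grp_zero] at this

/-- Weak continuity together with constancy of the norm gives strong continuity. -/
theorem continuous_grp (α : ℝ) (a : L2) : Continuous fun t => grp α t a := by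
  rw [continuous_iff_continuousAt]
  intro s
  rw [ContinuousAt, tendsto_iff_norm_sub_tendsto_zero]
  have h1 : ∀ t, ‖grp α t a - grp α s a‖ ^ 2
      = 2 * ‖a‖ ^ 2 - 2 * (⟪grp α t a, grp α s a⟫).re := fun t => by
    rw [norm_sub_sq (𝕜 := ℂ), norm_grp, norm_grp]; simp; ring
  have h2 : Filter.Tendsto (fun t => ‖grp α t a - grp α s a‖ ^ 2) (nhds s) (nhds 0) := by
    simp_rw [h1]
    have hc : Continuous fun t => 2 * ‖a‖ ^ 2 - 2 * (⟪grp α t a, grp α s a⟫).re :=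
      continuous_const.sub
        (continuous_const.mul (Complex.continuous_re.comp (continuous_inner_grp α a _)))
    have := hc.tendsto s
    have h0 : 2 * ‖a‖ ^ 2 - 2 * (⟪grp α s a, grp α s a⟫).re = 0 := by
      rw [inner_self_eq_norm_sq_to_K, norm_grp]
      simp [← Complex.ofReal_pow]
    rwa [h0] at this
  have h3 := h2.sqrt
  simpa [Real.sqrt_sq (norm_nonneg _)] using h3

/-- A set of frequencies, away from `ξ = 0`, on which all symbols are bounded. -/
def lowSet (α : ℝ) (n : ℕ) : Set Plane :=
  {ζ | (1 : ℝ) ≤ n * |freqX ζ| ∧ |freqX ζ| ≤ n ∧ |freqY ζ| ≤ n ∧ |phase α ζ| ≤ n}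

theorem measurableSet_lowSet (α : ℝ) (n : ℕ) : MeasurableSet (lowSet α n) := by
  have h1 := measurable_freqX
  have h2 := measurable_freqY
  have h3 := measurable_phase α
  have e : lowSet α n = {ζ | (1 : ℝ) ≤ n * |freqX ζ|} ∩ ({ζ | |freqX ζ| ≤ n} ∩
      ({ζ | |freqY ζ| ≤ n} ∩ {ζ | |phase α ζ| ≤ n})) := rfl
  rw [e]
  refine (measurableSet_le measurable_const ?_).inter ((measurableSet_le ?_ measurable_const).inter
    ((measurableSet_le ?_ measurable_const).inter (measurableSet_le ?_ measurable_const)))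
  · exact h1.abs.const_mul _
  · exact h1.abs
  · exact h2.abs
  · exact h3.abs

/-- The characteristic function of `lowSet`. -/
def lowCut (α : ℝ) (n : ℕ) : Plane → ℂ := (lowSet α n).indicator fun _ => 1

theorem isMult_lowCut (α : ℝ) (n : ℕ) : IsMult (lowCut α n) 1 :=
  ⟨measurable_const.indicator (measurableSet_lowSet α n), fun ζ => by
    rw [lowCut]
    exact (norm_indicator_le_norm_self _ _).trans (by simp)⟩

theorem freqX_ne_zero_ae : ∀ᵐ ζ : Plane, freqX ζ ≠ 0 := by
  have h : ∀ᵐ z : ℝ × ℝ, z.1 ≠ 0 := by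
    have := Measure.quasiMeasurePreserving_fst (μ := (volume : Measure ℝ))
      (ν := (volume : Measure ℝ))
    exact this.ae (Measure.ae_ne volume 0)
  have h2 := measurePreserving_planeEquiv.quasiMeasurePreserving.ae h
  filter_upwards [h2] with ζ hζ
  have h0 : ζ 0 ≠ 0 := hζ
  rw [freqX]
  exact mul_ne_zero (by positivity) h0

theorem tendsto_lowCut (α : ℝ) :
    ∀ᵐ ζ : Plane, Filter.Tendsto (fun n => lowCut α n ζ) Filter.atTop (nhds 1) := by
  filter_upwards [freqX_ne_zero_ae] with ζ hζ
  have h0 : 0 < |freqX ζ| := abs_pos.2 hζ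
  obtain ⟨N, hN⟩ := exists_nat_ge (max (1 / |freqX ζ|)
    (max |freqX ζ| (max |freqY ζ| |phase α ζ|)))
  refine tendsto_const_nhds.congr' ?_
  filter_upwards [Filter.eventually_ge_atTop N] with n hn
  have hn' : max (1 / |freqX ζ|) (max |freqX ζ| (max |freqY ζ| |phase α ζ|)) ≤ (n : ℝ) :=
    hN.trans (by exact_mod_cast hn)
  simp only [max_le_iff] at hn'
  have : ζ ∈ lowSet α n := ⟨by
    have := hn'.1
    rwa [div_le_iff₀ h0] at this, hn'.2.1, hn'.2.2.1, hn'.2.2.2⟩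
  rw [lowCut, indicator_of_mem this]

theorem measurable_linSymbol (α : ℝ) : Measurable (linSymbol α) := by
  have e : linSymbol α = fun ζ => -(Complex.I * phase α ζ) := funext (linSymbol_eq α)
  have := measurable_phase α
  rw [e]; fun_prop

section lowSupport

variable {α C : ℝ} {n : ℕ} {k : Plane → ℂ}

theorem isMult_linSymbol_mul (hk : IsMult k C) (hs : ∀ ζ ∉ lowSet α n, k ζ = 0) :
    IsMult (fun ζ => linSymbol α ζ * k ζ) (n * C) := by
  refine ⟨(measurable_linSymbol α).mul hk.meas, fun ζ => ?_⟩
  by_cases h : ζ ∈ lowSet α n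
  · have h1 : ‖linSymbol α ζ‖ = |phase α ζ| := by rw [linSymbol_eq]; simp
    rw [norm_mul, h1]
    exact mul_le_mul h.2.2.2 (hk.bound ζ) (norm_nonneg _) (Nat.cast_nonneg n)
  · rw [hs ζ h]; simp only [mul_zero, norm_zero]
    exact mul_nonneg (Nat.cast_nonneg n) hk.nonneg

/-- On the support `|ξ|`, `|η|` and `|ξ|⁻¹` are at most `n`, so the weight of `X³`, including its
singular part `|ξ|⁻²`, is bounded. -/
theorem memX3_of_lowSupport (hk : IsMult k C) (hs : ∀ ζ ∉ lowSet α n, k ζ = 0) (b : L2) :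
    MemX3 (𝓕⁻ (mulL2 k b) : L2) := by
  set N : ℝ := (n : ℝ) with hN
  have hN0 : 0 ≤ N := Nat.cast_nonneg n
  set D : ℝ := (1 + N ^ 2) * ((1 + N ^ 2) ^ 3 + (1 + N ^ 2) ^ 3) with hD
  have hD0 : 0 ≤ D := by positivity
  have hF : (𝓕 (𝓕⁻ (mulL2 k b) : L2) : L2) = mulL2 k b :=
    FourierTransform.fourier_fourierInv_eq (mulL2 k b)
  rw [MemX3, hF]
  have hle : ∀ᵐ ζ : Plane, ENNReal.ofReal
      ((1 + (freqX ζ ^ 2)⁻¹) * ((1 + freqX ζ ^ 2) ^ 3 + (1 + freqY ζ ^ 2) ^ 3)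
        * ‖mulL2 k b ζ‖ ^ 2) ≤ ENNReal.ofReal (D * ‖mulL2 k b ζ‖ ^ 2) := by
    filter_upwards [coeFn_mulL2 hk b] with ζ hζ
    by_cases h : ζ ∈ lowSet α n
    · apply ENNReal.ofReal_le_ofReal
      refine mul_le_mul_of_nonneg_right ?_ (sq_nonneg _)
      have hx0 : 0 < |freqX ζ| := by
        by_contra hc
        have : |freqX ζ| = 0 := le_antisymm (not_lt.1 hc) (abs_nonneg _)
        have h1 := h.1
        rw [this] at h1; norm_num at h1
      have hx : freqX ζ ^ 2 ≤ N ^ 2 := by rw [← sq_abs]; gcongr; exact h.2.1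
      have hy : freqY ζ ^ 2 ≤ N ^ 2 := by rw [← sq_abs]; gcongr; exact h.2.2.1
      have hi : (freqX ζ ^ 2)⁻¹ ≤ N ^ 2 := by
        rw [← sq_abs, ← inv_pow]
        gcongr
        rw [inv_le_iff_one_le_mul₀ hx0]
        exact h.1
      rw [hD]
      gcongr
    · rw [hζ, hs ζ h]; simp
  refine (lintegral_mono_ae hle).trans_lt ?_
  have hint : Integrable (fun ζ => D * ‖mulL2 k b ζ‖ ^ 2) :=
    ((Lp.memLp (mulL2 k b)).integrable_norm_pow (by norm_num)).const_mul D
  rw [← ofReal_integral_eq_lintegral_ofReal hint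
    (Filter.Eventually.of_forall fun ζ => by positivity)]
  exact ENNReal.ofReal_lt_top

theorem weak_fourier {T : ℝ} {w F : ℝ → L2} (h : IsSolution α T w F) (hk : IsMult k C)
    (hs : ∀ ζ ∉ lowSet α n, k ζ = 0) (b : L2) {t : ℝ} (ht : t ∈ Icc 0 T) :
    ⟪mulL2 k b, (𝓕 (w t) : L2)⟫ = ⟪mulL2 k b, (𝓕 (w 0) : L2)⟫ + ∫ s in Ioc 0 t,
      (-⟪mulL2 (fun ζ => linSymbol α ζ * k ζ) b, (𝓕 (w s) : L2)⟫
        + ⟪mulL2 k b, (𝓕 (F s) : L2)⟫) := by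
  have hF : ∀ a : L2, (𝓕 (𝓕⁻ a : L2) : L2) = a := fun a =>
    FourierTransform.fourier_fourierInv_eq a
  have hin : ∀ a y : L2, ⟪(𝓕⁻ a : L2), y⟫ = ⟪a, (𝓕 y : L2)⟫ := fun a y => by
    rw [← Lp.inner_fourier_eq, hF]
  have hl := isMult_linSymbol_mul hk hs
  have := h.equation (𝓕⁻ (mulL2 k b)) (𝓕⁻ (mulL2 (fun ζ => linSymbol α ζ * k ζ) b))
    (memX3_of_lowSupport hk hs b) (by
      rw [hF, hF]
      filter_upwards [coeFn_mulL2 hk b, coeFn_mulL2 hl b] with ζ h1 h2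
      rw [h1, h2, mul_assoc]) t ht
  simp_rw [hin] at this
  rw [this, intervalIntegral.integral_of_le ht.1]

theorem hasDerivAt_inner_mulL2 (hk : IsMult k C) (hs : ∀ ζ ∉ lowSet α n, k ζ = 0) (t₀ : ℝ)
    (b y : L2) (s : ℝ) :
    HasDerivAt (fun s => ⟪mulL2 (fun ζ => grpSymbol α (s - t₀) ζ * k ζ) b, y⟫)
      ⟪mulL2 (fun ζ => linSymbol α ζ * (grpSymbol α (s - t₀) ζ * k ζ)) b, y⟫ s := by
  have hg : ∀ s, IsMult (fun ζ => grpSymbol α (s - t₀) ζ * k ζ) (1 * C) := fun s =>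
    (isMult_grpSymbol α (s - t₀)).mul hk
  have hgs : ∀ s, ∀ ζ ∉ lowSet α n, grpSymbol α (s - t₀) ζ * k ζ = 0 := fun s ζ hζ => by
    rw [hs ζ hζ, mul_zero]
  have hl : ∀ s, IsMult (fun ζ => linSymbol α ζ * (grpSymbol α (s - t₀) ζ * k ζ)) (n * (1 * C)) :=
    fun s => isMult_linSymbol_mul (hg s) (hgs s)
  simp_rw [fun s => inner_mulL2_eq (hg s) b y, inner_mulL2_eq (hl s) b y]
  have hby := integrable_conj_mul b y
  refine (hasDerivAt_integral_of_dominated_loc_of_deriv_le (s := univ)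
    (F := fun s ζ => starRingEnd ℂ (grpSymbol α (s - t₀) ζ * k ζ) * (starRingEnd ℂ (b ζ) * y ζ))
    (F' := fun s ζ => starRingEnd ℂ (linSymbol α ζ * (grpSymbol α (s - t₀) ζ * k ζ)) *
      (starRingEnd ℂ (b ζ) * y ζ))
    (bound := fun ζ => n * (1 * C) * ‖starRingEnd ℂ (b ζ) * y ζ‖) Filter.univ_mem
    (Filter.Eventually.of_forall fun s => (hg s).conj.meas.aestronglyMeasurable.mul hby.1) ?_
    ((hl s).conj.meas.aestronglyMeasurable.mul hby.1)
    (Filter.Eventually.of_forall fun ζ s _ => ?_) (hby.norm.const_mul _)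
    (Filter.Eventually.of_forall fun ζ s _ => ?_)).2
  · exact hby.bdd_mul (hg s).conj.meas.aestronglyMeasurable
      (Filter.Eventually.of_forall (hg s).conj.bound)
  · rw [norm_mul]
    exact mul_le_mul_of_nonneg_right ((hl s).conj.bound ζ) (norm_nonneg _)
  · refine HasDerivAt.mul_const ?_ _
    have h1 : HasDerivAt (fun s : ℝ => grpSymbol α (s - t₀) ζ)
        (grpSymbol α (s - t₀) ζ * linSymbol α ζ) s := by
      have h2 : HasDerivAt (fun s : ℝ => -((s - t₀) * phase α ζ)) (-(1 * phase α ζ)) s :=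
        (((hasDerivAt_id s).sub_const t₀).mul_const _).neg
      have h3 := (h2.ofReal_comp.mul_const Complex.I).cexp
      refine h3.congr_deriv ?_
      rw [linSymbol_eq, grpSymbol]; push_cast; ring
    have h4 := (h1.mul_const (k ζ)).star
    refine h4.congr_deriv ?_
    change starRingEnd ℂ _ = _
    congr 1; ring

theorem mulL2_grpSymbol_mul (hk : IsMult k C) (t : ℝ) (b : L2) :
    mulL2 (fun ζ => grpSymbol α t ζ * k ζ) b = grp α t (mulL2 k b) := by
  rw [grp, mulL2_mulL2 (isMult_grpSymbol α t) hk]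

theorem continuous_mulL2_grpSymbol (hk : IsMult k C) (t₀ : ℝ) (b : L2) :
    Continuous fun s => mulL2 (fun ζ => grpSymbol α (s - t₀) ζ * k ζ) b := by
  simp_rw [mulL2_grpSymbol_mul hk]
  exact (continuous_grp α (mulL2 k b)).comp (continuous_id.sub continuous_const)

end lowSupport

theorem integrableOn_fourier {f : ℝ → L2} {s : Set ℝ} (hf : IntegrableOn f s) :
    IntegrableOn (fun t => (𝓕 (f t) : L2)) s :=
  (Lp.fourierTransformₗᵢ Plane ℂ).toContinuousLinearEquiv.toContinuousLinearMap.integrable_comp hf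

theorem continuousOn_fourier {f : ℝ → L2} {s : Set ℝ} (hf : ContinuousOn f s) :
    ContinuousOn (fun t => (𝓕 (f t) : L2)) s :=
  (Lp.fourierTransformₗᵢ Plane ℂ).continuous.comp_continuousOn hf

instance : SecondCountableTopology L2 :=
  haveI : Fact ((2 : ℝ≥0∞) ≠ ∞) := ⟨ENNReal.ofNat_ne_top⟩
  Lp.SecondCountableTopology

/-! ### Duhamel's formula for weak solutions -/

theorem duhamel_lowCut {α T : ℝ} {w F : ℝ → L2} (h : IsSolution α T w F) (n : ℕ) (b : L2)
    (t₀ : ℝ) {t : ℝ} (ht : t ∈ Icc 0 T) :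
    ⟪grp α (t - t₀) (mulL2 (lowCut α n) b), (𝓕 (w t) : L2)⟫
      = ⟪grp α (0 - t₀) (mulL2 (lowCut α n) b), (𝓕 (w 0) : L2)⟫
      + ∫ s in Ioc 0 t, ⟪grp α (s - t₀) (mulL2 (lowCut α n) b), (𝓕 (F s) : L2)⟫ := by
  have hk := isMult_lowCut α n
  have hks : ∀ ζ ∉ lowSet α n, lowCut α n ζ = 0 := fun ζ hζ => indicator_of_notMem hζ _
  have hl := isMult_linSymbol_mul hk hks
  have hls : ∀ ζ ∉ lowSet α n, linSymbol α ζ * lowCut α n ζ = 0 := fun ζ hζ => by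
    rw [hks ζ hζ, mul_zero]
  have hl2 := isMult_linSymbol_mul hl hls
  have hcomm : ∀ (k : Plane → ℂ) (s : ℝ), (fun ζ => linSymbol α ζ * (grpSymbol α s ζ * k ζ))
      = fun ζ => grpSymbol α s ζ * (linSymbol α ζ * k ζ) := fun k s => by
    ext ζ; ring
  have hg : ∀ (k : Plane → ℂ) (C : ℝ) (s : ℝ), IsMult k C →
      IsMult (fun ζ => grpSymbol α s ζ * k ζ) (1 * C) := fun k C s hk =>
    (isMult_grpSymbol α s).mul hk
  have hgs : ∀ (k : Plane → ℂ) (s : ℝ), (∀ ζ ∉ lowSet α n, k ζ = 0) →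
      ∀ ζ ∉ lowSet α n, grpSymbol α s ζ * k ζ = 0 := fun k s hk ζ hζ => by
    rw [hk ζ hζ, mul_zero]
  have hsub : Ioc 0 t ⊆ Icc 0 T := fun s hs => ⟨hs.1.le, hs.2.trans ht.2⟩
  have hu : IntegrableOn (fun s => (𝓕 (w s) : L2)) (Ioc 0 t) :=
    ((continuousOn_fourier h.continuousOn).integrableOn_Icc).mono_set hsub
  have hf : IntegrableOn (fun s => (𝓕 (F s) : L2)) (Ioc 0 t) :=
    (integrableOn_fourier h.integrableOn).mono_set hsub
  simp_rw [← mulL2_grpSymbol_mul hk]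
  -- The test vector moves by the group, and its two time derivatives insert one and two factors of
  -- the symbol, which the frequency cutoff keeps bounded.
  refine duhamel_of_weak (ψ := fun s => mulL2 (fun ζ => grpSymbol α (s - t₀) ζ * lowCut α n ζ) b)
    (u := fun s => (𝓕 (w s) : L2)) (f := fun s => (𝓕 (F s) : L2))
    (χ := fun s => mulL2 (fun ζ => grpSymbol α (s - t₀) ζ * (linSymbol α ζ * lowCut α n ζ)) b)
    (ω := fun s => mulL2 (fun ζ => grpSymbol α (s - t₀) ζ *
      (linSymbol α ζ * (linSymbol α ζ * lowCut α n ζ))) b)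
    ht.1 (continuous_mulL2_grpSymbol hk t₀ b) (continuous_mulL2_grpSymbol hl t₀ b)
    (continuous_mulL2_grpSymbol hl2 t₀ b) (fun y s => ?_) (fun y s => ?_) hu hf ?_ (fun s hs => ?_)
  · have := hasDerivAt_inner_mulL2 hk hks t₀ b y s
    rwa [hcomm] at this
  · have := hasDerivAt_inner_mulL2 hl hls t₀ b y s
    rwa [hcomm] at this
  · have := weak_fourier h (hg _ _ (t - t₀) hk) (hgs _ (t - t₀) hks) b ht
    rwa [hcomm] at this
  · have := weak_fourier h (hg _ _ (s - t₀) hl) (hgs _ (s - t₀) hls) b (hsub hs)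
    rwa [hcomm] at this

theorem grp_mulL2 {k : Plane → ℂ} {C : ℝ} (hk : IsMult k C) (α t : ℝ) (b : L2) :
    grp α t (mulL2 k b) = mulL2 k (grp α t b) := by
  rw [grp, grp, mulL2_mulL2 (isMult_grpSymbol α t) hk, mulL2_mulL2 hk (isMult_grpSymbol α t)]
  simp_rw [mul_comm]

/-- The frequency cutoff is removed by dominated convergence; it tends to `1` off the null set `ξ =
0`. -/
theorem duhamel_zero {α T : ℝ} {w F : ℝ → L2} (h : IsSolution α T w F) (b : L2)
    (t₀ : ℝ) {t : ℝ} (ht : t ∈ Icc 0 T) :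
    ⟪grp α (t - t₀) b, (𝓕 (w t) : L2)⟫ = ⟪grp α (0 - t₀) b, (𝓕 (w 0) : L2)⟫
      + ∫ s in Ioc 0 t, ⟪grp α (s - t₀) b, (𝓕 (F s) : L2)⟫ := by
  have hone : IsMult (fun _ : Plane => (1 : ℂ)) 1 := ⟨measurable_const, fun _ => by simp⟩
  have hmul1 : ∀ a : L2, mulL2 (fun _ : Plane => (1 : ℂ)) a = a := fun a => by
    apply Lp.ext
    filter_upwards [coeFn_mulL2 hone a] with ζ hζ
    rw [hζ, one_mul]
  have hlim : ∀ a y : L2, Filter.Tendsto (fun n => ⟪mulL2 (lowCut α n) a, y⟫) Filter.atTop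
      (nhds ⟪a, y⟫) := fun a y => by
    have := tendsto_inner_mulL2 (isMult_lowCut α) hone (tendsto_lowCut α) a y
    rwa [hmul1] at this
  have hD : ∀ n, _ := fun n => duhamel_lowCut h n b t₀ ht
  simp_rw [fun n => grp_mulL2 (isMult_lowCut α n)] at hD
  have hsub : Ioc 0 t ⊆ Icc 0 T := fun s hs => ⟨hs.1.le, hs.2.trans ht.2⟩
  have hf : IntegrableOn (fun s => (𝓕 (F s) : L2)) (Ioc 0 t) :=
    (integrableOn_fourier h.integrableOn).mono_set hsub
  have hint : Filter.Tendsto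
      (fun n => ∫ s in Ioc 0 t, ⟪mulL2 (lowCut α n) (grp α (s - t₀) b), (𝓕 (F s) : L2)⟫)
      Filter.atTop (nhds (∫ s in Ioc 0 t, ⟪grp α (s - t₀) b, (𝓕 (F s) : L2)⟫)) := by
    refine tendsto_integral_of_dominated_convergence (fun s => ‖b‖ * ‖(𝓕 (F s) : L2)‖)
      (fun n => ?_) (hf.norm.const_mul _) (fun n => Filter.Eventually.of_forall fun s => ?_)
      (Filter.Eventually.of_forall fun s => hlim _ _)
    · have hc : Continuous fun s => mulL2 (lowCut α n) (grp α (s - t₀) b) :=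
        (continuous_mulL2 (isMult_lowCut α n)).comp
          ((continuous_grp α b).comp (continuous_id.sub continuous_const))
      exact hc.aestronglyMeasurable.inner hf.aestronglyMeasurable
    · refine (norm_inner_le_norm _ _).trans (mul_le_mul_of_nonneg_right ?_ (norm_nonneg _))
      refine (norm_mulL2_le (isMult_lowCut α n) _).trans ?_
      rw [one_mul, norm_grp]
  exact tendsto_nhds_unique ((hlim _ _).congr hD) ((hlim _ _).add hint)

theorem duhamel {α T : ℝ} {w F : ℝ → L2} (h : IsSolution α T w F) (b : L2) {p t : ℝ}
    (hp : 0 ≤ p) (hpt : p ≤ t) (ht : t ≤ T) :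
    ⟪b, (𝓕 (w t) : L2)⟫ = ⟪grp α (p - t) b, (𝓕 (w p) : L2)⟫
      + ∫ s in Ioc p t, ⟪grp α (s - t) b, (𝓕 (F s) : L2)⟫ := by
  -- Both formulas are based at the final time `t`, so their difference leaves exactly the integral
  -- over `(p, t]`.
  have h1 := duhamel_zero h b t (t := t) ⟨hp.trans hpt, ht⟩
  have h2 := duhamel_zero h b t (t := p) ⟨hp, hpt.trans ht⟩
  have hsub : Ioc 0 t ⊆ Icc 0 T := fun s hs => ⟨hs.1.le, hs.2.trans ht⟩
  have hf : IntegrableOn (fun s => (𝓕 (F s) : L2)) (Ioc 0 t) :=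
    (integrableOn_fourier h.integrableOn).mono_set hsub
  have hc : Continuous fun s => grp α (s - t) b :=
    (continuous_grp α b).comp (continuous_id.sub continuous_const)
  have hi := integrableOn_inner hc hf
  have hu : Ioc 0 t = Ioc 0 p ∪ Ioc p t := (Ioc_union_Ioc_eq_Ioc hp hpt).symm
  rw [hu, setIntegral_union (Ioc_disjoint_Ioc_of_le le_rfl) measurableSet_Ioc
    (hi.mono_set (Ioc_subset_Ioc_right hpt)) (hi.mono_set (Ioc_subset_Ioc_left hp))] at h1
  rw [sub_self, grp_zero] at h1
  linear_combination h1 - h2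

/-! ### The `L^∞` norm by duality -/

/-- The elements of `L²` with `L¹` norm at most `1`. -/
def unitL1 : Set L2 := {g | eLpNorm g 1 volume ≤ 1}

theorem zero_mem_unitL1 : (0 : L2) ∈ unitL1 := by
  change eLpNorm (0 : L2) 1 volume ≤ 1
  rw [eLpNorm_congr_ae (Lp.coeFn_zero ℂ 2 volume), eLpNorm_zero]; exact zero_le_one

instance : Nonempty unitL1 := ⟨⟨0, zero_mem_unitL1⟩⟩

/-- A sequence that is dense, in the topology of `L²`, in `unitL1`. -/
def testSeq (n : ℕ) : L2 := TopologicalSpace.denseSeq unitL1 n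

theorem testSeq_mem (n : ℕ) : eLpNorm (testSeq n) 1 volume ≤ 1 :=
  (TopologicalSpace.denseSeq unitL1 n).2

/-- The norm of `h` as a functional on `L¹`. -/
def dualNorm (h : L2) : ℝ≥0∞ := ⨆ n, ‖⟪testSeq n, h⟫‖ₑ

theorem enorm_inner_le_dualNorm {g : L2} (hg : g ∈ unitL1) (h : L2) : ‖⟪g, h⟫‖ₑ ≤ dualNorm h := by
  have hc : Continuous fun x : unitL1 => ‖⟪(x : L2), h⟫‖ₑ :=
    (continuous_subtype_val.inner continuous_const).enorm
  have hcl : IsClosed {x : unitL1 | ‖⟪(x : L2), h⟫‖ₑ ≤ dualNorm h} :=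
    isClosed_le hc continuous_const
  have hd := TopologicalSpace.denseRange_denseSeq unitL1
  have : ∀ x : unitL1, ‖⟪(x : L2), h⟫‖ₑ ≤ dualNorm h := fun x =>
    hd.induction_on (p := fun x : unitL1 => ‖⟪(x : L2), h⟫‖ₑ ≤ dualNorm h) x hcl
      fun n => le_iSup (fun n => ‖⟪testSeq n, h⟫‖ₑ) n
  exact this ⟨g, hg⟩

theorem norm_inner_le_mul_dualNorm {g h : L2} {c : ℝ} (hc : 0 < c)
    (hg : eLpNorm g 1 volume ≤ ENNReal.ofReal c) (hM : dualNorm h ≠ ∞) :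
    ‖⟪g, h⟫‖ ≤ c * (dualNorm h).toReal := by
  have hmem : ((c⁻¹ : ℝ) : ℂ) • g ∈ unitL1 := by
    change eLpNorm (((c⁻¹ : ℝ) : ℂ) • g : L2) 1 volume ≤ 1
    rw [eLpNorm_congr_ae (Lp.coeFn_smul _ g), eLpNorm_const_smul, ← ofReal_norm,
      Complex.norm_real, Real.norm_of_nonneg (inv_nonneg.2 hc.le)]
    calc ENNReal.ofReal c⁻¹ * eLpNorm g 1 volume
        ≤ ENNReal.ofReal c⁻¹ * ENNReal.ofReal c := by gcongr
      _ = 1 := by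
        rw [← ENNReal.ofReal_mul (inv_nonneg.2 hc.le), inv_mul_cancel₀ hc.ne', ENNReal.ofReal_one]
  have h1 := enorm_inner_le_dualNorm hmem h
  rw [← ofReal_norm, ENNReal.ofReal_le_iff_le_toReal hM, inner_smul_left, norm_mul,
    Complex.conj_ofReal, Complex.norm_real, Real.norm_of_nonneg (inv_nonneg.2 hc.le),
    inv_mul_le_iff₀ hc] at h1
  exact h1

/-- Testing with the phase of `h` on a set of finite measure shows that `|h|` has average at most
`M` on every such set of positive measure. -/
theorem ae_norm_le_dualNorm {h : L2} (hM : dualNorm h ≠ ∞) :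
    ∀ᵐ x, ‖h x‖ ≤ (dualNorm h).toReal := by
  set M := (dualNorm h).toReal with hMdef
  have hint : ∀ s, MeasurableSet s → volume s < ∞ → IntegrableOn (fun x => ‖h x‖) s := by
    intro s _ hs
    have : IsFiniteMeasure (volume.restrict s) := ⟨by simpa using hs⟩
    exact ((Lp.memLp h).restrict s).integrable (by norm_num) |>.norm
  have hconst : ∀ s, volume s < ∞ → IntegrableOn (fun _ : Plane => M) s := fun s hs =>
    integrableOn_const hs.ne
  have key := ae_nonneg_of_forall_setIntegral_nonneg_of_sigmaFinite
    (μ := (volume : Measure Plane)) (f := fun x => M - ‖h x‖)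
    (fun s hs hfin => (hconst s hfin).sub (hint s hs hfin)) (fun s hs hfin => by
      rw [integral_sub (hconst s hfin) (hint s hs hfin), setIntegral_const, smul_eq_mul, sub_nonneg]
      have hr : volume.real s = (volume s).toReal := rfl
      rcases eq_or_ne (volume s) 0 with h0 | h0
      · have : volume.restrict s = 0 := Measure.restrict_eq_zero.2 h0
        rw [this, integral_zero_measure, hr, h0]; simp
      have hpos : 0 < (volume s).toReal := ENNReal.toReal_pos h0 hfin.ne
      have hθm : AEStronglyMeasurable (fun x => unitPhase (h x)) volume :=
        (measurable_unitPhase.comp_aemeasurable (Lp.memLp h).1.aemeasurable).aestronglyMeasurable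
      let g₀ : Plane → ℂ := s.indicator fun x => unitPhase (h x)
      have hg₀n : ∀ x, ‖g₀ x‖ ≤ ‖s.indicator (fun _ => (1 : ℝ)) x‖ := fun x => by
        by_cases hx : x ∈ s
        · simp only [g₀, indicator_of_mem hx]; simpa using norm_unitPhase_le (h x)
        · simp only [g₀, indicator_of_notMem hx]; simp
      have hg₀m : AEStronglyMeasurable g₀ volume := hθm.indicator hs
      have hg₀ : MemLp g₀ 2 volume :=
        (memLp_indicator_const 2 hs (1 : ℝ) (Or.inr hfin.ne)).mono hg₀m
          (Filter.Eventually.of_forall hg₀n)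
      have hg1 : eLpNorm (hg₀.toLp g₀ : L2) 1 volume ≤ ENNReal.ofReal (volume s).toReal := by
        rw [eLpNorm_congr_ae hg₀.coeFn_toLp, ENNReal.ofReal_toReal hfin.ne]
        refine (eLpNorm_mono hg₀n).trans ?_
        rw [eLpNorm_indicator_const hs (by norm_num) (by norm_num)]
        simp
      have := norm_inner_le_mul_dualNorm hpos hg1 hM
      have e : ⟪(hg₀.toLp g₀ : L2), h⟫ = ((∫ x in s, ‖h x‖ : ℝ) : ℂ) := by
        rw [inner_L2, ← integral_complex_ofReal, ← integral_indicator hs]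
        apply integral_congr_ae
        filter_upwards [hg₀.coeFn_toLp] with x hx
        rw [hx]
        by_cases hxs : x ∈ s
        · simp only [g₀, indicator_of_mem hxs]; exact conj_unitPhase_mul _
        · simp only [g₀, indicator_of_notMem hxs]; simp
      rw [e, Complex.norm_real, Real.norm_of_nonneg (integral_nonneg fun _ => norm_nonneg _)] at this
      exact this)
  filter_upwards [key] with x hx
  exact sub_nonneg.1 hx

theorem eLpNorm_top_le_dualNorm (h : L2) : eLpNorm h ∞ volume ≤ dualNorm h := by
  by_cases hM : dualNorm h = ∞
  · rw [hM]; exact le_top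
  · rw [eLpNorm_exponent_top, ← ENNReal.ofReal_toReal hM]
    exact eLpNormEssSup_le_of_ae_bound (ae_norm_le_dualNorm hM)

/-! ### The decomposition into frequency bands -/

/-- The sign of a band. -/
def bandSign (b : Bool) : ℝ := if b then 1 else -1

theorem abs_bandSign (b : Bool) : |bandSign b| = 1 := by
  cases b <;> simp [bandSign]

/-- The scale of a band. -/
def bandScale (j : ℤ) : ℝ := 2 ^ j

theorem bandScale_pos (j : ℤ) : 0 < bandScale j := by unfold bandScale; positivity

/-- The dyadic frequency bands. -/
def dyadicBand (i : ℤ × Bool) : Set Plane := band (bandSign i.2) (bandScale i.1)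

theorem pairwise_disjoint_dyadicBand : Pairwise (Function.onFun Disjoint dyadicBand) := by
  rintro ⟨j, b⟩ ⟨k, c⟩ hne
  refine disjoint_left.2 fun ζ h1 h2 => hne ?_
  have a1 := abs_freqX_of_mem_band (abs_bandSign b) (bandScale_pos j) h1
  have a2 := abs_freqX_of_mem_band (abs_bandSign c) (bandScale_pos k) h2
  have h1' : bandSign b * freqX ζ ∈ Ico (bandScale j) (2 * bandScale j) := h1
  have h2' : bandSign c * freqX ζ ∈ Ico (bandScale k) (2 * bandScale k) := h2
  have hpos := (bandScale_pos j).trans_le h1'.1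
  have hsign : b = c := by
    rw [a1] at a2
    cases b <;> cases c <;> simp [bandSign] at a2 hpos ⊢ <;> linarith
  rw [← a1] at h1'
  rw [← a2] at h2'
  have h2j : ∀ j : ℤ, 2 * bandScale j = (2 : ℝ) ^ (j + 1) := fun j => by
    rw [bandScale, zpow_add_one₀ (by norm_num), mul_comm]
  have l1 : (2 : ℝ) ^ j < 2 ^ (k + 1) := by rw [← h2j]; exact h1'.1.trans_lt h2'.2
  have l2 : (2 : ℝ) ^ k < 2 ^ (j + 1) := by rw [← h2j]; exact h2'.1.trans_lt h1'.2
  have l1' := (zpow_lt_zpow_iff_right₀ (by norm_num)).1 l1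
  have l2' := (zpow_lt_zpow_iff_right₀ (by norm_num)).1 l2
  have hjk : j = k := by omega
  rw [hjk, hsign]

theorem ae_mem_iUnion_dyadicBand : ∀ᵐ ζ : Plane, ζ ∈ ⋃ i, dyadicBand i := by
  filter_upwards [freqX_ne_zero_ae] with ζ hζ
  obtain ⟨j, hj⟩ := exists_mem_Ico_zpow (abs_pos.2 hζ) (show (1 : ℝ) < 2 by norm_num)
  have h2 : 2 * bandScale j = (2 : ℝ) ^ (j + 1) := by
    rw [bandScale, zpow_add_one₀ (by norm_num), mul_comm]
  rw [mem_iUnion]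
  rcases lt_or_gt_of_ne hζ with h | h
  · refine ⟨(j, false), ?_⟩
    change bandSign false * freqX ζ ∈ Ico (bandScale j) (2 * bandScale j)
    rw [h2]; simpa [bandSign, bandScale, abs_of_neg h] using hj
  · refine ⟨(j, true), ?_⟩
    change bandSign true * freqX ζ ∈ Ico (bandScale j) (2 * bandScale j)
    rw [h2]; simpa [bandSign, bandScale, abs_of_pos h] using hj

/-- The symbol of `∂_x` on a dyadic band. -/
def dyadicDeriv (i : ℤ × Bool) : Plane → ℂ := bandDeriv (bandSign i.2) (bandScale i.1)

theorem isMult_dyadicDeriv (i : ℤ × Bool) : IsMult (dyadicDeriv i) (2 * bandScale i.1) :=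
  isMult_bandDeriv (abs_bandSign _) (bandScale_pos _)

/-- The part of `∂_x f` in a dyadic band. -/
def bandPart (i : ℤ × Bool) (f : L2) : L2 := (𝓕⁻ (mulL2 (dyadicDeriv i) (𝓕 f)) : L2)

theorem inner_bandPart (i : ℤ × Bool) (g f : L2) :
    ⟪g, bandPart i f⟫ = ⟪bandTest (bandSign i.2) (bandScale i.1) g, (𝓕 f : L2)⟫ := by
  have h1 : (𝓕 (bandPart i f) : L2) = mulL2 (dyadicDeriv i) (𝓕 f) :=
    FourierTransform.fourier_fourierInv_eq _
  rw [← Lp.inner_fourier_eq, h1, bandTest,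
    inner_mulL2_left (isMult_bandDeriv (abs_bandSign _) (bandScale_pos _)).conj]
  simp_rw [Complex.conj_conj]
  rfl

theorem toTemperedDistribution_bandPart_apply (i : ℤ × Bool) (f : L2) (φ : 𝓢(Plane, ℂ)) :
    ((bandPart i f : L2) : 𝓢'(Plane, ℂ)) φ
      = ∫ ζ in dyadicBand i, Complex.I * (freqX ζ : ℂ) * ((𝓕⁻ φ) ζ * (𝓕 f : L2) ζ) := by
  rw [bandPart, ← Lp.fourierInv_toTemperedDistribution_eq, TemperedDistribution.fourierInv_apply,
    Lp.toTemperedDistribution_apply, 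
    ← integral_indicator (show MeasurableSet (dyadicBand i) from measurableSet_band _ _)]
  apply integral_congr_ae
  filter_upwards [coeFn_mulL2 (isMult_dyadicDeriv i) (𝓕 f : L2)] with ζ hζ
  rw [hζ, dyadicDeriv, bandDeriv, dyadicBand]
  by_cases h : ζ ∈ band (bandSign i.2) (bandScale i.1)
  · rw [indicator_of_mem h, indicator_of_mem h, smul_eq_mul]; ring
  · rw [indicator_of_notMem h, indicator_of_notMem h]; simp

theorem fourierInv_neg_lineDeriv_apply (φ : 𝓢(Plane, ℂ)) (ζ : Plane) :
    (𝓕⁻ (-∂_{EuclideanSpace.single (0 : Fin 2) (1 : ℝ)} φ)) ζ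
      = Complex.I * (freqX ζ : ℂ) * (𝓕⁻ φ) ζ := by
  have ht : (fun x : Plane => inner ℝ x (EuclideanSpace.single (0 : Fin 2) (1 : ℝ))).HasTemperateGrowth := by
    fun_prop
  rw [FourierTransform.fourierInv_neg, SchwartzMap.fourierInv_lineDerivOp_eq]
  simp only [neg_apply, smul_apply, SchwartzMap.smulLeftCLM_apply_apply ht]
  have hin : inner ℝ ζ (EuclideanSpace.single (0 : Fin 2) (1 : ℝ)) = ζ 0 := by
    rw [EuclideanSpace.inner_single_right]; simp
  rw [hin]
  simp [freqX]
  ring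

theorem lineDeriv_toTemperedDistribution_apply (f : L2) (φ : 𝓢(Plane, ℂ)) :
    (∂_{EuclideanSpace.single (0 : Fin 2) (1 : ℝ)} (f : 𝓢'(Plane, ℂ))) φ
      = ∫ ζ, Complex.I * (freqX ζ : ℂ) * ((𝓕⁻ φ) ζ * (𝓕 f : L2) ζ) ∧
    Integrable (fun ζ => Complex.I * (freqX ζ : ℂ) * ((𝓕⁻ φ) ζ * (𝓕 f : L2) ζ)) := by
  set ψ : 𝓢(Plane, ℂ) := -∂_{EuclideanSpace.single (0 : Fin 2) (1 : ℝ)} φ with hψ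
  have e : ∀ ζ, (𝓕⁻ ψ) ζ * (𝓕 f : L2) ζ
      = Complex.I * (freqX ζ : ℂ) * ((𝓕⁻ φ) ζ * (𝓕 f : L2) ζ) := fun ζ => by
    rw [hψ, fourierInv_neg_lineDeriv_apply]; ring
  have hf : (f : 𝓢'(Plane, ℂ)) = 𝓕⁻ (((𝓕 f : L2)) : 𝓢'(Plane, ℂ)) := by
    rw [Lp.fourierInv_toTemperedDistribution_eq]
    congr 1
    exact (FourierTransform.fourierInv_fourier_eq f).symm
  constructor
  · rw [TemperedDistribution.lineDerivOp_apply_apply, ← hψ, hf,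
      TemperedDistribution.fourierInv_apply, Lp.toTemperedDistribution_apply]
    exact integral_congr_ae (Filter.Eventually.of_forall e)
  · have h1 : Integrable (fun ζ => (𝓕⁻ ψ) ζ * (𝓕 f : L2) ζ) :=
      ((𝓕⁻ ψ).memLp 2 volume).integrable_mul (Lp.memLp (𝓕 f : L2))
    exact h1.congr (Filter.Eventually.of_forall e)

/-- On the Fourier side this is countable additivity of an integral over disjoint bands that cover
almost all frequencies. -/
theorem hasSum_bandPart_apply (f : L2) (φ : 𝓢(Plane, ℂ)) :
    HasSum (fun i => ((bandPart i f : L2) : 𝓢'(Plane, ℂ)) φ)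
      ((∂_{EuclideanSpace.single (0 : Fin 2) (1 : ℝ)} (f : 𝓢'(Plane, ℂ))) φ) := by
  obtain ⟨h1, h2⟩ := lineDeriv_toTemperedDistribution_apply f φ
  have := hasSum_integral_iUnion (s := dyadicBand) (fun i => measurableSet_band _ _)
    pairwise_disjoint_dyadicBand h2.integrableOn
  simp_rw [← toTemperedDistribution_bandPart_apply] at this
  rwa [setIntegral_eq_integral_of_ae_compl_eq_zero, ← h1] at this
  filter_upwards [ae_mem_iUnion_dyadicBand] with ζ hζ hζ'
  exact absurd hζ hζ'

/-- If the right side is finite, the band parts form an absolutely convergent series in `L^∞`, and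
its sum represents `∂_x f` because the pairings with Schwartz functions agree. -/
theorem supNormDerivX_le_tsum (f : L2) :
    supNormDerivX f ≤ ∑' i, dualNorm (bandPart i f) := by
  by_cases htop : ∑' i, dualNorm (bandPart i f) = ∞
  · rw [htop]; exact le_top
  have hfin : ∀ i, dualNorm (bandPart i f) ≠ ∞ := ENNReal.ne_top_of_tsum_ne_top htop
  have hmem : ∀ i, MemLp (bandPart i f) ∞ volume := fun i =>
    ⟨(Lp.memLp (bandPart i f)).1, (eLpNorm_top_le_dualNorm _).trans_lt (hfin i).lt_top⟩
  let g : ℤ × Bool → Lp ℂ ∞ (volume : Measure Plane) := fun i => (hmem i).toLp _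
  have hg : ∀ i, ‖g i‖ₑ ≤ dualNorm (bandPart i f) := fun i => by
    rw [Lp.enorm_toLp]; exact eLpNorm_top_le_dualNorm _
  have hsum : ∑' i, ‖g i‖ₑ ≠ ∞ := ne_top_of_le_ne_top htop (ENNReal.tsum_le_tsum hg)
  have hsummable : Summable g := by
    apply Summable.of_norm
    have := ENNReal.summable_toReal hsum
    simpa using this
  have happ : ∀ i (φ : 𝓢(Plane, ℂ)), ((g i : Lp ℂ ∞ (volume : Measure Plane)) : 𝓢'(Plane, ℂ)) φ
      = ((bandPart i f : L2) : 𝓢'(Plane, ℂ)) φ := fun i φ => by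
    rw [Lp.toTemperedDistribution_apply, Lp.toTemperedDistribution_apply]
    apply integral_congr_ae
    filter_upwards [(hmem i).coeFn_toLp] with x hx
    rw [hx]
  have hG : ((∑' i, g i : Lp ℂ ∞ (volume : Measure Plane)) : 𝓢'(Plane, ℂ))
      = ∂_{EuclideanSpace.single (0 : Fin 2) (1 : ℝ)} (f : 𝓢'(Plane, ℂ)) := by
    ext φ
    have h1 := (hsummable.hasSum.mapL (Lp.toTemperedDistributionCLM ℂ (volume : Measure Plane) ∞)).mapL
      (PointwiseConvergenceCLM.evalCLM (RingHom.id ℂ) ℂ φ)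
    refine h1.unique ?_
    have h2 := hasSum_bandPart_apply f φ
    simp_rw [← happ] at h2
    exact h2
  have h0 : supNormDerivX f ≤ ‖∑' i, g i‖ₑ := iInf₂_le (∑' i, g i) hG
  refine h0.trans ?_
  exact enorm_tsum_le_tsum_enorm.trans (ENNReal.tsum_le_tsum hg)

/-! ### Summation over the frequency bands -/

/-- The indicator function of a frequency band. -/
def bandCut (σ R : ℝ) (ζ : Plane) : ℂ := (band σ R).indicator (fun _ => 1) ζ

theorem isMult_bandCut (σ R : ℝ) : IsMult (bandCut σ R) 1 := by
  refine ⟨measurable_const.indicator (measurableSet_band σ R), fun ζ => ?_⟩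
  by_cases h : ζ ∈ band σ R
  · rw [bandCut, indicator_of_mem h, norm_one]
  · rw [bandCut, indicator_of_notMem h, norm_zero]; exact zero_le_one

theorem conj_bandCut (σ R : ℝ) (ζ : Plane) :
    starRingEnd ℂ (bandCut σ R ζ) = bandCut σ R ζ := by
  by_cases h : ζ ∈ band σ R
  · rw [bandCut, indicator_of_mem h, map_one]
  · rw [bandCut, indicator_of_notMem h, map_zero]

theorem mulL2_bandCut_bandTest {σ R : ℝ} (hσ : |σ| = 1) (hR : 0 < R) (g : L2) :
    mulL2 (bandCut σ R) (bandTest σ R g) = bandTest σ R g := by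
  rw [bandTest, mulL2_mulL2 (isMult_bandCut σ R) (isMult_bandDeriv hσ hR).conj]
  congr 1
  ext ζ
  by_cases h : ζ ∈ band σ R
  · rw [bandCut, indicator_of_mem h, one_mul]
  · rw [bandDeriv, indicator_of_notMem h, map_zero, mul_zero]

theorem inner_grp_bandTest_bandCut {σ R : ℝ} (hσ : |σ| = 1) (hR : 0 < R) (α τ : ℝ) (g v : L2) :
    ⟪grp α τ (bandTest σ R g), mulL2 (bandCut σ R) v⟫ = ⟪grp α τ (bandTest σ R g), v⟫ := by
  have h := inner_mulL2_left (isMult_bandCut σ R) (grp α τ (bandTest σ R g)) v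
  simp_rw [conj_bandCut] at h
  rw [← h, ← grp_mulL2 (isMult_bandCut σ R), mulL2_bandCut_bandTest hσ hR]

theorem inner_bandTest_bandCut {σ R : ℝ} (hσ : |σ| = 1) (hR : 0 < R) (g v : L2) :
    ⟪bandTest σ R g, mulL2 (bandCut σ R) v⟫ = ⟪bandTest σ R g, v⟫ := by
  simpa only [grp_zero] using inner_grp_bandTest_bandCut hσ hR 0 0 g v

theorem isDispersive_band {α σ R ε T p q : ℝ} {w F : ℝ → L2} (h : IsSolution α T w F)
    (hσ : |σ| = 1) (hR : 0 < R) (hα : -1 ≤ α) (hα1 : α ≤ 1) (hε : 0 ≤ ε) (hε1 : ε ≤ 1)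
    (hT : 0 ≤ T) (hp : 0 ≤ p) (hq : q ≤ T) :
    IsDispersive (grp α) (fun n => bandTest σ R (testSeq n))
      (fun t => mulL2 (bandCut σ R) (𝓕 (w (projIcc 0 T hT t)) : L2))
      (fun s => mulL2 (bandCut σ R) (𝓕 (F s) : L2))
      (2000 * R ^ (2 - α / 2 + ε)) (5 / 6 - ε / 3) p q where
  cont := continuous_grp α
  norm_le := norm_grp_le α
  cont_v := (continuous_mulL2 (isMult_bandCut σ R)).comp
    ((continuousOn_fourier h.continuousOn).comp_continuous
      (continuous_subtype_val.comp continuous_projIcc) fun t => (projIcc 0 T hT t).2)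
  int_f := by
    have h1 : IntegrableOn (fun s => (𝓕 (F s) : L2)) (Ioc p q) :=
      (integrableOn_fourier h.integrableOn).mono_set
        fun t ht => ⟨hp.trans ht.1.le, ht.2.trans hq⟩
    refine h1.norm.mono' ((continuous_mulL2 (isMult_bandCut σ R)).comp_aestronglyMeasurable h1.1)
      (Filter.Eventually.of_forall fun s => ?_)
    simpa using norm_mulL2_le (isMult_bandCut σ R) (𝓕 (F s) : L2)
  duhamel n t ht := by
    have e : ∀ t, 0 ≤ t → t ≤ T → ((projIcc 0 T hT t : Icc 0 T) : ℝ) = t := fun t h0 h1 => by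
      rw [projIcc_of_mem hT ⟨h0, h1⟩]
    simp only [inner_grp_bandTest_bandCut hσ hR, inner_bandTest_bandCut hσ hR]
    rw [e t (hp.trans ht.1.le) (ht.2.trans hq), e p hp (ht.1.le.trans (ht.2.trans hq))]
    exact duhamel h _ hp ht.1.le (ht.2.trans hq)
  decay n m s t t' htt := by
    have := norm_inner_grp_bandTest_le (R := R) hσ hα hα1 hR hε hε1 (testSeq_mem n) (testSeq_mem m)
      (t := t - s) (t' := t' - s) (fun e => htt (by linarith))
    rwa [neg_sub, neg_sub, sub_sub_sub_cancel_right, ← mul_assoc] at this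

theorem enorm_mulL2_bandCut_le {σ R C : ℝ} {m : Plane → ℝ} (hC : 0 ≤ C)
    (hm : ∀ ζ ∈ band σ R, 1 ≤ C * m ζ) (f : L2) :
    ‖mulL2 (bandCut σ R) (𝓕 f : L2)‖ₑ ≤ ENNReal.ofReal C * multiplierNorm m f := by
  rw [Lp.enorm_def, eLpNorm_congr_ae (coeFn_mulL2 (isMult_bandCut σ R) (𝓕 f : L2)), multiplierNorm]
  refine eLpNorm_le_mul_eLpNorm_of_ae_le_mul (Filter.Eventually.of_forall fun ζ => ?_) 2
  by_cases h : ζ ∈ band σ R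
  · rw [bandCut, indicator_of_mem h, one_mul, norm_mul, ← mul_assoc, Complex.norm_real,
      Real.norm_eq_abs]
    have h1 : 1 ≤ C * |m ζ| := (hm ζ h).trans (by gcongr; exact le_abs_self _)
    exact le_mul_of_one_le_left (norm_nonneg _) h1
  · rw [bandCut, indicator_of_notMem h, zero_mul, norm_zero]; positivity

theorem enorm_mulL2_bandCut_le_normDx {σ R s : ℝ} (hσ : |σ| = 1) (hR : 0 < R) (hs : 0 ≤ s)
    (f : L2) :
    ‖mulL2 (bandCut σ R) (𝓕 f : L2)‖ₑ ≤ ENNReal.ofReal (R ^ (-s)) * normDx s f := by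
  refine enorm_mulL2_bandCut_le (by positivity) (fun ζ h => ?_) f
  have h1 : R ≤ |freqX ζ| := by rw [abs_freqX_of_mem_band hσ hR h]; exact h.1
  rw [Real.rpow_neg hR.le, le_inv_mul_iff₀ (by positivity), mul_one]
  exact Real.rpow_le_rpow hR.le h1 hs

theorem enorm_mulL2_bandCut_le_normJx {σ R s : ℝ} (hσ : |σ| = 1) (hR : 0 < R) (hs : 0 ≤ s)
    (f : L2) :
    ‖mulL2 (bandCut σ R) (𝓕 f : L2)‖ₑ ≤ ENNReal.ofReal (R ^ (-s)) * normJx s f := by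
  refine enorm_mulL2_bandCut_le (by positivity) (fun ζ h => ?_) f
  have h1 : R ≤ |freqX ζ| := by rw [abs_freqX_of_mem_band hσ hR h]; exact h.1
  rw [Real.rpow_neg hR.le, le_inv_mul_iff₀ (by positivity), mul_one]
  calc R ^ s = (R ^ (2 : ℝ)) ^ (s / 2) := by rw [← Real.rpow_mul hR.le]; congr 1; ring
    _ ≤ _ := by
      refine Real.rpow_le_rpow (by positivity) ?_ (by positivity)
      rw [Real.rpow_two]; nlinarith

theorem enorm_mulL2_bandCut_le_normJx_one {σ R s : ℝ} (hs : 0 ≤ s) (f : L2) :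
    ‖mulL2 (bandCut σ R) (𝓕 f : L2)‖ₑ ≤ ENNReal.ofReal 1 * normJx s f := by
  refine enorm_mulL2_bandCut_le zero_le_one (fun ζ _ => ?_) f
  rw [one_mul]
  exact Real.one_le_rpow (by nlinarith [sq_nonneg |freqX ζ|]) (by positivity)

/-- The endpoint contribution is paid once per step, but the forcing only once in total, since the
steps are disjoint. -/
theorem lintegral_Ioc_le_of_step {φ ψ : ℝ → ℝ≥0∞} {C A : ℝ≥0∞} {δ : ℝ} (hδ : 0 ≤ δ) (K : ℕ)
    (h : ∀ k < K, ∫⁻ t in Ioc (k * δ) ((k + 1) * δ), φ t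
      ≤ C * (A + ∫⁻ t in Ioc (k * δ) ((k + 1) * δ), ψ t)) :
    ∫⁻ t in Ioc 0 (K * δ), φ t ≤ C * (K * A + ∫⁻ t in Ioc 0 (K * δ), ψ t) := by
  induction K with
  | zero => simp
  | succ K ih =>
    have hu : Ioc 0 ((K + 1 : ℕ) * δ) = Ioc 0 (K * δ) ∪ Ioc (K * δ) ((K + 1) * δ) := by
      rw [Ioc_union_Ioc_eq_Ioc (by positivity) (by nlinarith)]; push_cast; rfl
    have hd : Disjoint (Ioc 0 (K * δ)) (Ioc (K * δ) ((K + 1) * δ)) :=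
      Ioc_disjoint_Ioc_of_le le_rfl
    rw [hu, lintegral_union measurableSet_Ioc hd, lintegral_union measurableSet_Ioc hd]
    refine (add_le_add (ih fun k hk => h k (hk.trans (Nat.lt_succ_self K)))
      (h K (Nat.lt_succ_self K))).trans (le_of_eq ?_)
    push_cast; ring

theorem lintegral_dualNorm_bandPart_le {α ε T p q : ℝ} {w F : ℝ → L2} (h : IsSolution α T w F)
    (hα : -1 ≤ α) (hα1 : α ≤ 1) (hε : 0 ≤ ε) (hε1 : ε ≤ 1) (hp : 0 ≤ p) (hpq : p ≤ q)
    (hq : q ≤ T) (i : ℤ × Bool) :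
    ∫⁻ t in Ioc p q, dualNorm (bandPart i (w t)) ≤
      ENNReal.ofReal (160 * bandScale i.1 ^ (1 - α / 4 + ε / 2) * (q - p) ^ (7 / 12 + ε / 6)) *
        (‖mulL2 (bandCut (bandSign i.2) (bandScale i.1)) (𝓕 (w p) : L2)‖ₑ +
          ∫⁻ s in Ioc p q, ‖mulL2 (bandCut (bandSign i.2) (bandScale i.1)) (𝓕 (F s) : L2)‖ₑ) := by
  have hT : 0 ≤ T := hp.trans (hpq.trans hq)
  have hσ := abs_bandSign i.2
  have hR := bandScale_pos i.1
  set σ := bandSign i.2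
  set R := bandScale i.1
  have key := (isDispersive_band h hσ hR hα hα1 hε hε1 hT hp hq).lintegral_iSup_le
    (by positivity) (by linarith) hpq
  have e : ∀ t, 0 ≤ t → t ≤ T → ((projIcc 0 T hT t : Icc 0 T) : ℝ) = t := fun t h0 h1 => by
    rw [projIcc_of_mem hT ⟨h0, h1⟩]
  rw [e p hp (hpq.trans hq)] at key
  refine (le_of_eq ?_).trans (key.trans (mul_le_mul_left (ENNReal.ofReal_le_ofReal ?_) _))
  · refine setLIntegral_congr_fun measurableSet_Ioc fun t ht => ?_
    simp only [dualNorm, inner_bandPart, inner_bandTest_bandCut hσ hR]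
    rw [e t (hp.trans ht.1.le) (ht.2.trans hq)]
  · rw [show 1 - (5 / 6 - ε / 3) / 2 = 7 / 12 + ε / 6 by ring]
    refine mul_le_mul_of_nonneg_right ?_ (Real.rpow_nonneg (by linarith) _)
    apply Real.sqrt_le_iff.2 ⟨by positivity, ?_⟩
    -- The constant `160` comes from `2000 * 12 ≤ 160 ^ 2`.
    have h1 : 2 / (1 - (5 / 6 - ε / 3)) ≤ 12 := by
      rw [div_le_iff₀ (by linarith)]; linarith
    have h2 : R ^ (2 - α / 2 + ε) = (R ^ (1 - α / 4 + ε / 2)) ^ 2 := by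
      rw [← Real.rpow_natCast, ← Real.rpow_mul hR.le]; congr 1; push_cast; ring
    rw [h2, mul_pow]
    have h3 : 0 ≤ (R ^ (1 - α / 4 + ε / 2)) ^ 2 := by positivity
    nlinarith [mul_le_mul_of_nonneg_left h1 h3]

theorem bandScale_natCast_rpow (n : ℕ) (x : ℝ) : bandScale n ^ x = ((2 : ℝ) ^ x) ^ n := by
  rw [bandScale, zpow_natCast, ← Real.rpow_natCast, ← Real.rpow_natCast, ← Real.rpow_mul (by norm_num),
    ← Real.rpow_mul (by norm_num), mul_comm]

/-- For `R = 2^n ≥ 1` the choice `K = R` balances both exponents to exactly `-ε/3`. For `R ≤ 1` the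
choice `K = 1` works, because both powers of `R` are at least `ε/3`; there `a = 1` suffices, as
`J_x^s` has a symbol at least `1`. -/
theorem exists_partition_size {α ε s s' : ℝ} (hα1 : α ≤ 1) (hε : 0 ≤ ε)
    (hε1 : ε ≤ 1) (hs : s = 17 / 12 - α / 4 + 2 * ε / 3) (hs' : s' = 5 / 12 - α / 4 + 2 * ε / 3)
    (j : ℤ) :
    ∃ K : ℕ, 0 < K ∧ ∃ a : ℝ, (a = 1 ∨ a = bandScale j ^ (-s)) ∧
      bandScale j ^ (1 - α / 4 + ε / 2) * (K : ℝ) ^ (-(7 / 12 + ε / 6)) * (K * a)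
        ≤ ((2 : ℝ) ^ (-(ε / 3))) ^ j.natAbs ∧
      bandScale j ^ (1 - α / 4 + ε / 2) * (K : ℝ) ^ (-(7 / 12 + ε / 6)) * bandScale j ^ (-s')
        ≤ ((2 : ℝ) ^ (-(ε / 3))) ^ j.natAbs := by
  subst hs hs'
  have hR := bandScale_pos j
  obtain ⟨n, rfl | rfl⟩ := j.eq_nat_or_neg
  · have hK : ((2 ^ n : ℕ) : ℝ) = bandScale n := by rw [bandScale]; push_cast; rfl
    refine ⟨2 ^ n, by positivity, _, Or.inr rfl, ?_, ?_⟩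
    · rw [hK, Int.natAbs_natCast, ← bandScale_natCast_rpow, ← Real.rpow_add hR]
      nth_rw 2 [← Real.rpow_one (bandScale n)]
      rw [← Real.rpow_add hR, ← Real.rpow_add hR]
      apply le_of_eq; congr 1; ring
    · rw [hK, Int.natAbs_natCast, ← bandScale_natCast_rpow, ← Real.rpow_add hR,
        ← Real.rpow_add hR]
      apply le_of_eq; congr 1; ring
  · have hR1 : bandScale (-n) ≤ 1 := by
      rw [bandScale, zpow_neg, zpow_natCast]; exact inv_le_one_of_one_le₀ (one_le_pow₀ (by norm_num))
    have hw : ((2 : ℝ) ^ (-(ε / 3))) ^ (-(n : ℤ)).natAbs = bandScale (-n) ^ (ε / 3) := by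
      rw [Int.natAbs_neg, Int.natAbs_natCast, ← bandScale_natCast_rpow, bandScale, bandScale,
        zpow_neg, Real.inv_rpow (by positivity), Real.rpow_neg (by positivity)]
    refine ⟨1, one_pos, 1, Or.inl rfl, ?_, ?_⟩
    · rw [hw, Nat.cast_one, Real.one_rpow, mul_one, mul_one, mul_one]
      exact Real.rpow_le_rpow_of_exponent_ge hR hR1 (by linarith)
    · rw [hw, Nat.cast_one, Real.one_rpow, mul_one, ← Real.rpow_add hR]
      exact Real.rpow_le_rpow_of_exponent_ge hR hR1 (by linarith)

/-- The band estimate is applied on `K` intervals of length `T / K`, each restarted from its left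
endpoint, where the data are controlled by the supremum in time. -/
theorem lintegral_dualNorm_bandPart_le_geometric {α ε T s s' : ℝ} {w F : ℝ → L2}
    (h : IsSolution α T w F) (hα : -1 ≤ α) (hα1 : α ≤ 1) (hε : 0 ≤ ε) (hε1 : ε ≤ 1) (hT : 0 < T)
    (hs : s = 17 / 12 - α / 4 + 2 * ε / 3) (hs' : s' = 5 / 12 - α / 4 + 2 * ε / 3)
    (i : ℤ × Bool) :
    ∫⁻ t in Ioc 0 T, dualNorm (bandPart i (w t)) ≤
      ENNReal.ofReal (160 * T ^ (7 / 12 + ε / 6) * ((2 : ℝ) ^ (-(ε / 3))) ^ i.1.natAbs) *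
        ((⨆ t ∈ Icc 0 T, normJx s (w t)) + ∫⁻ t in Ioc 0 T, normDx s' (F t)) := by
  obtain ⟨K, hK, a, ha, b1, b2⟩ := exists_partition_size hα1 hε hε1 hs hs' i.1
  have hs0 : 0 ≤ s := by linarith
  have hs0' : 0 ≤ s' := by linarith
  have hσ := abs_bandSign i.2
  have hR := bandScale_pos i.1
  have hK0 : (0 : ℝ) < K := Nat.cast_pos.2 hK
  set J := ⨆ t ∈ Icc 0 T, normJx s (w t)
  have ha0 : 0 ≤ a := by rcases ha with rfl | rfl <;> positivity
  have hA : ∀ t ∈ Icc 0 T, ‖mulL2 (bandCut (bandSign i.2) (bandScale i.1)) (𝓕 (w t) : L2)‖ₑ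
      ≤ ENNReal.ofReal a * J := fun t ht => by
    have h1 : normJx s (w t) ≤ J := le_iSup₂ (f := fun t (_ : t ∈ Icc 0 T) => normJx s (w t)) t ht
    refine le_trans ?_ (mul_le_mul_right h1 _)
    rcases ha with rfl | rfl
    · exact enorm_mulL2_bandCut_le_normJx_one hs0 _
    · exact enorm_mulL2_bandCut_le_normJx hσ hR hs0 _
  have hB : ∫⁻ t in Ioc 0 T, ‖mulL2 (bandCut (bandSign i.2) (bandScale i.1)) (𝓕 (F t) : L2)‖ₑ
      ≤ ENNReal.ofReal (bandScale i.1 ^ (-s')) * ∫⁻ t in Ioc 0 T, normDx s' (F t) := by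
    rw [← lintegral_const_mul' _ _ ENNReal.ofReal_ne_top]
    exact lintegral_mono fun t => enorm_mulL2_bandCut_le_normDx hσ hR hs0' _
  set C := 160 * bandScale i.1 ^ (1 - α / 4 + ε / 2) * (T / K) ^ (7 / 12 + ε / 6) with hC
  have hC0 : 0 ≤ C := by positivity
  have hC' : C = 160 * T ^ (7 / 12 + ε / 6)
      * (bandScale i.1 ^ (1 - α / 4 + ε / 2) * (K : ℝ) ^ (-(7 / 12 + ε / 6))) := by
    rw [hC, Real.div_rpow hT.le hK0.le, Real.rpow_neg hK0.le]; ring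
  have hKT : K * (T / K) = T := mul_div_cancel₀ T hK0.ne'
  have step := lintegral_Ioc_le_of_step (φ := fun t => dualNorm (bandPart i (w t)))
    (ψ := fun t => ‖mulL2 (bandCut (bandSign i.2) (bandScale i.1)) (𝓕 (F t) : L2)‖ₑ)
    (C := ENNReal.ofReal C) (A := ENNReal.ofReal a * J) (δ := T / K) (by positivity) K
    (fun k hk => by
      have hk1 : ((k : ℝ) + 1) ≤ K := by exact_mod_cast hk
      have hkT : ((k : ℝ) + 1) * (T / K) ≤ T := by
        calc ((k : ℝ) + 1) * (T / K) ≤ K * (T / K) := by gcongr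
          _ = T := hKT
      have hkk : (k : ℝ) * (T / K) ≤ (k + 1) * (T / K) := by gcongr; linarith
      refine (lintegral_dualNorm_bandPart_le h hα hα1 hε hε1 (by positivity) hkk hkT i).trans ?_
      rw [show ((k : ℝ) + 1) * (T / K) - k * (T / K) = T / K by ring]
      exact mul_le_mul_right (add_le_add_left (hA _ ⟨by positivity, hkk.trans hkT⟩) _) _)
  rw [hKT] at step
  refine step.trans ?_
  rw [mul_add, mul_add]
  refine add_le_add ?_ ((mul_le_mul_right hB _).trans ?_)
  · rw [← ENNReal.ofReal_natCast, ← mul_assoc, ← mul_assoc, ← ENNReal.ofReal_mul hC0,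
      ← ENNReal.ofReal_mul (by positivity)]
    refine mul_le_mul_left (ENNReal.ofReal_le_ofReal ?_) _
    rw [hC', mul_assoc _ (K : ℝ) a, mul_assoc (160 * T ^ (7 / 12 + ε / 6))]
    exact mul_le_mul_of_nonneg_left b1 (by positivity)
  · rw [← mul_assoc, ← ENNReal.ofReal_mul hC0]
    refine mul_le_mul_left (ENNReal.ofReal_le_ofReal ?_) _
    rw [hC', mul_assoc]
    exact mul_le_mul_of_nonneg_left b2 (by positivity)

theorem aemeasurable_dualNorm_bandPart {T : ℝ} {w : ℝ → L2} (hw : ContinuousOn w (Icc 0 T))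
    (i : ℤ × Bool) :
    AEMeasurable (fun t => dualNorm (bandPart i (w t))) (volume.restrict (Ioc 0 T)) := by
  simp only [dualNorm, inner_bandPart]
  refine AEMeasurable.iSup fun n => ContinuousOn.aemeasurable ?_ measurableSet_Ioc
  exact ((continuousOn_const.inner (𝕜 := ℂ) (continuousOn_fourier hw)).mono Ioc_subset_Icc_self).enorm

theorem summable_pow_natAbs {r : ℝ} (h0 : 0 ≤ r) (h1 : r < 1) :
    Summable fun i : ℤ × Bool => r ^ i.1.natAbs := by
  have hZ : Summable fun j : ℤ => r ^ j.natAbs :=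
    Summable.of_nat_of_neg (by simpa using summable_geometric_of_lt_one h0 h1)
      (by simpa using summable_geometric_of_lt_one h0 h1)
  have := hZ.mul_of_nonneg (g := fun _ : Bool => (1 : ℝ)) (Summable.of_finite)
    (fun _ => by positivity) (fun _ => zero_le_one)
  simpa using this

end ZKKP

end

theorem mainTheorem11 (ε : ℝ) (hε0 : 0 < ε) (hε1 : ε < 1) :
    ∃ c : ℝ, 0 < c ∧
      ∀ α : ℝ, -1 ≤ α → α ≤ 1 → ∀ T : ℝ, 0 < T →
        ∀ w F : ℝ → ZKKP.L2, ZKKP.IsSolution α T w F →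
          ∫⁻ t in Icc 0 T, ZKKP.supNormDerivX (w t) ≤
            ENNReal.ofReal (c * T ^ ((7 + 2 * ε) / 12)) *
              ((⨆ t ∈ Icc 0 T, ZKKP.normJx (17 / 12 - α / 4 + 2 * ε / 3) (w t)) +
                ∫⁻ t in Icc 0 T, ZKKP.normDx (5 / 12 - α / 4 + 2 * ε / 3) (F t)) := by
  set r : ℝ := (2 : ℝ) ^ (-(ε / 3)) with hr
  have hr0 : 0 < r := by positivity
  have hr1 : r < 1 := Real.rpow_lt_one_of_one_lt_of_neg (by norm_num) (by linarith)
  have hsum := ZKKP.summable_pow_natAbs hr0.le hr1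
  have hpos : 0 < ∑' i : ℤ × Bool, r ^ i.1.natAbs :=
    hsum.tsum_pos (fun i => by positivity) (0, true) (by positivity)
  refine ⟨160 * ∑' i : ℤ × Bool, r ^ i.1.natAbs, by positivity, ?_⟩
  intro α hα hα1 T hT w F h
  -- Half-open intervals are used throughout because they concatenate; the endpoint `0` is a null
  -- set.
  rw [← setLIntegral_congr (f := fun t => ZKKP.supNormDerivX (w t)) Ioc_ae_eq_Icc,
    ← setLIntegral_congr (f := fun t => ZKKP.normDx (5 / 12 - α / 4 + 2 * ε / 3) (F t))
      Ioc_ae_eq_Icc]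
  refine (lintegral_mono fun t => ZKKP.supNormDerivX_le_tsum (w t)).trans ?_
  rw [lintegral_tsum fun i => ZKKP.aemeasurable_dualNorm_bandPart h.continuousOn i]
  refine (ENNReal.tsum_le_tsum fun i => ZKKP.lintegral_dualNorm_bandPart_le_geometric h hα hα1
    hε0.le hε1.le hT rfl rfl i).trans (le_of_eq ?_)
  rw [ENNReal.tsum_mul_right, ← ENNReal.ofReal_tsum_of_nonneg (fun i => by positivity)
    (hsum.mul_left _), tsum_mul_left, show 7 / 12 + ε / 6 = (7 + 2 * ε) / 12 by ring]
  congr 2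
  ring
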